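/- Let $N\ge 1$ and let $\omega_1,\dots,\omega_N\in\mathbb R$ be non-resonant: $\sum m_i\omega_i=0$ with $m_i\in\mathbb Z$ only if all $m_i=0$. Consider the system $\dot x=Ax+Bu$, $|u|\le1$, with $x=(x_1,y_1,\dots,x_N,y_N)\in\mathbb R^{2N}$, that is $\dot x_i=y_i$, $\dot y_i=-\omega_i^2x_i+u$. Let $\tau(x)$ be the minimum time in which a measurable control with $|u|\le1$ steers $x$ to $0$. **Control $u_U$.** For $p=(\xi_1,\eta_1,\dots,\xi_N,\eta_N)$ put $z_i=(\eta_i^2+\omega_i^{-2}\xi_i^2)^{1/2}$ and $H(p)=(2\pi)^{-N}\int_{[0,2\pi]^N}\bigl|\sum_i z_i\cos\varphi_i\bigr|\,d\varphi$. Let $\Omega$ be the convex body with support function $H$, and let $\rho$ be its Minkowski functional, so that $x\in\rho(x)\,\partial\Omega$. For $x\ne0$ let $p(x)$ be a solution of $\rho(x)^{-1}x=\frac{\partial H}{\partial p}(p)$ (unique up to a positive factor). For $0<U\le1$ put $u_U(x)=-U\operatorname{sign}(B,p(x))$, where $\operatorname{sign}0$ may be any number in $[-1,1]$; motions under $u_U$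 are absolutely continuous solutions of the corresponding differential inclusion. **Terminal control.** Let $C=(c_1,0,\dots,c_N,0)$ with $c_k=(-1)^{N+1}\omega_k^{2N}\prod_{i\ne k}(\omega_i^2-\omega_k^2)^{-1}$. Let $D$ be the $2N\times 2N$ matrix with columns $\frac{(-1)^{i-1}}{(i-1)!}(A+BC)^{i-1}B$, $i=1,\dots,2N$. Let $\mathfrak q=\bigl([(i+j)(i+j-1)]^{-1}\bigr)_{i,j=1}^{2N}$, $\mathfrak Q=\mathfrak q^{-1}$, $\delta(T)=\mathrm{diag}(T,T^2,\dots,T^{2N})^{-1}$ and $\mathfrak C=-\frac12 e_1^*\mathfrak Q$, where $e_1=(1,0,\dots,0)^*$. For $w\in\mathbb R^{2N}\setminus\{0\}$ let $\mathfrak T(w)>0$ be the unique solution $T$ of $(\mathfrak Q\delta(T)w,\delta(T)w)=\frac1{2N(2N+1)}$, and put $\mathfrak T(0)=0$. The terminal control is $u(x)=\mathfrak C\,\delta(\mathfrak T(w))\,w+Cx$ with $w=D^{-1}x$ (and $u(0)=0$). For $\Theta>0$ put $G_\Theta=\{x:\mathfrak T(D^{-1}x)\le\Theta\}$. **Three-stage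 control.** Given $R,U,\Theta$, it uses $u_1$ until $\rho(x)\le R$, then $u_U$ until $G_\Theta$ is reached, and then the terminal control. **Theorem.** There is a constant $C_0=C_0(\omega_1,\dots,\omega_N)>0$ such that the following holds for every $\bar C\ge C_0$. 1. The inclusion (B) $G_\Theta\subset\{|Cx|\le\frac12\}$ holds for all sufficiently small $\Theta>0$. For every $\Theta>0$, the inclusion (A) $\{\rho\le U\bar C\}\subset G_\Theta$ holds for all sufficiently small $U>0$. 2. Let $R\ge\bar C$, $\Theta>0$ and $0<U\le1$ be such that (A) and (B) hold. Then from every $x$ there is a motion under the three-stage control, and every such motion satisfies $|u|\le1$ almost everywhere and reaches $0$ in finite time. If $T(x)$ denotes the time of first arrival at $0$ of any such motion from $x$, then, as $\rho(x)\to+\infty$, $$\rho(x)/T(x)=1+o(1),\qquad \tau(x)/T(x)=1+o(1).$$ -/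

import Mathlib

open MeasureTheory Filter Topology Matrix

noncomputable section

namespace Oscillators

/-- Phase vectors `(x₁, y₁, …, x_N, y_N)`; `(i, 0)` is the position `x_i`, `(i, 1)` the
velocity `y_i` of the `i`-th oscillator. -/
abbrev State (N : ℕ) : Type := Fin N × Fin 2 → ℝ

/-- Square matrices acting on phase vectors. -/
abbrev Mat (N : ℕ) : Type := Matrix (Fin N × Fin 2) (Fin N × Fin 2) ℝ

variable {N : ℕ}

/-- Position (counted from 1) of an index in the ordering `x₁, y₁, x₂, y₂, …, x_N, y_N`. -/
def pos (a : Fin N × Fin 2) : ℕ := 2 * (a.1 : ℕ) + (a.2 : ℕ) + 1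

/-- The block diagonal system matrix with the blocks `(0, 1; -ω_i², 0)`. -/
def sysA (ω : Fin N → ℝ) : Mat N := fun a b =>
  if a.1 = b.1 then
    (if a.2 = 0 ∧ b.2 = 1 then 1 else if a.2 = 1 ∧ b.2 = 0 then -(ω a.1) ^ 2 else 0)
  else 0

/-- The input vector `(0, 1, 0, 1, …, 0, 1)`. -/
def sysB (N : ℕ) : State N := fun a => if a.2 = 1 then 1 else 0

/-- `y` solves `ẏ = A y + B u`, `y(0) = x`, on `[0, ∞)` in the sense of Carathéodory. -/
structure IsTrajectory (ω : Fin N → ℝ) (x : State N) (y : ℝ → State N) (u : ℝ → ℝ) : Prop where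
  continuousOn : ContinuousOn y (Set.Ici 0)
  intervalIntegrable : ∀ t, 0 ≤ t → IntervalIntegrable u volume 0 t
  eq_integral : ∀ t, 0 ≤ t → y t = x + ∫ s in (0 : ℝ)..t, (sysA ω *ᵥ y s + u s • sysB N)

/-- The constraint `|u| ≤ 1` (at almost every time). -/
def IsAdmissible (u : ℝ → ℝ) : Prop :=
  ∀ᵐ t ∂(volume.restrict (Set.Ici (0 : ℝ))), |u t| ≤ 1

/-- The minimum time needed to steer `x` to the equilibrium by an admissible control. -/
def minTime (ω : Fin N → ℝ) (x : State N) : ℝ :=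
  sInf {T : ℝ | 0 ≤ T ∧ ∃ (y : ℝ → State N) (u : ℝ → ℝ),
    IsTrajectory ω x y u ∧ IsAdmissible u ∧ y T = 0}

/-! ### The limit shape of the reachable sets and the high-energy control -/

/-- The mean value of `|∑ z_i cos φ_i|` over the torus. -/
def meanAbs (z : Fin N → ℝ) : ℝ :=
  ((2 * Real.pi) ^ N)⁻¹ *
    ∫ φ in Set.Icc (0 : Fin N → ℝ) (fun _ => 2 * Real.pi), |∑ i, z i * Real.cos (φ i)|

/-- The amplitudes `z_i = (η_i² + ω_i⁻² ξ_i²)^{1/2}` of a momentum `p = (ξ_i, η_i)`. -/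
def amplitude (ω : Fin N → ℝ) (p : State N) (i : Fin N) : ℝ :=
  Real.sqrt ((p (i, 1)) ^ 2 + ((ω i) ^ 2)⁻¹ * (p (i, 0)) ^ 2)

/-- The support function of the convex body `Ω`. -/
def supportFn (ω : Fin N → ℝ) (p : State N) : ℝ := meanAbs (amplitude ω p)

/-- The convex body `Ω` with the support function `supportFn`. -/
def body (ω : Fin N → ℝ) : Set (State N) := {x | ∀ p : State N, x ⬝ᵥ p ≤ supportFn ω p}

/-- The polar radius: `x = ρ(x) φ` with `φ ∈ ∂Ω`. -/
def rho (ω : Fin N → ℝ) (x : State N) : ℝ := gauge (body ω) x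

/-- `p` is a momentum at `x`: the gradient of the support function of `Ω` at `p` exists and
equals `ρ(x)⁻¹ x`. (For `x ≠ 0` this determines `p` up to a positive factor.) -/
def IsMomentum (ω : Fin N → ℝ) (x p : State N) : Prop :=
  ∃ L : State N →L[ℝ] ℝ, (∀ q, L q = ((rho ω x)⁻¹ • x) ⬝ᵥ q) ∧ HasFDerivAt (supportFn ω) L p

/-- `v` is a value at `x` of the feedback `-U sign (B, p(x))`, where, as for dry friction, the
sign of `0` may be any number in `[-1, 1]`. `U = 1` is the high-energy control and `U < 1`
the reduced one. -/
def IsSignFeedback (ω : Fin N → ℝ) (U : ℝ) (x : State N) (v : ℝ) : Prop :=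
  ∃ p, IsMomentum ω x p ∧ |v| ≤ U ∧
    (0 < sysB N ⬝ᵥ p → v = -U) ∧ (sysB N ⬝ᵥ p < 0 → v = U)

/-! ### The terminal control -/

/-- The row `C = (c₁, 0, c₂, 0, …, c_N, 0)`,
`c_k = (-1)^{N+1} ω_k^{2N} ∏_{i ≠ k} (ω_i² - ω_k²)⁻¹`, of the linear feedback. -/
def feedbackC (ω : Fin N → ℝ) : State N := fun a =>
  if a.2 = 0 then
    (-1) ^ (N + 1) * (ω a.1) ^ (2 * N) *
      ∏ i ∈ Finset.univ.erase a.1, ((ω i) ^ 2 - (ω a.1) ^ 2)⁻¹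
  else 0

/-- The matrix `D` with the columns `(-1)^{i-1}/(i-1)! (A + BC)^{i-1} B`, `i = 1, …, 2N`. -/
def gaugeD (ω : Fin N → ℝ) : Mat N := fun a b =>
  (((-1) ^ (pos b - 1) / ((pos b - 1).factorial : ℝ)) •
    (((sysA ω + vecMulVec (sysB N) (feedbackC ω)) ^ (pos b - 1)) *ᵥ sysB N)) a

/-- The canonical coordinates `D⁻¹ x` of a phase vector. -/
def canon (ω : Fin N → ℝ) (x : State N) : State N := (gaugeD ω)⁻¹ *ᵥ x

/-- `𝔮_{ij} = [(i + j)(i + j - 1)]⁻¹`. -/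
def matq (N : ℕ) : Mat N := fun a b =>
  (((pos a : ℝ) + pos b) * ((pos a : ℝ) + pos b - 1))⁻¹

/-- `𝔔 = 𝔮⁻¹`. -/
def matQ (N : ℕ) : Mat N := (matq N)⁻¹

/-- The first standard basis vector. -/
def canonB (N : ℕ) : State N := fun a => if pos a = 1 then 1 else 0

/-- The row `-(1/2) 𝔅* 𝔔`. -/
def canonC (N : ℕ) : State N := (-(1 / 2) : ℝ) • (canonB N ᵥ* matQ N)

/-- `δ(T) = diag(T, T², …, T^{2N})⁻¹`. -/
def delta (N : ℕ) (T : ℝ) : Mat N := diagonal fun a => (T ^ pos a)⁻¹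

/-- The constant `κ² = 1 / (2N(2N+1))`. -/
def kappaSq (N : ℕ) : ℝ := 1 / (2 * N * (2 * N + 1))

/-- The quadratic form `(𝔔 δ(T) w, δ(T) w)`. -/
def lyapunov (T : ℝ) (w : State N) : ℝ :=
  (matQ N *ᵥ (delta N T *ᵥ w)) ⬝ᵥ (delta N T *ᵥ w)

/-- The function `T(w)` given implicitly by `(𝔔 δ(T) w, δ(T) w) = κ²`, `T > 0`, for `w ≠ 0`
(there is exactly one such `T`), and `T(0) = 0`. -/
def terminalTime (w : State N) : ℝ := sInf {T : ℝ | 0 < T ∧ lyapunov T w = kappaSq N}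

/-- The terminal feedback `u = 𝔲(D⁻¹ x) + C x`, `𝔲(w) = ℭ δ(T(w)) w`. -/
def terminalControl (ω : Fin N → ℝ) (x : State N) : ℝ :=
  canonC N ⬝ᵥ (delta N (terminalTime (canon ω x)) *ᵥ canon ω x) + feedbackC ω ⬝ᵥ x

/-- The domain `G_Θ` (in the original coordinates) where the terminal control is used. -/
def terminalDomain (ω : Fin N → ℝ) (Θ : ℝ) : Set (State N) :=
  {x | terminalTime (canon ω x) ≤ Θ}

/-! ### Matching of the three stages -/

/-- `G_Θ` contains the inefficiency domain `{ρ ≤ U C}` of the reduced control. -/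
def CoversInefficient (ω : Fin N → ℝ) (C Θ U : ℝ) : Prop :=
  {x | rho ω x ≤ U * C} ⊆ terminalDomain ω Θ

/-- `G_Θ` lies in the strip `|C x| ≤ 1/2`. -/
def InStrip (ω : Fin N → ℝ) (Θ : ℝ) : Prop :=
  terminalDomain ω Θ ⊆ {x | |feedbackC ω ⬝ᵥ x| ≤ 1 / 2}

/-- The first stage is still going on at time `t`: the level `ρ = R` has not been reached. -/
def InFirstStage (ω : Fin N → ℝ) (R : ℝ) (y : ℝ → State N) (t : ℝ) : Prop :=
  ∀ s ∈ Set.Icc 0 t, R < rho ω (y s)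

/-- The third stage has begun by time `t`: `G_Θ` has been visited after the first stage. -/
def InThirdStage (ω : Fin N → ℝ) (R Θ : ℝ) (y : ℝ → State N) (t : ℝ) : Prop :=
  ∃ s ∈ Set.Icc 0 t, ¬ InFirstStage ω R y s ∧ y s ∈ terminalDomain ω Θ

/-- `(y, u)` is a motion from `x` under the three-stage control: the high-energy control until
`ρ ≤ R`, then the control reduced by the factor `U` until `G_Θ` is reached, then the terminal
control. -/
structure IsThreeStageMotion (ω : Fin N → ℝ) (R U Θ : ℝ) (x : State N)
    (y : ℝ → State N) (u : ℝ → ℝ) : Prop where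
  trajectory : IsTrajectory ω x y u
  first : ∀ᵐ t ∂(volume.restrict (Set.Ici (0 : ℝ))),
    InFirstStage ω R y t → IsSignFeedback ω 1 (y t) (u t)
  second : ∀ᵐ t ∂(volume.restrict (Set.Ici (0 : ℝ))),
    ¬ InFirstStage ω R y t → ¬ InThirdStage ω R Θ y t → IsSignFeedback ω U (y t) (u t)
  third : ∀ᵐ t ∂(volume.restrict (Set.Ici (0 : ℝ))),
    InThirdStage ω R Θ y t → u t = terminalControl ω (y t)

/-- `T` is the first time at which `y` is at the equilibrium. -/
def IsArrivalTime (y : ℝ → State N) (T : ℝ) : Prop := IsLeast {t : ℝ | 0 ≤ t ∧ y t = 0} T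

/-- `T` is the time which some motion under the three-stage control takes from `x` to the
equilibrium. -/
def IsMotionTime (ω : Fin N → ℝ) (R U Θ : ℝ) (x : State N) (T : ℝ) : Prop :=
  ∃ (y : ℝ → State N) (u : ℝ → ℝ), IsThreeStageMotion ω R U Θ x y u ∧ IsArrivalTime y T

end Oscillators

end

namespace Oscillators

variable {N : ℕ}

/-! In the frame z = e^{-At}x moving with the free flow the system reads ż = u e^{-At}B, and
e^{-At}B runs along a straight line of direction -ω on the torus (`drive_eq_torusPhase`). H(p) is
the Haar mean of |(p, ·)| over that torus, so Weyl equidistribution of the non-resonant line shows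
that the time mean of |(p, e^{-At}B)| over a long window is close to H(p), uniformly in the position
of the window and in p with H(p) = 1 (`exists_mean_drive_uniform`). H is invariant under the adjoint
flow, hence ρ under the free flow.

Lower bound for every admissible control: pair z with a momentum q of the initial state, normalized
by H(q) = 1. The pairing starts at ρ(x), ends at 0 and changes by at most ∫|(q, e^{-At}B)|, which is
about T; so ρ(x) ≤ (1 + ε)T + K (`exists_rho_le_time`).

Efficiency of the sign feedback: over a window of fixed length L the state z moves by O(UL). H is
strictly, hence uniformly convex, so when ρ is at least a large multiple of U the normalized
momentum hardly turns, and u(q, e^{-At}B) is nearly -U|(q, e^{-At}B)| for the momentum q frozen at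
the end of the window. Thus ρ drops by at least (1 - ε)UL per window (`exists_window_decrease`,
`exists_decay`). Rate 1/2 already makes the first two stages finite, and it fixes C₀. For the
asymptotics ε tends to 0 with R, U, Θ fixed: only the part of the first stage where ρ is large
depends on ρ(x), and all the rest takes bounded time (`exists_arrival_le`).

Terminal stage: C makes the powers of A + BC applied to B vanish from the order 2N on, so D brings
the system to a canonical form compatible with the anisotropic dilations. A Riccati identity for 𝔮
shows that the terminal time decreases at unit rate and that the canonical part of the control is at
most 1/2; in the strip the part Cx is at most 1/2 too.

Existence: for the discontinuous sign feedback, sample-and-hold motions converge along an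
ultrafilter, and the limit obeys the feedback wherever it is locally constant
(`exists_motion_of_feedback`). The terminal motion is explicit, being linear after dilation and
passage to logarithmic time (`exists_canon_motion`). -/

/-! ### The torus of phases and the support function as a Haar mean. -/

/-- The normalized Haar measure of the torus. -/
noncomputable def haarTorus (N : ℕ) : Measure (UnitAddTorus (Fin N)) :=
  Measure.pi fun _ => (AddCircle.haarAddCircle : Measure UnitAddCircle)

instance : IsProbabilityMeasure (haarTorus N) := by unfold haarTorus; infer_instance

instance : (haarTorus N).IsAddHaarMeasure := by unfold haarTorus; infer_instance

/-- The vector `(ω_i⁻¹ sin φ_i, cos φ_i)` at the point of the torus with the angles `φ_i`. -/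
noncomputable def torusPhase (ω : Fin N → ℝ) (θ : UnitAddTorus (Fin N)) : State N := fun a =>
  if a.2 = 0 then (ω a.1)⁻¹ * (fourier 1 (θ a.1)).im else (fourier 1 (θ a.1)).re

/-- The point of the torus with the angles `φ_i`. -/
noncomputable def torusPoint (φ : Fin N → ℝ) : UnitAddTorus (Fin N) :=
  fun i => ((φ i / (2 * Real.pi) : ℝ) : UnitAddCircle)

theorem fourier_one_angle (s : ℝ) :
    fourier 1 ((s / (2 * Real.pi) : ℝ) : UnitAddCircle) = Complex.exp (s * Complex.I) := by
  rw [fourier_coe_apply]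
  congr 1
  have : (Real.pi : ℂ) ≠ 0 := by exact_mod_cast Real.pi_ne_zero
  push_cast
  field_simp

theorem torusPhase_torusPoint_zero (ω : Fin N → ℝ) (φ : Fin N → ℝ) (i : Fin N) :
    torusPhase ω (torusPoint φ) (i, 0) = (ω i)⁻¹ * Real.sin (φ i) := by
  simp only [torusPhase, torusPoint, fourier_one_angle, if_true, Complex.exp_ofReal_mul_I_im]

theorem torusPhase_torusPoint_one (ω : Fin N → ℝ) (φ : Fin N → ℝ) (i : Fin N) :
    torusPhase ω (torusPoint φ) (i, 1) = Real.cos (φ i) := by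
  simp only [torusPhase, torusPoint, fourier_one_angle, one_ne_zero, if_false,
    Complex.exp_ofReal_mul_I_re]

theorem continuous_torusPhase (ω : Fin N → ℝ) : Continuous (torusPhase ω) := by
  refine continuous_pi fun a => ?_
  unfold torusPhase
  split_ifs
  · exact continuous_const.mul (Complex.continuous_im.comp
      ((fourier 1).continuous.comp (continuous_apply _)))
  · exact Complex.continuous_re.comp ((fourier 1).continuous.comp (continuous_apply _))

theorem dotProduct_eq_sum (p x : State N) :
    p ⬝ᵥ x = ∑ i, (p (i, 0) * x (i, 0) + p (i, 1) * x (i, 1)) := by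
  rw [dotProduct, Fintype.sum_prod_type]
  simp [Fin.sum_univ_two]

theorem continuous_dotProduct_torusPhase (ω : Fin N → ℝ) (p : State N) :
    Continuous fun θ => p ⬝ᵥ torusPhase ω θ :=
  Continuous.dotProduct continuous_const (continuous_torusPhase ω)

theorem integrable_of_continuous_torus {f : UnitAddTorus (Fin N) → ℝ} (hf : Continuous f) :
    Integrable f (haarTorus N) :=
  hf.integrable_of_hasCompactSupport (HasCompactSupport.of_compactSpace f)

-- The circle factors have length 1 while angles have length 2π; rescaling the cube produces the
-- factor (2π)^{-N}.
open scoped Pointwise in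
theorem integral_haarTorus {E : Type*} [NormedAddCommGroup E] [NormedSpace ℝ E]
    (f : UnitAddTorus (Fin N) → E) :
    ∫ θ, f θ ∂(haarTorus N) = ((2 * Real.pi) ^ N)⁻¹ •
      ∫ φ in Set.Icc (0 : Fin N → ℝ) (fun _ => 2 * Real.pi), f (torusPoint φ) := by
  have h2 : (0 : ℝ) < 2 * Real.pi := by positivity
  have h1 : ∫ θ, f θ ∂(haarTorus N) =
      ∫ x in {x : Fin N → ℝ | ∀ i, x i ∈ Set.Ioc ((0 : Fin N → ℝ) i) ((0 : Fin N → ℝ) i + 1)},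
        f (fun i => (x i : UnitAddCircle)) := UnitAddTorus.integral_preimage f 0
  have hset : {x : Fin N → ℝ | ∀ i, x i ∈ Set.Ioc ((0 : Fin N → ℝ) i) ((0 : Fin N → ℝ) i + 1)} =
      Set.univ.pi fun i : Fin N => Set.Ioc ((0 : Fin N → ℝ) i) ((1 : Fin N → ℝ) i) := by
    ext x; simp
  have hae : (Set.univ.pi fun i : Fin N => Set.Ioc ((0 : Fin N → ℝ) i) ((1 : Fin N → ℝ) i))
      =ᵐ[volume] Set.Icc (0 : Fin N → ℝ) 1 := Measure.univ_pi_Ioc_ae_eq_Icc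
  have hsm : (2 * Real.pi) • Set.Icc (0 : Fin N → ℝ) 1 =
      Set.Icc (0 : Fin N → ℝ) (fun _ => 2 * Real.pi) := by
    ext x
    rw [Set.mem_smul_set_iff_inv_smul_mem₀ h2.ne']
    simp only [Set.mem_Icc, Pi.le_def, Pi.zero_apply, Pi.smul_apply, smul_eq_mul, Pi.one_apply]
    refine and_congr (forall_congr' fun i => ?_) (forall_congr' fun i => ?_)
    · constructor
      · intro h
        have := mul_nonneg h2.le h
        rwa [← mul_assoc, mul_inv_cancel₀ h2.ne', one_mul] at this
      · intro h; positivity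
    · rw [inv_mul_le_iff₀ h2, mul_one]
  rw [h1, hset, setIntegral_congr_set hae]
  have h3 := Measure.setIntegral_comp_smul (volume : Measure (Fin N → ℝ))
    (fun φ => f (torusPoint φ)) (Set.Icc (0 : Fin N → ℝ) 1) h2.ne'
  rw [hsm, Module.finrank_fin_fun, abs_of_pos (by positivity)] at h3
  rw [← h3]
  refine integral_congr_ae (Eventually.of_forall fun x => ?_)
  refine congrArg f (funext fun i => ?_)
  simp only [torusPoint, Pi.smul_apply, smul_eq_mul]
  rw [mul_div_cancel_left₀ _ h2.ne']

/-- The contribution of the `i`-th oscillator to `p ⬝ᵥ torusPhase ω`. -/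
noncomputable def component (ω : Fin N → ℝ) (p : State N) (i : Fin N) (x : ℝ) : ℝ :=
  p (i, 0) * ((ω i)⁻¹ * Real.sin x) + p (i, 1) * Real.cos x

theorem exists_angle (ω : Fin N → ℝ) (p : State N) (i : Fin N) :
    ∃ α : ℝ, ∀ x, component ω p i x = amplitude ω p i * Real.cos (x - α) := by
  set c : ℂ := ⟨p (i, 1), (ω i)⁻¹ * p (i, 0)⟩ with hc
  have hn : ‖c‖ = amplitude ω p i := by
    rw [Complex.norm_def, Complex.normSq_apply, amplitude]
    congr 1
    simp only [hc]
    ring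
  have e3 : p (i, 1) = ‖c‖ * Real.cos c.arg := (Complex.norm_mul_cos_arg c).symm
  have e4 : (ω i)⁻¹ * p (i, 0) = ‖c‖ * Real.sin c.arg := (Complex.norm_mul_sin_arg c).symm
  refine ⟨c.arg, fun x => ?_⟩
  rw [Real.cos_sub, ← hn, component]
  linear_combination (Real.cos x) * e3 + (Real.sin x) * e4

theorem dotProduct_torusPhase_torusPoint (ω : Fin N → ℝ) (p : State N) (φ : Fin N → ℝ) :
    p ⬝ᵥ torusPhase ω (torusPoint φ) = ∑ i, component ω p i (φ i) := by
  rw [dotProduct_eq_sum]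
  refine Finset.sum_congr rfl fun i _ => ?_
  rw [torusPhase_torusPoint_zero, torusPhase_torusPoint_one, component]

theorem torusPoint_surjective : Function.Surjective (torusPoint (N := N)) := by
  intro θ
  choose x hx using fun i => QuotientAddGroup.mk_surjective (θ i)
  refine ⟨fun i => x i * (2 * Real.pi), funext fun i => ?_⟩
  rw [torusPoint, mul_div_cancel_right₀ _ (by positivity)]
  exact hx i

/-- Each oscillator contributes z_i cos(φ_i - α_i), and translation invariance of Haar measure
absorbs the phases α_i. The right-hand side is a mean of absolute values of linear forms in p, which
is what makes convexity and differentiability accessible. -/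
theorem supportFn_eq_integral (ω : Fin N → ℝ) (p : State N) :
    supportFn ω p = ∫ θ, |p ⬝ᵥ torusPhase ω θ| ∂(haarTorus N) := by
  choose α hα using exists_angle ω p
  have h1 : ∀ θ : UnitAddTorus (Fin N), p ⬝ᵥ torusPhase ω θ =
      ∑ i, amplitude ω p i * (fourier 1 ((θ - torusPoint α) i)).re := by
    intro θ
    obtain ⟨φ, rfl⟩ := torusPoint_surjective θ
    rw [dotProduct_torusPhase_torusPoint]
    refine Finset.sum_congr rfl fun i _ => ?_
    rw [hα, Pi.sub_apply, torusPoint, torusPoint, ← AddCircle.coe_sub, ← sub_div,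
      fourier_one_angle, Complex.exp_ofReal_mul_I_re]
  simp_rw [h1]
  rw [integral_sub_right_eq_self (μ := haarTorus N)
    (fun θ => |∑ i, amplitude ω p i * (fourier 1 (θ i)).re|) (torusPoint α), integral_haarTorus,
    supportFn, meanAbs, smul_eq_mul]
  congr 1
  refine integral_congr_ae (Eventually.of_forall fun φ => ?_)
  simp only [torusPoint, fourier_one_angle, Complex.exp_ofReal_mul_I_re]

/-! ### Equidistribution of non-resonant lines on the torus -/

theorem continuous_torusPoint_line (ν : Fin N → ℝ) :
    Continuous fun s : ℝ => torusPoint (s • ν) := by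
  refine continuous_pi fun i => ?_
  simp only [torusPoint, Pi.smul_apply, smul_eq_mul]
  exact (AddCircle.continuous_mk' 1).comp (by fun_prop)

theorem mFourier_torusPoint_line (ν : Fin N → ℝ) (n : Fin N → ℤ) (s : ℝ) :
    UnitAddTorus.mFourier n (torusPoint (s • ν)) =
      Complex.exp (((∑ i, (n i : ℝ) * ν i : ℝ) : ℂ) * Complex.I * s) := by
  simp only [UnitAddTorus.mFourier, ContinuousMap.coe_mk, torusPoint, Pi.smul_apply, smul_eq_mul]
  have h : ∀ i, fourier (n i) ((s * ν i / (2 * Real.pi) : ℝ) : UnitAddCircle) =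
      Complex.exp ((n i : ℂ) * ν i * Complex.I * s) := by
    intro i
    rw [fourier_coe_apply]
    congr 1
    have : (Real.pi : ℂ) ≠ 0 := by exact_mod_cast Real.pi_ne_zero
    push_cast
    field_simp
  simp_rw [h]
  rw [← Complex.exp_sum]
  congr 1
  push_cast
  simp_rw [Finset.sum_mul]

/-- Translation by the point reached on the line at time π/l multiplies the character by -1, while
Haar measure is invariant. -/
theorem integral_mFourier_eq_zero {ν : Fin N → ℝ} {n : Fin N → ℤ}
    (h : ∑ i, (n i : ℝ) * ν i ≠ 0) : ∫ θ, UnitAddTorus.mFourier n θ ∂(haarTorus N) = 0 := by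
  set l := ∑ i, (n i : ℝ) * ν i with hl
  set τ := torusPoint ((Real.pi / l) • ν)
  have hτ : UnitAddTorus.mFourier n τ = -1 := by
    rw [mFourier_torusPoint_line, ← hl, ← Complex.exp_pi_mul_I]
    congr 1
    have : (l : ℂ) ≠ 0 := by exact_mod_cast h
    push_cast
    field_simp
  have hadd : ∀ θ, UnitAddTorus.mFourier n (θ + τ) = -UnitAddTorus.mFourier n θ := by
    intro θ
    have : UnitAddTorus.mFourier n (θ + τ) =
        UnitAddTorus.mFourier n θ * UnitAddTorus.mFourier n τ := by
      simp only [UnitAddTorus.mFourier, ContinuousMap.coe_mk, ← Finset.prod_mul_distrib,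
        Pi.add_apply, fourier_apply, smul_add, AddCircle.toCircle_add, Circle.coe_mul]
    rw [this, hτ, mul_neg_one]
  have h1 := integral_add_right_eq_self (μ := haarTorus N)
    (fun θ => UnitAddTorus.mFourier n θ) τ
  simp_rw [hadd, integral_neg] at h1
  exact self_eq_neg.mp h1.symm

/-- The mean value of `F` along the line with the direction `ν` over the time `L`. -/
noncomputable def lineMean (ν : Fin N → ℝ) (F : UnitAddTorus (Fin N) → ℂ) (L : ℝ) : ℂ :=
  (L : ℂ)⁻¹ * ∫ s in (0 : ℝ)..L, F (torusPoint (s • ν))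

theorem intervalIntegrable_line (ν : Fin N → ℝ) (F : C(UnitAddTorus (Fin N), ℂ)) (a b : ℝ) :
    IntervalIntegrable (fun s => F (torusPoint (s • ν))) volume a b :=
  (F.continuous.comp (continuous_torusPoint_line ν)).intervalIntegrable a b

theorem norm_lineMean_sub_le (ν : Fin N → ℝ) (F G : C(UnitAddTorus (Fin N), ℂ)) {L : ℝ}
    (hL : 0 < L) : ‖lineMean ν F L - lineMean ν G L‖ ≤ ‖F - G‖ := by
  rw [lineMean, lineMean, ← mul_sub,
    ← intervalIntegral.integral_sub (intervalIntegrable_line ν F 0 L)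
      (intervalIntegrable_line ν G 0 L), norm_mul, norm_inv, Complex.norm_real,
    Real.norm_of_nonneg hL.le, inv_mul_le_iff₀ hL]
  have := intervalIntegral.norm_integral_le_of_norm_le_const (a := 0) (b := L) (C := ‖F - G‖)
    (f := fun s => F (torusPoint (s • ν)) - G (torusPoint (s • ν)))
    (fun s _ => (F - G).norm_coe_le_norm (torusPoint (s • ν)))
  rwa [sub_zero, abs_of_pos hL, mul_comm] at this

/-- A nontrivial character restricted to the line is an exponential e^{ils} with l ≠ 0 by
non-resonance, so its mean over [0, L] is O(1/L). -/
theorem tendsto_lineMean_mFourier {ν : Fin N → ℝ}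
    (hν : ∀ m : Fin N → ℤ, ∑ i, (m i : ℝ) * ν i = 0 → m = 0) (n : Fin N → ℤ) :
    Tendsto (lineMean ν (UnitAddTorus.mFourier n)) atTop
      (𝓝 (∫ θ, UnitAddTorus.mFourier n θ ∂(haarTorus N))) := by
  by_cases hn : n = 0
  · subst hn
    have h1 : ∫ θ, UnitAddTorus.mFourier (0 : Fin N → ℤ) θ ∂(haarTorus N) = 1 := by
      simp [UnitAddTorus.mFourier_zero]
    rw [h1]
    refine tendsto_const_nhds.congr' ?_
    filter_upwards [eventually_gt_atTop 0] with L hL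
    have : (L : ℂ) ≠ 0 := by exact_mod_cast hL.ne'
    simp [lineMean, UnitAddTorus.mFourier_zero, this]
  · have hl : ∑ i, (n i : ℝ) * ν i ≠ 0 := fun h => hn (hν n h)
    rw [integral_mFourier_eq_zero hl]
    set l := ∑ i, (n i : ℝ) * ν i with hldef
    have hlC : (l : ℂ) * Complex.I ≠ 0 :=
      mul_ne_zero (by exact_mod_cast hl) Complex.I_ne_zero
    have hb : ∀ᶠ L : ℝ in atTop,
        ‖lineMean ν (UnitAddTorus.mFourier n) L‖ ≤ (2 / |l|) * L⁻¹ := by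
      filter_upwards [eventually_gt_atTop 0] with L hL
      rw [lineMean]
      simp_rw [mFourier_torusPoint_line, ← hldef]
      rw [integral_exp_mul_complex hlC, norm_mul, norm_inv, Complex.norm_real,
        Real.norm_of_nonneg hL.le, norm_div, mul_comm]
      gcongr
      · refine (norm_sub_le _ _).trans ?_
        have e : (l : ℂ) * Complex.I * (L : ℂ) = ((l * L : ℝ) : ℂ) * Complex.I := by
          push_cast; ring
        rw [e, Complex.norm_exp_ofReal_mul_I]
        simp
        norm_num
      · simp
    refine squeeze_zero_norm' hb ?_
    have := (tendsto_inv_atTop_zero (𝕜 := ℝ)).const_mul (2 / |l|)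
    rwa [mul_zero] at this

theorem integrable_continuousMap_torus (F : C(UnitAddTorus (Fin N), ℂ)) :
    Integrable F (haarTorus N) :=
  F.continuous.integrable_of_hasCompactSupport (HasCompactSupport.of_compactSpace F)

/-- Weyl's argument: characters span a dense subspace of the continuous functions, and both the line
mean and the Haar mean are contractions for the sup norm. -/
theorem tendsto_lineMean {ν : Fin N → ℝ}
    (hν : ∀ m : Fin N → ℤ, ∑ i, (m i : ℝ) * ν i = 0 → m = 0)
    (F : C(UnitAddTorus (Fin N), ℂ)) :
    Tendsto (lineMean ν F) atTop (𝓝 (∫ θ, F θ ∂(haarTorus N))) := by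
  have hspan : ∀ G ∈ Submodule.span ℂ (Set.range (UnitAddTorus.mFourier (d := Fin N))),
      Tendsto (lineMean ν G) atTop (𝓝 (∫ θ, G θ ∂(haarTorus N))) := by
    intro G hG
    induction hG using Submodule.span_induction with
    | mem x hx => obtain ⟨n, rfl⟩ := hx; exact tendsto_lineMean_mFourier hν n
    | zero =>
      have : lineMean ν ((0 : C(UnitAddTorus (Fin N), ℂ)) : UnitAddTorus (Fin N) → ℂ) =
          fun _ => 0 := by ext L; simp [lineMean]
      rw [this]
      simp
    | add F G _ _ hF hG =>
      have : ∫ θ, (F + G) θ ∂(haarTorus N) =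
          ∫ θ, F θ ∂(haarTorus N) + ∫ θ, G θ ∂(haarTorus N) :=
        integral_add (integrable_continuousMap_torus F) (integrable_continuousMap_torus G)
      rw [this]
      refine (hF.add hG).congr fun L => ?_
      simp only [lineMean, ContinuousMap.add_apply]
      rw [intervalIntegral.integral_add (intervalIntegrable_line ν F 0 L)
        (intervalIntegrable_line ν G 0 L), mul_add]
    | smul c F _ hF =>
      have : ∫ θ, (c • F) θ ∂(haarTorus N) = c * ∫ θ, F θ ∂(haarTorus N) := by
        simp [integral_const_mul]
      rw [this]
      refine (hF.const_mul c).congr fun L => ?_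
      simp only [lineMean, ContinuousMap.smul_apply, smul_eq_mul,
        intervalIntegral.integral_const_mul]
      ring
  rw [Metric.tendsto_atTop]
  intro ε hε
  have hF : F ∈ closure (Submodule.span ℂ (Set.range (UnitAddTorus.mFourier (d := Fin N))) :
      Set C(UnitAddTorus (Fin N), ℂ)) := by
    have := UnitAddTorus.span_mFourier_closure_eq_top (d := Fin N)
    rw [← Submodule.topologicalClosure_coe, this]
    trivial
  obtain ⟨G, hG, hFG⟩ := Metric.mem_closure_iff.mp hF (ε / 3) (by positivity)
  obtain ⟨L₀, hL₀⟩ := Metric.tendsto_atTop.mp (hspan G hG) (ε / 3) (by positivity)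
  refine ⟨max L₀ 1, fun L hL => ?_⟩
  have hL0 : 0 < L := lt_of_lt_of_le one_pos ((le_max_right _ _).trans hL)
  have e1 := norm_lineMean_sub_le ν F G hL0
  have e2 := hL₀ L ((le_max_left _ _).trans hL)
  have e3 : ‖∫ θ, G θ ∂(haarTorus N) - ∫ θ, F θ ∂(haarTorus N)‖ ≤ ‖F - G‖ := by
    rw [← integral_sub (integrable_continuousMap_torus G) (integrable_continuousMap_torus F)]
    refine (norm_integral_le_of_norm_le_const (C := ‖F - G‖)
      (Eventually.of_forall fun θ => ?_)).trans (by simp)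
    rw [norm_sub_rev]
    exact (F - G).norm_coe_le_norm θ
  rw [dist_eq_norm] at *
  calc ‖lineMean ν F L - ∫ θ, F θ ∂(haarTorus N)‖
      = ‖(lineMean ν F L - lineMean ν G L) + (lineMean ν G L - ∫ θ, G θ ∂(haarTorus N)) +
          (∫ θ, G θ ∂(haarTorus N) - ∫ θ, F θ ∂(haarTorus N))‖ := by congr 1; ring
    _ ≤ ‖lineMean ν F L - lineMean ν G L‖ + ‖lineMean ν G L - ∫ θ, G θ ∂(haarTorus N)‖ +
          ‖∫ θ, G θ ∂(haarTorus N) - ∫ θ, F θ ∂(haarTorus N)‖ := norm_add₃_le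
    _ < ε := by linarith

theorem tendsto_lineMean_real {ν : Fin N → ℝ}
    (hν : ∀ m : Fin N → ℤ, ∑ i, (m i : ℝ) * ν i = 0 → m = 0)
    {f : UnitAddTorus (Fin N) → ℝ} (hf : Continuous f) :
    Tendsto (fun L : ℝ => L⁻¹ * ∫ s in (0 : ℝ)..L, f (torusPoint (s • ν))) atTop
      (𝓝 (∫ θ, f θ ∂(haarTorus N))) := by
  have h := tendsto_lineMean hν ⟨fun θ => (f θ : ℂ), Complex.continuous_ofReal.comp hf⟩
  have h' := (Complex.continuous_re.tendsto _).comp h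
  simp only [ContinuousMap.coe_mk, integral_complex_ofReal, Complex.ofReal_re] at h'
  refine h'.congr fun L => ?_
  simp only [lineMean, intervalIntegral.integral_ofReal, Function.comp_apply]
  rw [← Complex.ofReal_inv, ← Complex.ofReal_mul, Complex.ofReal_re]

/-! ### The support function as a norm on momenta. -/

theorem supportFn_nonneg (ω : Fin N → ℝ) (p : State N) : 0 ≤ supportFn ω p := by
  rw [supportFn_eq_integral]
  exact integral_nonneg fun _ => abs_nonneg _

theorem supportFn_smul (ω : Fin N → ℝ) (c : ℝ) (p : State N) :
    supportFn ω (c • p) = |c| * supportFn ω p := by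
  simp_rw [supportFn_eq_integral, smul_dotProduct, smul_eq_mul, abs_mul]
  rw [integral_const_mul]

theorem supportFn_zero (ω : Fin N → ℝ) : supportFn ω 0 = 0 := by
  simpa using supportFn_smul ω 0 0

theorem integrable_abs_dotProduct_torusPhase (ω : Fin N → ℝ) (p : State N) :
    Integrable (fun θ => |p ⬝ᵥ torusPhase ω θ|) (haarTorus N) :=
  integrable_of_continuous_torus (continuous_dotProduct_torusPhase ω p).abs

theorem supportFn_add_le (ω : Fin N → ℝ) (p q : State N) :
    supportFn ω (p + q) ≤ supportFn ω p + supportFn ω q := by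
  simp_rw [supportFn_eq_integral]
  rw [← integral_add (integrable_abs_dotProduct_torusPhase ω p)
    (integrable_abs_dotProduct_torusPhase ω q)]
  refine integral_mono (integrable_abs_dotProduct_torusPhase ω _)
    ((integrable_abs_dotProduct_torusPhase ω p).add (integrable_abs_dotProduct_torusPhase ω q))
    fun θ => ?_
  simp only [add_dotProduct]
  exact abs_add_le _ _

theorem abs_dotProduct_le (p x : State N) : |p ⬝ᵥ x| ≤ (2 * N) * ‖p‖ * ‖x‖ := by
  rw [dotProduct]
  refine (Finset.abs_sum_le_sum_abs _ _).trans ?_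
  have : ∀ a ∈ Finset.univ, |p a * x a| ≤ ‖p‖ * ‖x‖ := by
    intro a _
    rw [abs_mul]
    exact mul_le_mul (norm_le_pi_norm p a) (norm_le_pi_norm x a) (abs_nonneg _) (norm_nonneg _)
  refine (Finset.sum_le_sum this).trans (le_of_eq ?_)
  simp
  ring

theorem exists_norm_torusPhase_le (ω : Fin N → ℝ) :
    ∃ M : ℝ, 0 < M ∧ ∀ θ, ‖torusPhase ω θ‖ ≤ M := by
  obtain ⟨M, hM⟩ := isCompact_univ.exists_bound_of_continuousOn
    (continuous_torusPhase ω).continuousOn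
  exact ⟨max M 1, by positivity, fun θ => (hM θ trivial).trans (le_max_left _ _)⟩

theorem exists_abs_dotProduct_torusPhase_le (ω : Fin N → ℝ) :
    ∃ M : ℝ, 0 < M ∧ ∀ p θ, |p ⬝ᵥ torusPhase ω θ| ≤ M * ‖p‖ := by
  obtain ⟨M, hM, h⟩ := exists_norm_torusPhase_le ω
  refine ⟨(2 * N + 1) * M, by positivity, fun p θ => (abs_dotProduct_le _ _).trans ?_⟩
  have := h θ
  calc 2 * N * ‖p‖ * ‖torusPhase ω θ‖ ≤ (2 * N + 1) * ‖p‖ * M := by gcongr; linarith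
    _ = _ := by ring

theorem exists_supportFn_le (ω : Fin N → ℝ) :
    ∃ M : ℝ, 0 < M ∧ ∀ p, supportFn ω p ≤ M * ‖p‖ := by
  obtain ⟨M, hM, h⟩ := exists_abs_dotProduct_torusPhase_le ω
  refine ⟨M, hM, fun p => ?_⟩
  rw [supportFn_eq_integral]
  refine (integral_mono (integrable_abs_dotProduct_torusPhase ω p) (integrable_const (M * ‖p‖))
    fun θ => h p θ).trans ?_
  simp

theorem supportFn_neg (ω : Fin N → ℝ) (p : State N) : supportFn ω (-p) = supportFn ω p := by
  simpa using supportFn_smul ω (-1) p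

theorem abs_supportFn_sub_le (ω : Fin N → ℝ) (p q : State N) :
    |supportFn ω p - supportFn ω q| ≤ supportFn ω (p - q) := by
  have h1 := supportFn_add_le ω (p - q) q
  have h2 := supportFn_add_le ω (q - p) p
  rw [← neg_sub p q, supportFn_neg, neg_sub] at h2
  simp only [sub_add_cancel] at h1 h2
  rw [abs_le]
  constructor <;> linarith

theorem continuous_supportFn (ω : Fin N → ℝ) : Continuous (supportFn ω) := by
  obtain ⟨M, hM, h⟩ := exists_supportFn_le ω
  refine (LipschitzWith.of_dist_le_mul (K := ⟨M, hM.le⟩) fun p q => ?_).continuous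
  rw [Real.dist_eq, dist_eq_norm]
  exact (abs_supportFn_sub_le ω p q).trans (h _)

/-! ### Strict convexity -/

theorem component_add_pi (ω : Fin N → ℝ) (p : State N) (i : Fin N) (x : ℝ) :
    component ω p i (x + Real.pi) = -component ω p i x := by
  simp only [component, Real.sin_add_pi, Real.cos_add_pi]
  ring

theorem component_eq (ω : Fin N → ℝ) (p : State N) (i : Fin N) (α x : ℝ) :
    component ω p i x = component ω p i α * Real.cos (x - α) +
      component ω p i (α + Real.pi / 2) * Real.sin (x - α) := by
  simp only [component, Real.sin_add_pi_div_two, Real.cos_add_pi_div_two, Real.cos_sub,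
    Real.sin_sub]
  have := Real.sin_sq_add_cos_sq α
  linear_combination (-(p (i, 0) * (ω i)⁻¹ * Real.sin x + p (i, 1) * Real.cos x)) * this

theorem component_smul (ω : Fin N → ℝ) (c : ℝ) (p : State N) (i : Fin N) (x : ℝ) :
    component ω (c • p) i x = c * component ω p i x := by
  simp only [component, Pi.smul_apply, smul_eq_mul]; ring

theorem eq_of_component_eq {ω : Fin N → ℝ} (hω : ∀ i, ω i ≠ 0) {p q : State N}
    (h : ∀ i x, component ω p i x = component ω q i x) : p = q := by
  funext ⟨i, k⟩
  have h0 := h i (Real.pi / 2)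
  have h1 := h i 0
  simp only [component, Real.sin_pi_div_two, Real.cos_pi_div_two, Real.sin_zero, Real.cos_zero,
    mul_zero, mul_one, add_zero, zero_add] at h0 h1
  fin_cases k
  · exact mul_right_cancel₀ (inv_ne_zero (hω i)) h0
  · exact h1

/-- If one linear form on the torus dominates another one, they are proportional. -/
theorem exists_smul_eq_of_dominated {ω : Fin N → ℝ} (hω : ∀ i, ω i ≠ 0) {s d : State N}
    (h : ∀ θ, |d ⬝ᵥ torusPhase ω θ| ≤ |s ⬝ᵥ torusPhase ω θ|) : ∃ c : ℝ, d = c • s := by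
  choose α hα using exists_angle ω s
  set σ := amplitude ω s with hσ
  have hφ : ∀ φ : Fin N → ℝ, |∑ i, component ω d i (φ i)| ≤ |∑ i, component ω s i (φ i)| := by
    intro φ
    rw [← dotProduct_torusPhase_torusPoint, ← dotProduct_torusPhase_torusPoint]
    exact h _
  have hcos : Real.cos (Real.pi / 2) = 0 := Real.cos_pi_div_two
  have hsv : ∀ i, component ω s i (α i + Real.pi / 2) = 0 := by
    intro i
    rw [hα, add_sub_cancel_left, hcos, mul_zero]
  -- Put every oscillator at its quarter phase, where s vanishes, so that d vanishes too. Shifting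
  -- all oscillators except the i-th by π flips the sign of the other terms; adding the two
  -- equations isolates the i-th one.
  have hdv : ∀ i, component ω d i (α i + Real.pi / 2) = 0 := by
    intro i
    have key : ∀ e : ℝ, (e = 0 ∨ e = Real.pi) →
        |component ω d i (α i + Real.pi / 2) + Real.cos e * ∑ j ∈ Finset.univ.erase i,
          component ω d j (α j + Real.pi / 2)| ≤ 0 := by
      intro e he
      have := hφ (fun j => if j = i then α i + Real.pi / 2 else α j + Real.pi / 2 + e)
      rw [← Finset.add_sum_erase _ _ (Finset.mem_univ i),
        ← Finset.add_sum_erase _ _ (Finset.mem_univ i), if_pos rfl, hsv, zero_add] at this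
      have h1 : ∀ p : State N, ∀ j, component ω p j (α j + Real.pi / 2 + e) =
          Real.cos e * component ω p j (α j + Real.pi / 2) := by
        intro p j
        rcases he with rfl | rfl
        · simp
        · rw [component_add_pi, Real.cos_pi]; ring
      have h2 : ∀ p : State N, ∑ j ∈ Finset.univ.erase i,
          component ω p j (if j = i then α i + Real.pi / 2 else α j + Real.pi / 2 + e) =
          Real.cos e * ∑ j ∈ Finset.univ.erase i, component ω p j (α j + Real.pi / 2) := by
        intro p
        rw [Finset.mul_sum]
        refine Finset.sum_congr rfl fun j hj => ?_
        rw [if_neg (Finset.ne_of_mem_erase hj), h1]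
      rw [h2, h2] at this
      simpa [hsv] using this
    have k0 := key 0 (Or.inl rfl)
    have k1 := key Real.pi (Or.inr rfl)
    rw [abs_nonpos_iff, Real.cos_zero] at k0
    rw [abs_nonpos_iff, Real.cos_pi] at k1
    linarith
  set e : Fin N → ℝ := fun i => component ω d i (α i) with he
  have hd : ∀ i x, component ω d i x = e i * Real.cos (x - α i) := by
    intro i x
    rw [component_eq ω d i (α i) x, hdv, zero_mul, add_zero]
  -- After this reduction only the cosines cos(x_i - α_i) enter. They take arbitrary values in [-1,
  -- 1] independently, and by homogeneity any real vector t is allowed.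
  have ht : ∀ t : Fin N → ℝ, |∑ i, e i * t i| ≤ |∑ i, σ i * t i| := by
    intro t
    set M := ‖t‖ + 1
    have hM : 0 < M := by positivity
    have hti : ∀ i, |t i / M| ≤ 1 := by
      intro i
      rw [abs_div, abs_of_pos hM, div_le_one hM]
      exact (norm_le_pi_norm t i).trans (by simp [M])
    have := hφ (fun i => α i + Real.arccos (t i / M))
    simp_rw [hd, hα, add_sub_cancel_left] at this
    simp_rw [Real.cos_arccos (abs_le.mp (hti _)).1 (abs_le.mp (hti _)).2, ← mul_div_assoc] at this
    rw [← Finset.sum_div, ← Finset.sum_div, abs_div, abs_div] at this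
    exact (div_le_div_iff_of_pos_right (abs_pos.mpr hM.ne')).mp this
  have hrel : ∀ i j, e i * σ j = e j * σ i := by
    intro i j
    by_cases hij : i = j
    · rw [hij]
    -- This test vector annihilates σ, hence also e.
    · have := ht (fun k => if k = i then σ j else if k = j then -σ i else 0)
      have hs : ∀ f : Fin N → ℝ, ∑ k, f k * (if k = i then σ j else if k = j then -σ i else 0) =
          f i * σ j - f j * σ i := by
        intro f
        have : ∀ k, f k * (if k = i then σ j else if k = j then -σ i else 0) =
            (if k = i then f k * σ j else 0) + (if k = j then -(f k * σ i) else 0) := by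
          intro k
          by_cases h1 : k = i
          · have : k ≠ j := fun h2 => hij (h1.symm.trans h2)
            simp [h1, hij]
          · by_cases h2 : k = j
            · have : ¬ j = i := fun h3 => hij h3.symm
              simp [h2, this]
            · simp [h1, h2]
        simp_rw [this, Finset.sum_add_distrib]
        simp [sub_eq_add_neg]
      rw [hs, hs, mul_comm (σ i), sub_self, abs_zero] at this
      exact sub_eq_zero.mp (abs_nonpos_iff.mp this)
  by_cases hz : ∃ i, σ i ≠ 0
  · obtain ⟨i, hi⟩ := hz
    refine ⟨e i / σ i, eq_of_component_eq hω fun j x => ?_⟩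
    rw [component_smul, hd, hα]
    have := hrel i j
    field_simp
    linear_combination (-Real.cos (x - α j)) * this
  · push Not at hz
    refine ⟨0, eq_of_component_eq hω fun j x => ?_⟩
    have := ht (Pi.single j 1)
    simp only [hz, zero_mul, Finset.sum_const_zero, abs_zero, abs_nonpos_iff] at this
    rw [component_smul, hd, zero_mul]
    have hj : e j = 0 := by simpa [Pi.single_apply] using this
    rw [hj, zero_mul]

theorem eq_zero_of_integral_torus_eq_zero {f : UnitAddTorus (Fin N) → ℝ} (hf : Continuous f)
    (h0 : ∀ θ, 0 ≤ f θ) (h : ∫ θ, f θ ∂(haarTorus N) = 0) (θ : UnitAddTorus (Fin N)) :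
    f θ = 0 := by
  rw [integral_eq_zero_iff_of_nonneg h0 (integrable_of_continuous_torus hf)] at h
  exact congrFun ((Continuous.ae_eq_iff_eq (haarTorus N) hf
    (g := fun _ => (0 : ℝ)) continuous_const).mp h) θ

theorem eq_zero_of_supportFn_eq_zero {ω : Fin N → ℝ} (hω : ∀ i, ω i ≠ 0) {p : State N}
    (h : supportFn ω p = 0) : p = 0 := by
  rw [supportFn_eq_integral] at h
  obtain ⟨c, hc⟩ := exists_smul_eq_of_dominated hω (s := 0) (d := p) fun θ => by
    rw [eq_zero_of_integral_torus_eq_zero (continuous_dotProduct_torusPhase ω p).abs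
      (fun _ => abs_nonneg _) h θ]
    exact abs_nonneg _
  simpa using hc

theorem supportFn_pos {ω : Fin N → ℝ} (hω : ∀ i, ω i ≠ 0) {p : State N} (hp : p ≠ 0) :
    0 < supportFn ω p :=
  lt_of_le_of_ne (supportFn_nonneg ω p) fun h => hp (eq_zero_of_supportFn_eq_zero hω h.symm)

/-- Equality in the integrated triangle inequality forces, by continuity, pointwise equality: the
forms of p and q never have opposite signs. Then |p - q| ≤ |p + q| as forms on the torus, and
domination makes p - q proportional to p + q. -/
theorem supportFn_strictConvex {ω : Fin N → ℝ} (hω : ∀ i, ω i ≠ 0) {p q : State N}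
    (hp : supportFn ω p = 1) (hq : supportFn ω q = 1) (hpq : supportFn ω (p + q) = 2) :
    p = q := by
  have hp0 : p ≠ 0 := by rintro rfl; simp [supportFn_zero] at hp
  have hcont : Continuous fun θ => |p ⬝ᵥ torusPhase ω θ| + |q ⬝ᵥ torusPhase ω θ| -
      |(p + q) ⬝ᵥ torusPhase ω θ| :=
    ((continuous_dotProduct_torusPhase ω p).abs.add
      (continuous_dotProduct_torusPhase ω q).abs).sub (continuous_dotProduct_torusPhase ω _).abs
  have hzero : ∫ θ, (|p ⬝ᵥ torusPhase ω θ| + |q ⬝ᵥ torusPhase ω θ| -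
      |(p + q) ⬝ᵥ torusPhase ω θ|) ∂(haarTorus N) = 0 := by
    have hi := integrable_abs_dotProduct_torusPhase ω
    have e1 : ∫ θ, (|p ⬝ᵥ torusPhase ω θ| + |q ⬝ᵥ torusPhase ω θ|) ∂(haarTorus N) = 1 + 1 := by
      rw [integral_add (hi p) (hi q), ← supportFn_eq_integral, ← supportFn_eq_integral, hp, hq]
    rw [integral_sub (f := fun θ => |p ⬝ᵥ torusPhase ω θ| + |q ⬝ᵥ torusPhase ω θ|)
      ((hi p).add (hi q)) (hi (p + q)), e1, ← supportFn_eq_integral, hpq]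
    norm_num
  have h' := eq_zero_of_integral_torus_eq_zero hcont (fun θ => by
    rw [add_dotProduct]
    linarith [abs_add_le (p ⬝ᵥ torusPhase ω θ) (q ⬝ᵥ torusPhase ω θ)]) hzero
  obtain ⟨c, hc⟩ := exists_smul_eq_of_dominated hω (s := p + q) (d := p - q) fun θ => by
    have := h' θ
    rw [add_dotProduct] at this
    rw [add_dotProduct, sub_dotProduct]
    set a := p ⬝ᵥ torusPhase ω θ
    set b := q ⬝ᵥ torusPhase ω θ
    rcases abs_cases a with ha | ha <;> rcases abs_cases b with hb | hb <;>
    rcases abs_cases (a + b) with hab | hab <;> rcases abs_cases (a - b) with hc | hc <;>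
    linarith
  have h1 : (1 - c) • p = (1 + c) • q := by
    have : p - q - c • (p + q) = 0 := sub_eq_zero.mpr hc
    rw [← sub_eq_zero]
    rw [← this]
    module
  -- Applying H gives |1 - c| = |1 + c|, so c = 0.
  have h2 := congrArg (supportFn ω) h1
  rw [supportFn_smul, supportFn_smul, hp, hq, mul_one, mul_one] at h2
  have hc0 : c = 0 := by
    rcases abs_eq_abs.mp h2 with h | h <;> linarith
  rw [hc0, sub_zero, add_zero, one_smul, one_smul] at h1
  exact h1

theorem exists_le_supportFn {ω : Fin N → ℝ} (hω : ∀ i, ω i ≠ 0) :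
    ∃ c : ℝ, 0 < c ∧ ∀ p, c * ‖p‖ ≤ supportFn ω p := by
  -- The sphere is empty when N = 0.
  rcases (Metric.sphere (0 : State N) 1).eq_empty_or_nonempty with hs | hs
  · refine ⟨1, one_pos, fun p => ?_⟩
    by_cases hp : p = 0
    · simp [hp, supportFn_zero]
    · exfalso
      have : (‖p‖⁻¹ • p) ∈ Metric.sphere (0 : State N) 1 := by
        simp [norm_smul, hp]
      rw [hs] at this
      exact this
  · obtain ⟨q, hq, hmin⟩ := (isCompact_sphere (0 : State N) 1).exists_isMinOn hs
      (continuous_supportFn ω).continuousOn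
    have hq0 : q ≠ 0 := by rintro rfl; simp at hq
    refine ⟨supportFn ω q, supportFn_pos hω hq0, fun p => ?_⟩
    by_cases hp : p = 0
    · simp [hp, supportFn_zero]
    · have hmem : (‖p‖⁻¹ • p) ∈ Metric.sphere (0 : State N) 1 := by
        simp [norm_smul, hp]
      have h1 : supportFn ω q ≤ supportFn ω (‖p‖⁻¹ • p) := hmin hmem
      rw [supportFn_smul, abs_of_nonneg (by positivity)] at h1
      have hpos : 0 < ‖p‖ := norm_pos_iff.mpr hp
      calc supportFn ω q * ‖p‖ ≤ ‖p‖⁻¹ * supportFn ω p * ‖p‖ := by gcongr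
        _ = supportFn ω p := by field_simp

theorem isCompact_supportFn_eq_one {ω : Fin N → ℝ} (hω : ∀ i, ω i ≠ 0) :
    IsCompact {p | supportFn ω p = 1} := by
  obtain ⟨c, hc, h⟩ := exists_le_supportFn hω
  refine Metric.isCompact_of_isClosed_isBounded
    (isClosed_eq (continuous_supportFn ω) continuous_const) ?_
  refine (Metric.isBounded_closedBall (x := (0 : State N)) (r := 1 / c)).subset fun p hp => ?_
  rw [mem_closedBall_zero_iff, le_div_iff₀ hc, mul_comm]
  exact (h p).trans (le_of_eq hp)

/-- Strict convexity made quantitative by compactness: H(p + q) attains a maximum below 2 on the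
pairs of unit momenta at distance at least ε. -/
theorem supportFn_uniformConvex {ω : Fin N → ℝ} (hω : ∀ i, ω i ≠ 0) {ε : ℝ} (hε : 0 < ε) :
    ∃ η : ℝ, 0 < η ∧ ∀ p q, supportFn ω p = 1 → supportFn ω q = 1 →
      2 - η ≤ supportFn ω (p + q) → ‖p - q‖ < ε := by
  set K : Set (State N × State N) :=
    ({p | supportFn ω p = 1} ×ˢ {p | supportFn ω p = 1}) ∩ {x | ε ≤ ‖x.1 - x.2‖} with hK
  have hKc : IsCompact K :=
    ((isCompact_supportFn_eq_one hω).prod (isCompact_supportFn_eq_one hω)).inter_right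
      (isClosed_le continuous_const (continuous_fst.sub continuous_snd).norm)
  rcases K.eq_empty_or_nonempty with he | hne
  · refine ⟨1, one_pos, fun p q hp hq _ => ?_⟩
    by_contra hcon
    have : (p, q) ∈ K := ⟨⟨hp, hq⟩, not_lt.mp hcon⟩
    rw [he] at this
    exact this
  · obtain ⟨x, hx, hmax⟩ := hKc.exists_isMaxOn hne
      (f := fun x : State N × State N => supportFn ω (x.1 + x.2))
      ((continuous_supportFn ω).comp (continuous_fst.add continuous_snd)).continuousOn
    have hlt : supportFn ω (x.1 + x.2) < 2 := by
      have h1 : supportFn ω x.1 = 1 := hx.1.1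
      have h2 : supportFn ω x.2 = 1 := hx.1.2
      refine lt_of_le_of_ne ?_ fun h => ?_
      · have := supportFn_add_le ω x.1 x.2
        linarith
      · have := supportFn_strictConvex hω h1 h2 h
        have h3 : ε ≤ ‖x.1 - x.2‖ := hx.2
        rw [this, sub_self, norm_zero] at h3
        linarith
    refine ⟨(2 - supportFn ω (x.1 + x.2)) / 2, by linarith, fun p q hp hq h => ?_⟩
    by_contra hcon
    have hmem : (p, q) ∈ K := ⟨⟨hp, hq⟩, not_lt.mp hcon⟩
    have : supportFn ω (p + q) ≤ supportFn ω (x.1 + x.2) := isMaxOn_iff.mp hmax (p, q) hmem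
    linarith

/-! ### Differentiability of the support function -/

/-- Along a coordinate whose amplitude is not 0 the form is a constant plus a nonzero multiple of a
cosine, a nonzero analytic function of one variable. Its zeros are null on every such line, so the
zero set is null. -/
theorem ae_dotProduct_torusPhase_ne_zero {ω : Fin N → ℝ} (hω : ∀ i, ω i ≠ 0) {p : State N}
    (hp : p ≠ 0) : ∀ᵐ θ ∂(haarTorus N), p ⬝ᵥ torusPhase ω θ ≠ 0 := by
  obtain ⟨i, hi⟩ : ∃ i, amplitude ω p i ≠ 0 := by
    by_contra! hcon
    refine hp (eq_of_component_eq hω fun i x => ?_)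
    obtain ⟨α, hα⟩ := exists_angle ω p i
    rw [hα, hcon]
    simp [component]
  set s : Set (Fin N → ℝ) := {φ | ∑ j, component ω p j (φ j) ≠ 0} with hs
  have hcont : Continuous fun φ : Fin N → ℝ => ∑ j, component ω p j (φ j) := by
    unfold component; fun_prop
  have hmeas : MeasurableSet s :=
    (isOpen_ne_fun hcont continuous_const).measurableSet
  have hae : ∀ᵐ φ : Fin N → ℝ, φ ∈ s := by
    refine ae_mem_of_ae_add_linearMap_mem (LinearMap.single ℝ (fun _ : Fin N => ℝ) i)
      volume volume hmeas fun y => ?_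
    obtain ⟨α, hα⟩ := exists_angle ω p i
    set K := ∑ j ∈ Finset.univ.erase i, component ω p j (y j)
    have hval : ∀ x : ℝ, ∑ j, component ω p j ((y + LinearMap.single ℝ (fun _ : Fin N => ℝ) i x) j)
        = K + amplitude ω p i * Real.cos (y i + x - α) := by
      intro x
      rw [← Finset.add_sum_erase _ _ (Finset.mem_univ i), add_comm]
      congr 1
      · refine Finset.sum_congr rfl fun j hj => ?_
        simp [Finset.ne_of_mem_erase hj]
      · rw [hα]; simp
    have han : AnalyticOnNhd ℝ (fun x : ℝ => K + amplitude ω p i * Real.cos (y i + x - α))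
        Set.univ := fun x _ => by
      have : AnalyticAt ℝ (fun x : ℝ => y i + x - α) x := by fun_prop
      exact analyticAt_const.add (analyticAt_const.mul (Real.analyticAt_cos.fun_comp this))
    have hne : ∃ x : ℝ, K + amplitude ω p i * Real.cos (y i + x - α) ≠ 0 := by
      by_contra! hcon
      have h1 := hcon (α - y i)
      have h2 := hcon (α - y i + Real.pi)
      have e1 : y i + (α - y i) - α = 0 := by ring
      have e2 : y i + (α - y i + Real.pi) - α = Real.pi := by ring
      rw [e1, Real.cos_zero] at h1
      rw [e2, Real.cos_pi] at h2
      exact hi (by linarith)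
    obtain ⟨x, hx⟩ := hne
    have hcod := han.preimage_zero_mem_codiscrete hx
    have h2 : ae (volume : Measure ℝ) ≤ codiscrete ℝ := by
      have := ae_restrict_le_codiscreteWithin (μ := (volume : Measure ℝ)) MeasurableSet.univ
      rwa [Measure.restrict_univ] at this
    filter_upwards [h2 hcod] with x hx
    change ∑ j, component ω p j ((y + LinearMap.single ℝ (fun _ : Fin N => ℝ) i x) j) ≠ 0
    rw [hval]
    exact hx
  set Z : Set (UnitAddTorus (Fin N)) := {θ | p ⬝ᵥ torusPhase ω θ = 0} with hZ
  have hZm : MeasurableSet Z :=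
    (isClosed_eq (continuous_dotProduct_torusPhase ω p) continuous_const).measurableSet
  have hint := integral_haarTorus (N := N) (Z.indicator (1 : UnitAddTorus (Fin N) → ℝ))
  rw [integral_indicator_one hZm] at hint
  have hzero : ∫ φ in Set.Icc (0 : Fin N → ℝ) (fun _ => 2 * Real.pi),
      Z.indicator (1 : UnitAddTorus (Fin N) → ℝ) (torusPoint φ) = 0 := by
    refine integral_eq_zero_of_ae (ae_restrict_of_ae ?_)
    filter_upwards [hae] with φ hφ
    have : torusPoint φ ∉ Z := by
      simp only [hZ, Set.mem_ofPred_eq, dotProduct_torusPhase_torusPoint]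
      exact hφ
    simp [this]
  rw [hzero, smul_zero, measureReal_eq_zero_iff] at hint
  exact compl_mem_ae_iff.mpr hint

/-- The pairing with `x` as a continuous linear form. -/
noncomputable def dotForm (x : State N) : State N →L[ℝ] ℝ :=
  ∑ a, x a • ContinuousLinearMap.proj a

theorem dotForm_apply (x p : State N) : dotForm x p = p ⬝ᵥ x := by
  simp [dotForm, dotProduct, mul_comm]

theorem continuous_dotForm : Continuous (dotForm (N := N)) := by
  unfold dotForm
  fun_prop

/-- Differentiation under the integral: the integrand is uniformly Lipschitz in p and, for almost
every point of the torus, differentiable at p, because the form vanishes only on a null set. -/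
theorem exists_hasFDerivAt_supportFn {ω : Fin N → ℝ} (hω : ∀ i, ω i ≠ 0) {p : State N}
    (hp : p ≠ 0) : ∃ L : State N →L[ℝ] ℝ, HasFDerivAt (supportFn ω) L p := by
  obtain ⟨M, hM, h⟩ := exists_abs_dotProduct_torusPhase_le ω
  have hfun : supportFn ω = fun p => ∫ θ, |p ⬝ᵥ torusPhase ω θ| ∂(haarTorus N) :=
    funext (supportFn_eq_integral ω)
  rw [hfun]
  refine ⟨_, (hasFDerivAt_integral_of_dominated_loc_of_lip (𝕜 := ℝ) (s := Set.univ)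
    (bound := fun _ => M)
    (F := fun p θ => |p ⬝ᵥ torusPhase ω θ|)
    (F' := fun θ => (SignType.sign (p ⬝ᵥ torusPhase ω θ) : ℝ) • dotForm (torusPhase ω θ))
    Filter.univ_mem ?_ (integrable_abs_dotProduct_torusPhase ω p) ?_ ?_
    (integrable_const M) ?_).2⟩
  · exact Eventually.of_forall fun q =>
      (continuous_dotProduct_torusPhase ω q).abs.aestronglyMeasurable
  · have hm : Measurable fun x : ℝ => ((SignType.sign x : SignType) : ℝ) := by
      have : (fun x : ℝ => ((SignType.sign x : SignType) : ℝ)) =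
          fun x => if 0 < x then 1 else if x < 0 then -1 else 0 := by
        funext x
        rw [sign_apply]
        split_ifs <;> simp
      rw [this]
      exact Measurable.ite measurableSet_Ioi measurable_const
        (Measurable.ite measurableSet_Iio measurable_const measurable_const)
    exact (hm.comp (continuous_dotProduct_torusPhase ω p).measurable).aestronglyMeasurable.smul
      (continuous_dotForm.comp (continuous_torusPhase ω)).aestronglyMeasurable
  · refine Eventually.of_forall fun θ => LipschitzOnWith.of_dist_le_mul fun q _ r _ => ?_
    rw [Real.dist_eq, dist_eq_norm]
    refine (abs_abs_sub_abs_le_abs_sub _ _).trans ?_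
    rw [← sub_dotProduct]
    simpa [abs_of_pos hM] using h (q - r) θ
  · filter_upwards [ae_dotProduct_torusPhase_ne_zero hω hp] with θ hθ
    have h1 : HasFDerivAt (fun q : State N => q ⬝ᵥ torusPhase ω θ) (dotForm (torusPhase ω θ)) p := by
      have : (fun q : State N => q ⬝ᵥ torusPhase ω θ) = dotForm (torusPhase ω θ) :=
        funext fun q => (dotForm_apply _ _).symm
      rw [this]
      exact (dotForm (torusPhase ω θ)).hasFDerivAt
    exact (hasDerivAt_abs hθ).comp_hasFDerivAt p h1

/-! ### The polar radius -/

theorem body_mem_nhds {ω : Fin N → ℝ} (hω : ∀ i, ω i ≠ 0) : body ω ∈ 𝓝 (0 : State N) := by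
  obtain ⟨c, hc, h⟩ := exists_le_supportFn hω
  refine Filter.mem_of_superset (Metric.ball_mem_nhds (0 : State N)
    (show 0 < c / (2 * N + 1) by positivity)) fun x hx p => ?_
  rw [mem_ball_zero_iff, lt_div_iff₀ (by positivity)] at hx
  calc x ⬝ᵥ p ≤ |x ⬝ᵥ p| := le_abs_self _
    _ ≤ 2 * N * ‖x‖ * ‖p‖ := abs_dotProduct_le x p
    _ ≤ c * ‖p‖ := by
      gcongr
      nlinarith [norm_nonneg x]
    _ ≤ _ := h p

theorem dotProduct_le_rho_mul {ω : Fin N → ℝ} (hω : ∀ i, ω i ≠ 0) (x p : State N) :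
    x ⬝ᵥ p ≤ rho ω x * supportFn ω p := by
  have h1 : ∀ r, rho ω x < r → x ⬝ᵥ p ≤ r * supportFn ω p := by
    intro r hr
    obtain ⟨b, hb, hbr, y, hy, rfl⟩ :=
      exists_lt_of_gauge_lt (absorbent_nhds_zero (body_mem_nhds hω)) hr
    simp only [smul_dotProduct, smul_eq_mul]
    calc b * (y ⬝ᵥ p) ≤ b * supportFn ω p := by gcongr; exact hy p
      _ ≤ r * supportFn ω p := by gcongr; exact supportFn_nonneg ω p
  have h2 : Tendsto (fun r => r * supportFn ω p) (𝓝[>] (rho ω x)) (𝓝 (rho ω x * supportFn ω p)) :=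
    ((continuous_id.mul continuous_const).tendsto _).mono_left nhdsWithin_le_nhds
  exact ge_of_tendsto h2 (eventually_nhdsWithin_of_forall h1)

theorem rho_nonneg (ω : Fin N → ℝ) (x : State N) : 0 ≤ rho ω x := gauge_nonneg x

theorem rho_zero (ω : Fin N → ℝ) : rho ω 0 = 0 := gauge_zero

theorem exists_supportFn_eq_one {ω : Fin N → ℝ} (hN : 0 < N) (hω : ∀ i, ω i ≠ 0) :
    ∃ p, supportFn ω p = 1 := by
  set q : State N := fun _ => 1
  have hq : q ≠ 0 := fun h => one_ne_zero (congrFun h (⟨0, hN⟩, 0))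
  refine ⟨(supportFn ω q)⁻¹ • q, ?_⟩
  have := supportFn_pos hω hq
  rw [supportFn_smul, abs_of_pos (by positivity), inv_mul_cancel₀ this.ne']

/-- The maximum m of (x, ·) on the compact level H = 1 is the required value: by homogeneity (x, q)
≤ m H(q) for all q, which says directly that x lies in m times the body. No separation theorem is
needed, since the body is defined by its support inequalities. -/
theorem exists_dotProduct_eq_rho {ω : Fin N → ℝ} (hN : 0 < N) (hω : ∀ i, ω i ≠ 0)
    (x : State N) : ∃ p, supportFn ω p = 1 ∧ x ⬝ᵥ p = rho ω x := by
  obtain ⟨p, hp, hmax⟩ := (isCompact_supportFn_eq_one hω).exists_isMaxOn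
    (exists_supportFn_eq_one hN hω) (f := fun p => x ⬝ᵥ p)
    (Continuous.dotProduct continuous_const continuous_id).continuousOn
  have hp1 : supportFn ω p = 1 := hp
  refine ⟨p, hp, le_antisymm ?_ ?_⟩
  · have := dotProduct_le_rho_mul hω x p
    rwa [hp1, mul_one] at this
  · have hall : ∀ q, x ⬝ᵥ q ≤ (x ⬝ᵥ p) * supportFn ω q := by
      intro q
      by_cases hq : q = 0
      · simp [hq, supportFn_zero]
      · have hq' := supportFn_pos hω hq
        have hmem : supportFn ω ((supportFn ω q)⁻¹ • q) = 1 := by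
          rw [supportFn_smul, abs_of_pos (by positivity), inv_mul_cancel₀ hq'.ne']
        have h1 := isMaxOn_iff.mp hmax _ hmem
        rw [dotProduct_smul, smul_eq_mul, inv_mul_le_iff₀ hq'] at h1
        linarith
    have h0 : 0 ≤ x ⬝ᵥ p := by
      have h1 := hall (-p)
      rw [supportFn_neg, hp1, mul_one, dotProduct_neg] at h1
      linarith
    refine gauge_le_of_mem h0 ?_
    rcases h0.eq_or_lt with h | h
    · rw [← h] at hall
      have hx : x = 0 := by
        have h2 := hall x
        rw [zero_mul] at h2
        exact dotProduct_self_eq_zero.mp (le_antisymm h2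
          (Finset.sum_nonneg fun a _ => mul_self_nonneg _))
      rw [hx]
      exact ⟨0, fun q => by rw [zero_dotProduct]; exact supportFn_nonneg ω q, by simp⟩
    · refine ⟨(x ⬝ᵥ p)⁻¹ • x, fun q => ?_, by simp [smul_smul, h.ne']⟩
      rw [smul_dotProduct, smul_eq_mul, inv_mul_le_iff₀ h]
      exact hall q

theorem rho_add_le {ω : Fin N → ℝ} (hN : 0 < N) (hω : ∀ i, ω i ≠ 0) (x y : State N) :
    rho ω (x + y) ≤ rho ω x + rho ω y := by
  obtain ⟨p, hp, h⟩ := exists_dotProduct_eq_rho hN hω (x + y)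
  have h1 := dotProduct_le_rho_mul hω x p
  have h2 := dotProduct_le_rho_mul hω y p
  rw [hp, mul_one] at h1 h2
  rw [← h, add_dotProduct]
  linarith

theorem exists_rho_le {ω : Fin N → ℝ} (hN : 0 < N) (hω : ∀ i, ω i ≠ 0) :
    ∃ M : ℝ, 0 < M ∧ ∀ x, rho ω x ≤ M * ‖x‖ := by
  obtain ⟨c, hc, h⟩ := exists_le_supportFn hω
  refine ⟨(2 * N + 1) / c, by positivity, fun x => ?_⟩
  obtain ⟨p, hp, hx⟩ := exists_dotProduct_eq_rho hN hω x
  have h1 := h p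
  rw [hp] at h1
  have h2 : ‖p‖ ≤ 1 / c := by rw [le_div_iff₀ hc]; linarith
  rw [← hx]
  calc x ⬝ᵥ p ≤ 2 * N * ‖x‖ * ‖p‖ := (le_abs_self _).trans (abs_dotProduct_le x p)
    _ ≤ (2 * N + 1) * ‖x‖ * (1 / c) := by gcongr; linarith
    _ = _ := by ring

theorem exists_norm_le_rho {ω : Fin N → ℝ} (hω : ∀ i, ω i ≠ 0) :
    ∃ M : ℝ, 0 < M ∧ ∀ x, ‖x‖ ≤ M * rho ω x := by
  obtain ⟨M, hM, h⟩ := exists_supportFn_le ω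
  refine ⟨M, hM, fun x => ?_⟩
  have hr := rho_nonneg ω x
  rw [pi_norm_le_iff_of_nonneg (by positivity)]
  intro a
  have h1 : ∀ c : ℝ, |c| = 1 → c * x a ≤ M * rho ω x := by
    intro c hc
    have h2 := dotProduct_le_rho_mul hω x (Pi.single a c)
    have h3 := h (Pi.single a c)
    rw [Pi.norm_single, Real.norm_eq_abs, hc, mul_one] at h3
    rw [dotProduct_single] at h2
    nlinarith
  rw [Real.norm_eq_abs, abs_le]
  have h2 := h1 1 (by simp)
  have h3 := h1 (-1) (by simp)
  constructor <;> linarith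

theorem rho_pos {ω : Fin N → ℝ} (hω : ∀ i, ω i ≠ 0) {x : State N} (hx : x ≠ 0) :
    0 < rho ω x := by
  obtain ⟨M, hM, h⟩ := exists_norm_le_rho hω
  have h1 := h x
  have h2 : 0 < ‖x‖ := norm_pos_iff.mpr hx
  exact pos_of_mul_pos_right (h2.trans_le h1) hM.le

theorem abs_rho_sub_le {ω : Fin N → ℝ} (hN : 0 < N) (hω : ∀ i, ω i ≠ 0) :
    ∃ M : ℝ, 0 < M ∧ ∀ x y, |rho ω x - rho ω y| ≤ M * ‖x - y‖ := by
  obtain ⟨M, hM, h⟩ := exists_rho_le hN hω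
  refine ⟨M, hM, fun x y => ?_⟩
  have h1 := rho_add_le hN hω (x - y) y
  have h2 := rho_add_le hN hω (y - x) x
  have h3 := h (x - y)
  have h4 := h (y - x)
  rw [norm_sub_rev] at h4
  simp only [sub_add_cancel] at h1 h2
  rw [abs_le]
  constructor <;> linarith

theorem continuous_rho {ω : Fin N → ℝ} (hN : 0 < N) (hω : ∀ i, ω i ≠ 0) :
    Continuous (rho ω) := by
  obtain ⟨M, hM, h⟩ := abs_rho_sub_le hN hω
  refine (LipschitzWith.of_dist_le_mul (K := ⟨M, hM.le⟩) fun p q => ?_).continuous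
  rw [Real.dist_eq, dist_eq_norm]
  exact h p q

/-! ### Momenta -/

/-- Momenta are the directions in which the duality inequality is an equality. Forward: Euler's
identity for the homogeneous H, which rules out p = 0 because H has a corner there. Backward: p
minimizes H minus the linear form of ρ(x)^{-1}x, so the derivative of the difference vanishes at p.
-/
theorem isMomentum_iff {ω : Fin N → ℝ} (hω : ∀ i, ω i ≠ 0) {x : State N} (hx : x ≠ 0)
    (p : State N) :
    IsMomentum ω x p ↔ p ≠ 0 ∧ x ⬝ᵥ p = rho ω x * supportFn ω p := by
  have hr := rho_pos hω hx
  constructor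
  · rintro ⟨L, hL, hd⟩
    have hray : ∀ q : State N, HasDerivAt (fun t : ℝ => supportFn ω (p + t • q)) (L q) 0 := by
      intro q
      have h1 : HasDerivAt (fun t : ℝ => p + t • q) q 0 := by
        simpa using ((hasDerivAt_id (0 : ℝ)).smul_const q).const_add p
      have h2 : HasFDerivAt (supportFn ω) L (p + (0 : ℝ) • q) := by simpa using hd
      exact h2.comp_hasDerivAt 0 h1
    have hp : p ≠ 0 := by
      rintro rfl
      have h1 := hray x
      have h2 : (fun t : ℝ => supportFn ω (0 + t • x)) = fun t => |t| * supportFn ω x := by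
        funext t; rw [zero_add, supportFn_smul]
      rw [h2] at h1
      have h3 := (h1.mul_const (supportFn ω x)⁻¹).differentiableAt
      have h4 := (supportFn_pos hω hx).ne'
      refine not_differentiableAt_abs_zero (h3.congr_of_eventuallyEq ?_)
      refine Eventually.of_forall fun t => ?_
      simp only [mul_assoc, mul_inv_cancel₀ h4, mul_one]
    refine ⟨hp, ?_⟩
    have h1 := hray p
    have h2 : HasDerivAt (fun t : ℝ => (1 + t) * supportFn ω p) (supportFn ω p) 0 := by
      simpa using ((hasDerivAt_id (0 : ℝ)).const_add 1).mul_const (supportFn ω p)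
    have h3 : (fun t : ℝ => supportFn ω (p + t • p)) =ᶠ[𝓝 0]
        fun t => (1 + t) * supportFn ω p := by
      filter_upwards [lt_mem_nhds (show (-1 : ℝ) < 0 by norm_num)] with t ht
      have : p + t • p = (1 + t) • p := by module
      rw [this, supportFn_smul, abs_of_pos (by linarith)]
    have h4 := h1.unique (h2.congr_of_eventuallyEq h3)
    rw [hL, smul_dotProduct, smul_eq_mul, inv_mul_eq_iff_eq_mul₀ hr.ne'] at h4
    exact h4
  · rintro ⟨hp, h⟩
    obtain ⟨L, hL⟩ := exists_hasFDerivAt_supportFn hω hp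
    refine ⟨L, ?_, hL⟩
    set D := dotForm ((rho ω x)⁻¹ • x) with hD
    have hmin : IsLocalMin (fun q => supportFn ω q - D q) p := by
      refine Eventually.of_forall fun q => ?_
      have hq : ∀ q, D q = (rho ω x)⁻¹ * (x ⬝ᵥ q) := by
        intro q
        rw [hD, dotForm_apply, dotProduct_smul, smul_eq_mul, dotProduct_comm]
      simp only [hq, h]
      rw [inv_mul_cancel_left₀ hr.ne', sub_self, sub_nonneg, inv_mul_le_iff₀ hr]
      exact dotProduct_le_rho_mul hω x q
    have h0 := hmin.hasFDerivAt_eq_zero (hL.sub D.hasFDerivAt)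
    intro q
    rw [sub_eq_zero.mp h0, hD, dotForm_apply, dotProduct_comm]

/-- The normalized momenta at nearby points are close to each other. -/
theorem momentum_uniformContinuous {ω : Fin N → ℝ} (hN : 0 < N) (hω : ∀ i, ω i ≠ 0)
    {ε : ℝ} (hε : 0 < ε) :
    ∃ δ : ℝ, 0 < δ ∧ ∀ x y p q : State N, supportFn ω p = 1 → supportFn ω q = 1 →
      x ⬝ᵥ p = rho ω x → y ⬝ᵥ q = rho ω y → 0 < rho ω y → ‖x - y‖ ≤ δ * rho ω y →
      ‖p - q‖ < ε := by
  obtain ⟨η, hη, h⟩ := supportFn_uniformConvex hω hε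
  obtain ⟨M, hM, hrho⟩ := exists_rho_le hN hω
  refine ⟨η / (2 * M), by positivity, fun x y p q hp hq hx hy hpos hxy => h p q hp hq ?_⟩
  have h1 := dotProduct_le_rho_mul hω y (p + q)
  have h2 := dotProduct_le_rho_mul hω (x - y) p
  have h3 := rho_add_le hN hω (y - x) x
  have h4 := hrho (y - x)
  have h5 := hrho (x - y)
  rw [norm_sub_rev] at h4
  rw [sub_add_cancel] at h3
  rw [hp, mul_one, sub_dotProduct, hx] at h2
  rw [dotProduct_add, hy] at h1
  have h6 : M * ‖x - y‖ ≤ η / 2 * rho ω y := by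
    calc M * ‖x - y‖ ≤ M * (η / (2 * M) * rho ω y) := by gcongr
      _ = _ := by field_simp
  -- Replacing x by y in (x, p) = ρ(x) costs at most 2M‖x - y‖ ≤ ηρ(y), so p + q nearly attains the
  -- value 2 on y, and uniform convexity applies.
  have h7 : (2 - η) * rho ω y ≤ supportFn ω (p + q) * rho ω y := by linarith
  exact le_of_mul_le_mul_right h7 hpos

/-! ### The free flow -/

/-- The free flow `e^{At}`. -/
noncomputable def flow (ω : Fin N → ℝ) (t : ℝ) (x : State N) : State N := fun a =>
  if a.2 = 0 then
    Real.cos (ω a.1 * t) * x (a.1, 0) + (ω a.1)⁻¹ * Real.sin (ω a.1 * t) * x (a.1, 1)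
  else -(ω a.1 * Real.sin (ω a.1 * t) * x (a.1, 0)) + Real.cos (ω a.1 * t) * x (a.1, 1)

/-- The transpose of the free flow. -/
noncomputable def coflow (ω : Fin N → ℝ) (t : ℝ) (p : State N) : State N := fun a =>
  if a.2 = 0 then
    Real.cos (ω a.1 * t) * p (a.1, 0) - ω a.1 * Real.sin (ω a.1 * t) * p (a.1, 1)
  else (ω a.1)⁻¹ * Real.sin (ω a.1 * t) * p (a.1, 0) + Real.cos (ω a.1 * t) * p (a.1, 1)

/-- The vector `e^{-At} B`. -/
noncomputable def drive (ω : Fin N → ℝ) (t : ℝ) : State N := fun a =>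
  if a.2 = 0 then -((ω a.1)⁻¹ * Real.sin (ω a.1 * t)) else Real.cos (ω a.1 * t)

section values

variable (ω : Fin N → ℝ) (t : ℝ) (x : State N) (i : Fin N)

theorem flow_zero_comp : flow ω t x (i, 0) =
    Real.cos (ω i * t) * x (i, 0) + (ω i)⁻¹ * Real.sin (ω i * t) * x (i, 1) := rfl

theorem flow_one_comp : flow ω t x (i, 1) =
    -(ω i * Real.sin (ω i * t) * x (i, 0)) + Real.cos (ω i * t) * x (i, 1) := rfl

theorem coflow_zero_comp : coflow ω t x (i, 0) =
    Real.cos (ω i * t) * x (i, 0) - ω i * Real.sin (ω i * t) * x (i, 1) := rfl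

theorem coflow_one_comp : coflow ω t x (i, 1) =
    (ω i)⁻¹ * Real.sin (ω i * t) * x (i, 0) + Real.cos (ω i * t) * x (i, 1) := rfl

theorem drive_zero_comp : drive ω t (i, 0) = -((ω i)⁻¹ * Real.sin (ω i * t)) := rfl

theorem drive_one_comp : drive ω t (i, 1) = Real.cos (ω i * t) := rfl

theorem sysB_zero_comp : sysB N (i, 0) = 0 := rfl

theorem sysB_one_comp : sysB N (i, 1) = 1 := rfl

theorem sysA_mulVec_zero_comp : (sysA ω *ᵥ x) (i, 0) = x (i, 1) := by
  rw [mulVec, dotProduct, Fintype.sum_prod_type, Finset.sum_eq_single i]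
  · simp [sysA]
  · intro j _ hj
    simp [sysA, hj.symm]
  · simp

theorem sysA_mulVec_one_comp : (sysA ω *ᵥ x) (i, 1) = -(ω i) ^ 2 * x (i, 0) := by
  rw [mulVec, dotProduct, Fintype.sum_prod_type, Finset.sum_eq_single i]
  · simp [sysA]
  · intro j _ hj
    simp [sysA, hj.symm]
  · simp

end values

theorem state_ext {x y : State N} (h0 : ∀ i, x (i, 0) = y (i, 0))
    (h1 : ∀ i, x (i, 1) = y (i, 1)) : x = y := by
  funext ⟨i, k⟩
  fin_cases k
  · exact h0 i
  · exact h1 i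

theorem flow_neg_dotProduct_coflow {ω : Fin N → ℝ} (hω : ∀ i, ω i ≠ 0) (t : ℝ) (x p : State N) :
    flow ω (-t) x ⬝ᵥ coflow ω t p = x ⬝ᵥ p := by
  rw [dotProduct_eq_sum, dotProduct_eq_sum]
  refine Finset.sum_congr rfl fun i _ => ?_
  rw [flow_zero_comp, flow_one_comp, coflow_zero_comp, coflow_one_comp, mul_neg, Real.cos_neg,
    Real.sin_neg]
  have h := Real.sin_sq_add_cos_sq (ω i * t)
  have hi := mul_inv_cancel₀ (hω i)
  linear_combination (x (i, 0) * p (i, 0) * Real.sin (ω i * t) ^ 2 +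
    x (i, 1) * p (i, 1) * Real.sin (ω i * t) ^ 2) * hi +
    (x (i, 0) * p (i, 0) + x (i, 1) * p (i, 1)) * h

theorem flow_add {ω : Fin N → ℝ} (hω : ∀ i, ω i ≠ 0) (s t : ℝ) (x : State N) :
    flow ω (s + t) x = flow ω s (flow ω t x) := by
  refine state_ext (fun i => ?_) (fun i => ?_)
  · simp only [flow_zero_comp, flow_one_comp, mul_add, Real.cos_add, Real.sin_add]
    have hi := mul_inv_cancel₀ (hω i)
    linear_combination (Real.sin (ω i * s) * Real.sin (ω i * t) * x (i, 0)) * hi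
  · simp only [flow_zero_comp, flow_one_comp, mul_add, Real.cos_add, Real.sin_add]
    have hi := mul_inv_cancel₀ (hω i)
    linear_combination (Real.sin (ω i * s) * Real.sin (ω i * t) * x (i, 1)) * hi

theorem flow_zero (ω : Fin N → ℝ) (x : State N) : flow ω 0 x = x := by
  refine state_ext (fun i => ?_) (fun i => ?_)
  · simp [flow_zero_comp]
  · simp [flow_one_comp]

theorem flow_neg_flow {ω : Fin N → ℝ} (hω : ∀ i, ω i ≠ 0) (t : ℝ) (x : State N) :
    flow ω (-t) (flow ω t x) = x := by
  rw [← flow_add hω, neg_add_cancel, flow_zero]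

theorem flow_apply_zero (ω : Fin N → ℝ) (t : ℝ) : flow ω t 0 = 0 := by
  refine state_ext (fun i => ?_) (fun i => ?_)
  · simp [flow_zero_comp]
  · simp [flow_one_comp]

theorem drive_eq_flow (ω : Fin N → ℝ) (t : ℝ) : drive ω t = flow ω (-t) (sysB N) := by
  refine state_ext (fun i => ?_) (fun i => ?_)
  · simp [flow_zero_comp, drive_zero_comp, sysB_zero_comp, sysB_one_comp]
  · simp [flow_one_comp, drive_one_comp, sysB_zero_comp, sysB_one_comp]

/-- The adjoint flow rotates each pair (ω_i^{-1}ξ_i, η_i), so it preserves the amplitudes. -/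
theorem supportFn_coflow {ω : Fin N → ℝ} (hω : ∀ i, ω i ≠ 0) (t : ℝ) (p : State N) :
    supportFn ω (coflow ω t p) = supportFn ω p := by
  have : amplitude ω (coflow ω t p) = amplitude ω p := by
    funext i
    rw [amplitude, amplitude, coflow_zero_comp, coflow_one_comp]
    congr 1
    have h := Real.sin_sq_add_cos_sq (ω i * t)
    have := hω i
    field_simp
    linear_combination (p (i, 0) ^ 2 + p (i, 1) ^ 2 * ω i ^ 2) * h
  rw [supportFn, this, supportFn]

theorem drive_dotProduct_coflow {ω : Fin N → ℝ} (hω : ∀ i, ω i ≠ 0) (t : ℝ) (p : State N) :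
    drive ω t ⬝ᵥ coflow ω t p = sysB N ⬝ᵥ p := by
  rw [drive_eq_flow, flow_neg_dotProduct_coflow hω]

theorem rho_flow {ω : Fin N → ℝ} (hN : 0 < N) (hω : ∀ i, ω i ≠ 0) (t : ℝ) (x : State N) :
    rho ω (flow ω t x) = rho ω x := by
  have key : ∀ t x, rho ω (flow ω t x) ≤ rho ω x := by
    intro t x
    obtain ⟨p, hp, h⟩ := exists_dotProduct_eq_rho hN hω (flow ω t x)
    rw [← h, ← flow_neg_dotProduct_coflow hω t, flow_neg_flow hω]
    refine (dotProduct_le_rho_mul hω _ _).trans (le_of_eq ?_)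
    rw [supportFn_coflow hω, hp, mul_one]
  refine le_antisymm (key t x) ?_
  conv_lhs => rw [← flow_neg_flow hω t x]
  exact key _ _

/-- This turns time averages of the forcing into averages along a line on the torus. -/
theorem drive_eq_torusPhase (ω : Fin N → ℝ) (s : ℝ) :
    drive ω s = torusPhase ω (torusPoint (s • (-ω))) := by
  refine state_ext (fun i => ?_) (fun i => ?_)
  · rw [torusPhase_torusPoint_zero, drive_zero_comp]
    simp [mul_comm s]
  · rw [torusPhase_torusPoint_one, drive_one_comp]
    simp [mul_comm s]

theorem continuous_drive (ω : Fin N → ℝ) : Continuous (drive ω) := by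
  have : drive ω = fun s => torusPhase ω (torusPoint (s • (-ω))) :=
    funext (drive_eq_torusPhase ω)
  rw [this]
  exact (continuous_torusPhase ω).comp (continuous_torusPoint_line (-ω))

theorem continuous_dotProduct_drive (ω : Fin N → ℝ) (p : State N) :
    Continuous fun s => p ⬝ᵥ drive ω s :=
  Continuous.dotProduct continuous_const (continuous_drive ω)

theorem exists_norm_drive_le (ω : Fin N → ℝ) : ∃ M : ℝ, 0 < M ∧ ∀ s, ‖drive ω s‖ ≤ M := by
  obtain ⟨M, hM, h⟩ := exists_norm_torusPhase_le ω
  exact ⟨M, hM, fun s => by rw [drive_eq_torusPhase]; exact h _⟩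

theorem continuous_flow (ω : Fin N → ℝ) : Continuous fun z : ℝ × State N => flow ω z.1 z.2 := by
  refine continuous_pi fun a => ?_
  unfold flow
  split_ifs <;> fun_prop

theorem continuousOn_flow (ω : Fin N → ℝ) {z : ℝ → State N} {s : Set ℝ}
    (hz : ContinuousOn z s) : ContinuousOn (fun t => flow ω t (z t)) s := by
  have hz' := continuousOn_pi.mp hz
  refine continuousOn_pi.mpr fun a => ?_
  have h0 := hz' (a.1, 0)
  have h1 := hz' (a.1, 1)
  unfold flow
  split_ifs <;> fun_prop

/-! ### Mean values of `|(p, e^{-At} B)|` -/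

theorem dotProduct_drive_add {ω : Fin N → ℝ} (hω : ∀ i, ω i ≠ 0) (a s : ℝ) (p : State N) :
    p ⬝ᵥ drive ω (a + s) = coflow ω (-a) p ⬝ᵥ drive ω s := by
  have h := flow_neg_dotProduct_coflow hω (-a) (drive ω (a + s)) p
  rw [dotProduct_comm, ← h, dotProduct_comm, neg_neg]
  congr 1
  rw [drive_eq_flow, drive_eq_flow, ← flow_add hω]
  congr 1
  ring

theorem tendsto_mean_drive {ω : Fin N → ℝ}
    (hres : ∀ m : Fin N → ℤ, ∑ i, (m i : ℝ) * ω i = 0 → m = 0) (p : State N) :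
    Tendsto (fun L : ℝ => L⁻¹ * ∫ s in (0 : ℝ)..L, |p ⬝ᵥ drive ω s|) atTop
      (𝓝 (supportFn ω p)) := by
  rw [supportFn_eq_integral]
  simp_rw [drive_eq_torusPhase]
  refine tendsto_lineMean_real (ν := -ω) (fun m hm => hres m ?_)
    (continuous_dotProduct_torusPhase ω p).abs
  simpa [Finset.sum_neg_distrib] using hm

/-- Moving the window by a amounts to moving p by the adjoint flow, which stays on the level H = 1.
That level is compact and the means are Lipschitz in p uniformly in L, so convergence at a finite
net suffices. -/
theorem exists_mean_drive_uniform {ω : Fin N → ℝ} (hω : ∀ i, ω i ≠ 0)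
    (hres : ∀ m : Fin N → ℤ, ∑ i, (m i : ℝ) * ω i = 0 → m = 0) {ε : ℝ} (hε : 0 < ε) :
    ∃ L₀ : ℝ, 0 < L₀ ∧ ∀ L, L₀ ≤ L → ∀ (a : ℝ) (p : State N), supportFn ω p = 1 →
      |(∫ s in a..(a + L), |p ⬝ᵥ drive ω s|) - L| ≤ ε * L := by
  obtain ⟨M, hM, hdot⟩ := exists_abs_dotProduct_torusPhase_le ω
  have hK := isCompact_supportFn_eq_one hω
  set η := ε / (2 * M) with hη
  have hηpos : 0 < η := by positivity
  obtain ⟨F, hFK, hFfin, hFcov⟩ := hK.finite_cover_balls hηpos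
  have hev : ∀ᶠ L : ℝ in atTop, ∀ q ∈ F,
      |L⁻¹ * (∫ s in (0 : ℝ)..L, |q ⬝ᵥ drive ω s|) - 1| < ε / 2 := by
    rw [Filter.eventually_all_finite hFfin]
    intro q hq
    have h := tendsto_mean_drive hres q
    have hq1 : supportFn ω q = 1 := hFK hq
    rw [hq1] at h
    have := Metric.tendsto_nhds.mp h (ε / 2) (by positivity)
    simpa [Real.dist_eq] using this
  obtain ⟨L₁, hL₁⟩ := eventually_atTop.mp hev
  refine ⟨max L₁ 1, by positivity, fun L hL a p hp => ?_⟩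
  have hLpos : 0 < L := lt_of_lt_of_le one_pos ((le_max_right _ _).trans hL)
  set p' := coflow ω (-a) p with hp'
  have hshift : ∫ s in a..(a + L), |p ⬝ᵥ drive ω s| = ∫ s in (0 : ℝ)..L, |p' ⬝ᵥ drive ω s| := by
    have := intervalIntegral.integral_comp_add_left (a := 0) (b := L)
      (fun s => |p ⬝ᵥ drive ω s|) a
    rw [add_zero] at this
    rw [← this]
    simp_rw [dotProduct_drive_add hω]
    rfl
  have hp1 : supportFn ω p' = 1 := by rw [hp', supportFn_coflow hω, hp]
  obtain ⟨q, hqF, hq⟩ := Set.mem_iUnion₂.mp (hFcov hp1)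
  rw [Metric.mem_ball, dist_eq_norm] at hq
  have h1 := hL₁ L ((le_max_left _ _).trans hL) q hqF
  have hint : ∀ q : State N, IntervalIntegrable (fun s => |q ⬝ᵥ drive ω s|) volume 0 L :=
    fun q => (continuous_dotProduct_drive ω q).abs.intervalIntegrable 0 L
  have h2 : |(∫ s in (0 : ℝ)..L, |p' ⬝ᵥ drive ω s|) - (∫ s in (0 : ℝ)..L, |q ⬝ᵥ drive ω s|)| ≤
      (ε / 2) * L := by
    rw [← intervalIntegral.integral_sub (hint p') (hint q)]
    have := intervalIntegral.norm_integral_le_of_norm_le_const (a := 0) (b := L) (C := ε / 2)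
      (f := fun s => |p' ⬝ᵥ drive ω s| - |q ⬝ᵥ drive ω s|) (fun s _ => by
        rw [Real.norm_eq_abs]
        refine (abs_abs_sub_abs_le_abs_sub _ _).trans ?_
        rw [← sub_dotProduct, drive_eq_torusPhase]
        refine (hdot _ _).trans ?_
        calc M * ‖p' - q‖ ≤ M * η := by gcongr
          _ = ε / 2 := by rw [hη]; field_simp)
    rwa [sub_zero, abs_of_pos hLpos] at this
  have h3 : |(∫ s in (0 : ℝ)..L, |q ⬝ᵥ drive ω s|) - L| ≤ (ε / 2) * L := by
    have e : (∫ s in (0 : ℝ)..L, |q ⬝ᵥ drive ω s|) - L =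
        L * (L⁻¹ * (∫ s in (0 : ℝ)..L, |q ⬝ᵥ drive ω s|) - 1) := by field_simp
    rw [e, abs_mul, abs_of_pos hLpos, mul_comm]
    gcongr
  rw [hshift]
  calc _ ≤ _ := abs_sub_le _ (∫ s in (0 : ℝ)..L, |q ⬝ᵥ drive ω s|) _
    _ ≤ _ := by linarith

/-! ### Trajectories -/

/-- Integration by parts when g is only absolutely continuous, as are the components of a trajectory
under a merely integrable control. -/
theorem integral_product_rule {f f' g h : ℝ → ℝ} {T : ℝ}
    (hf : ∀ t, HasDerivAt f (f' t) t) (hf' : Continuous f')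
    (hh : IntervalIntegrable h volume 0 T) (hT : 0 ≤ T)
    (hg : ∀ t ∈ Set.Icc 0 T, g t = g 0 + ∫ s in (0 : ℝ)..t, h s) :
    f T * g T = f 0 * g 0 + ∫ s in (0 : ℝ)..T, (f' s * g s + f s * h s) := by
  set G : ℝ → ℝ := fun t => g 0 + ∫ s in (0 : ℝ)..t, h s with hG
  have hf1 : ContDiff ℝ 1 f := by
    rw [contDiff_one_iff_deriv]
    refine ⟨fun t => (hf t).differentiableAt, ?_⟩
    have : deriv f = f' := funext fun t => (hf t).deriv
    rwa [this]
  have hfac : AbsolutelyContinuousOnInterval f 0 T :=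
    hf1.contDiffOn.absolutelyContinuousOnInterval
  have hGac : AbsolutelyContinuousOnInterval G 0 T := by
    have h1 : AbsolutelyContinuousOnInterval (fun _ : ℝ => g 0) 0 T :=
      (contDiff_const (n := 1)).contDiffOn.absolutelyContinuousOnInterval
    exact h1.add (hh.absolutelyContinuousOnInterval_intervalIntegral (c := 0) (by simp))
  have hmain := hfac.integral_deriv_mul_eq_sub hGac
  have hg0 : G 0 = g 0 := by simp [hG]
  have hgT : G T = g T := (hg T ⟨hT, le_rfl⟩).symm
  rw [hg0, hgT] at hmain
  have hcongr : ∫ s in (0 : ℝ)..T, (deriv f s * G s + f s * deriv G s) =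
      ∫ s in (0 : ℝ)..T, (f' s * g s + f s * h s) := by
    refine intervalIntegral.integral_congr_ae ?_
    filter_upwards [hh.ae_hasDerivAt_integral] with s hs hmem
    have hs' : s ∈ Set.uIcc 0 T := Set.uIoc_subset_uIcc hmem
    have h1 := (hs hs' 0 (by simp)).const_add (g 0)
    have h2 : G s = g s := by
      rw [Set.uIcc_of_le hT] at hs'
      exact (hg s hs').symm
    rw [(hf s).deriv, h2]
    congr 2
    exact h1.deriv
  rw [← hcongr, hmain]
  ring

theorem integral_apply {F : ℝ → State N} {a b : ℝ} (hF : IntervalIntegrable F volume a b)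
    (c : Fin N × Fin 2) : (∫ s in a..b, F s) c = ∫ s in a..b, F s c :=
  ((ContinuousLinearMap.proj (R := ℝ) (φ := fun _ : Fin N × Fin 2 => ℝ)
    c).intervalIntegral_comp_comm hF).symm

theorem intervalIntegrable_state {F : ℝ → State N} {a b : ℝ}
    (h : ∀ c, IntervalIntegrable (fun s => F s c) volume a b) :
    IntervalIntegrable F volume a b :=
  ⟨Integrable.of_eval fun c => (h c).1, Integrable.of_eval fun c => (h c).2⟩

theorem intervalIntegrable_smul_drive (ω : Fin N → ℝ) {u : ℝ → ℝ} {a b : ℝ}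
    (hu : IntervalIntegrable u volume a b) :
    IntervalIntegrable (fun s => u s • drive ω s) volume a b :=
  intervalIntegrable_state fun c => hu.mul_continuousOn
    ((continuous_apply c).comp (continuous_drive ω)).continuousOn

theorem IsTrajectory.intervalIntegrable_rhs {ω : Fin N → ℝ} {x : State N} {y : ℝ → State N}
    {u : ℝ → ℝ} (h : IsTrajectory ω x y u) {t : ℝ} (ht : 0 ≤ t) :
    IntervalIntegrable (fun s => sysA ω *ᵥ y s + u s • sysB N) volume 0 t := by
  refine IntervalIntegrable.add ?_ (intervalIntegrable_state fun c =>
    (h.intervalIntegrable t ht).mul_const _)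
  refine ContinuousOn.intervalIntegrable ?_
  have h1 : ContinuousOn y (Set.uIcc 0 t) := h.continuousOn.mono (by
    rw [Set.uIcc_of_le ht]; exact Set.Icc_subset_Ici_self)
  exact (Continuous.matrix_mulVec continuous_const continuous_id).comp_continuousOn h1

theorem IsTrajectory.apply_zero_eq {ω : Fin N → ℝ} {x : State N} {y : ℝ → State N}
    {u : ℝ → ℝ} (h : IsTrajectory ω x y u) : y 0 = x := by
  simpa using h.eq_integral 0 le_rfl

theorem IsTrajectory.position_eq {ω : Fin N → ℝ} {x : State N} {y : ℝ → State N}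
    {u : ℝ → ℝ} (h : IsTrajectory ω x y u) {t : ℝ} (ht : 0 ≤ t) (i : Fin N) :
    y t (i, 0) = y 0 (i, 0) + ∫ s in (0 : ℝ)..t, y s (i, 1) := by
  rw [h.eq_integral t ht, Pi.add_apply, integral_apply (h.intervalIntegrable_rhs ht),
    h.apply_zero_eq]
  simp [sysA_mulVec_zero_comp, sysB_zero_comp]

theorem IsTrajectory.velocity_eq {ω : Fin N → ℝ} {x : State N} {y : ℝ → State N}
    {u : ℝ → ℝ} (h : IsTrajectory ω x y u) {t : ℝ} (ht : 0 ≤ t) (i : Fin N) :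
    y t (i, 1) = y 0 (i, 1) + ∫ s in (0 : ℝ)..t, (-(ω i) ^ 2 * y s (i, 0) + u s) := by
  rw [h.eq_integral t ht, Pi.add_apply, integral_apply (h.intervalIntegrable_rhs ht),
    h.apply_zero_eq]
  simp [sysA_mulVec_one_comp, sysB_one_comp]

theorem hasDerivAt_cos_mul (c t : ℝ) :
    HasDerivAt (fun t => Real.cos (c * t)) (-(c * Real.sin (c * t))) t := by
  simpa [mul_comm] using ((hasDerivAt_id t).const_mul c).cos

theorem hasDerivAt_sin_mul (c t : ℝ) :
    HasDerivAt (fun t => Real.sin (c * t)) (c * Real.cos (c * t)) t := by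
  simpa [mul_comm] using ((hasDerivAt_id t).const_mul c).sin

theorem IsTrajectory.continuousOn_comp {ω : Fin N → ℝ} {x : State N} {y : ℝ → State N}
    {u : ℝ → ℝ} (h : IsTrajectory ω x y u) {t : ℝ} (ht : 0 ≤ t) (a : Fin N × Fin 2) :
    ContinuousOn (fun s => y s a) (Set.uIcc 0 t) :=
  (continuous_apply a).comp_continuousOn (h.continuousOn.mono (by
    rw [Set.uIcc_of_le ht]; exact Set.Icc_subset_Ici_self))

/-- Variation of constants. -/
theorem IsTrajectory.flow_neg_eq {ω : Fin N → ℝ} (hω : ∀ i, ω i ≠ 0) {x : State N}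
    {y : ℝ → State N} {u : ℝ → ℝ} (h : IsTrajectory ω x y u) {t : ℝ} (ht : 0 ≤ t) :
    flow ω (-t) (y t) = x + ∫ s in (0 : ℝ)..t, u s • drive ω s := by
  have hu := h.intervalIntegrable t ht
  have hy := h.continuousOn_comp ht
  have hh0 : ∀ i, IntervalIntegrable (fun s => y s (i, 1)) volume 0 t :=
    fun i => (hy (i, 1)).intervalIntegrable
  have hh1 : ∀ i, IntervalIntegrable (fun s => -(ω i) ^ 2 * y s (i, 0) + u s) volume 0 t :=
    fun i => ((hy (i, 0)).intervalIntegrable.const_mul _).add hu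
  have hcs : ∀ (i : Fin N) (g h f f' : ℝ → ℝ), IntervalIntegrable h volume 0 t →
      ContinuousOn g (Set.uIcc 0 t) → Continuous f → Continuous f' →
      IntervalIntegrable (fun s => f' s * g s + f s * h s) volume 0 t := by
    intro i g h f f' hh hg hf hf'
    exact ((hf'.continuousOn.mul hg).intervalIntegrable).add (hh.continuousOn_mul hf.continuousOn)
  have hx : y 0 = x := h.apply_zero_eq
  refine state_ext (fun i => ?_) (fun i => ?_)
  · have p0 := integral_product_rule (g := fun s => y s (i, 0)) (hasDerivAt_cos_mul (ω i))
      (by fun_prop) (hh0 i) ht (fun s hs => h.position_eq hs.1 i)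
    have p1 := integral_product_rule (g := fun s => y s (i, 1)) (hasDerivAt_sin_mul (ω i))
      (by fun_prop) (hh1 i) ht (fun s hs => h.velocity_eq hs.1 i)
    rw [flow_zero_comp, Pi.add_apply, integral_apply (intervalIntegrable_smul_drive ω hu), mul_neg,
      Real.cos_neg, Real.sin_neg]
    have e : Real.cos (ω i * t) * y t (i, 0) + (ω i)⁻¹ * -Real.sin (ω i * t) * y t (i, 1) =
      Real.cos (ω i * t) * y t (i, 0) - (ω i)⁻¹ * (Real.sin (ω i * t) * y t (i, 1)) := by ring
    rw [e, p0, p1]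
    simp only [mul_zero, Real.cos_zero, Real.sin_zero, one_mul, zero_mul, zero_add, hx]
    rw [← intervalIntegral.integral_const_mul, add_sub_assoc,
      ← intervalIntegral.integral_sub (hcs i _ _ _ _ (hh0 i) (hy _) (by fun_prop) (by fun_prop))
      ((hcs i _ _ _ _ (hh1 i) (hy _) (by fun_prop) (by fun_prop)).const_mul _)]
    congr 1
    refine intervalIntegral.integral_congr fun s _ => ?_
    simp only [Pi.smul_apply, smul_eq_mul, drive_zero_comp]
    have hi := hω i
    field_simp
    ring
  · have p0 := integral_product_rule (g := fun s => y s (i, 0)) (hasDerivAt_sin_mul (ω i))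
      (by fun_prop) (hh0 i) ht (fun s hs => h.position_eq hs.1 i)
    have p1 := integral_product_rule (g := fun s => y s (i, 1)) (hasDerivAt_cos_mul (ω i))
      (by fun_prop) (hh1 i) ht (fun s hs => h.velocity_eq hs.1 i)
    rw [flow_one_comp, Pi.add_apply, integral_apply (intervalIntegrable_smul_drive ω hu), mul_neg,
      Real.cos_neg, Real.sin_neg]
    have e : -(ω i * -Real.sin (ω i * t) * y t (i, 0)) + Real.cos (ω i * t) * y t (i, 1) =
      Real.cos (ω i * t) * y t (i, 1) + ω i * (Real.sin (ω i * t) * y t (i, 0)) := by ring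
    rw [e, p0, p1]
    simp only [mul_zero, Real.cos_zero, Real.sin_zero, one_mul, zero_mul, zero_add, hx]
    rw [← intervalIntegral.integral_const_mul, add_assoc,
      ← intervalIntegral.integral_add (hcs i _ _ _ _ (hh1 i) (hy _) (by fun_prop) (by fun_prop))
      ((hcs i _ _ _ _ (hh0 i) (hy _) (by fun_prop) (by fun_prop)).const_mul _)]
    congr 1
    refine intervalIntegral.integral_congr fun s _ => ?_
    simp only [Pi.smul_apply, smul_eq_mul, drive_one_comp]
    ring

/-- A control drives the system along the trajectory given by the variation of constants. -/
theorem isTrajectory_of_flow {ω : Fin N → ℝ} (hω : ∀ i, ω i ≠ 0) {x : State N}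
    {z : ℝ → State N} {u : ℝ → ℝ} (hu : ∀ t, 0 ≤ t → IntervalIntegrable u volume 0 t)
    (hzc : ContinuousOn z (Set.Ici 0))
    (hz : ∀ t, 0 ≤ t → z t = x + ∫ s in (0 : ℝ)..t, u s • drive ω s) :
    IsTrajectory ω x (fun t => flow ω t (z t)) u := by
  have hcont := continuousOn_flow ω hzc
  refine ⟨hcont, hu, fun t ht => ?_⟩
  have hsub : Set.uIcc 0 t ⊆ Set.Ici 0 := by
    rw [Set.uIcc_of_le ht]; exact Set.Icc_subset_Ici_self
  have hrhs : IntervalIntegrable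
      (fun s => sysA ω *ᵥ flow ω s (z s) + u s • sysB N) volume 0 t := by
    refine IntervalIntegrable.add ?_ (intervalIntegrable_state fun c => (hu t ht).mul_const _)
    refine ContinuousOn.intervalIntegrable ?_
    have h1 : ContinuousOn (fun t => flow ω t (z t)) (Set.uIcc 0 t) := hcont.mono hsub
    exact (Continuous.matrix_mulVec continuous_const continuous_id).comp_continuousOn h1
  have hz0 : z 0 = x := by simpa using hz 0 le_rfl
  have hzcomp : ∀ a : Fin N × Fin 2, ∀ s ∈ Set.Icc 0 t,
      z s a = z 0 a + ∫ r in (0 : ℝ)..s, u r * drive ω r a := by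
    intro a s hs
    rw [hz s hs.1, Pi.add_apply, integral_apply (intervalIntegrable_smul_drive ω (hu s hs.1)), hz0]
    simp
  have hh : ∀ a : Fin N × Fin 2, IntervalIntegrable (fun r => u r * drive ω r a) volume 0 t :=
    fun a => (hu t ht).mul_continuousOn
      ((continuous_apply a).comp (continuous_drive ω)).continuousOn
  have hy : ∀ a : Fin N × Fin 2, ContinuousOn (fun s => z s a) (Set.uIcc 0 t) := fun a =>
    (continuous_apply a).comp_continuousOn (hzc.mono hsub)
  have hcs : ∀ (i : Fin N) (g h f f' : ℝ → ℝ), IntervalIntegrable h volume 0 t →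
      ContinuousOn g (Set.uIcc 0 t) → Continuous f → Continuous f' →
      IntervalIntegrable (fun s => f' s * g s + f s * h s) volume 0 t := by
    intro i g h f f' hh hg hf hf'
    exact ((hf'.continuousOn.mul hg).intervalIntegrable).add (hh.continuousOn_mul hf.continuousOn)
  refine state_ext (fun i => ?_) (fun i => ?_)
  · have p0 := integral_product_rule (g := fun s => z s (i, 0)) (hasDerivAt_cos_mul (ω i))
      (by fun_prop) (hh (i, 0)) ht (hzcomp (i, 0))
    have p1 := integral_product_rule (g := fun s => z s (i, 1)) (hasDerivAt_sin_mul (ω i))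
      (by fun_prop) (hh (i, 1)) ht (hzcomp (i, 1))
    rw [flow_zero_comp, Pi.add_apply, integral_apply hrhs, mul_assoc, p0, p1]
    simp only [mul_zero, Real.cos_zero, Real.sin_zero, one_mul, zero_mul, zero_add, hz0]
    rw [← intervalIntegral.integral_const_mul, add_assoc,
      ← intervalIntegral.integral_add
        (hcs i _ _ _ _ (hh (i, 0)) (hy _) (by fun_prop) (by fun_prop))
        ((hcs i _ _ _ _ (hh (i, 1)) (hy _) (by fun_prop) (by fun_prop)).const_mul _)]
    congr 1
    refine intervalIntegral.integral_congr fun s _ => ?_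
    simp only [Pi.add_apply, Pi.smul_apply, smul_eq_mul, sysA_mulVec_zero_comp, sysB_zero_comp,
      flow_one_comp, drive_zero_comp, drive_one_comp]
    have hi := hω i
    field_simp
    ring
  · have p0 := integral_product_rule (g := fun s => z s (i, 0)) (hasDerivAt_sin_mul (ω i))
      (by fun_prop) (hh (i, 0)) ht (hzcomp (i, 0))
    have p1 := integral_product_rule (g := fun s => z s (i, 1)) (hasDerivAt_cos_mul (ω i))
      (by fun_prop) (hh (i, 1)) ht (hzcomp (i, 1))
    rw [flow_one_comp, Pi.add_apply, integral_apply hrhs, mul_assoc, p0, p1]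
    simp only [mul_zero, Real.cos_zero, Real.sin_zero, one_mul, zero_mul, zero_add, hz0]
    rw [← intervalIntegral.integral_const_mul, neg_add_eq_sub, add_sub_assoc,
      ← intervalIntegral.integral_sub
        (hcs i _ _ _ _ (hh (i, 1)) (hy _) (by fun_prop) (by fun_prop))
        ((hcs i _ _ _ _ (hh (i, 0)) (hy _) (by fun_prop) (by fun_prop)).const_mul _)]
    congr 1
    refine intervalIntegral.integral_congr fun s _ => ?_
    simp only [Pi.add_apply, Pi.smul_apply, smul_eq_mul, sysA_mulVec_one_comp, sysB_one_comp,
      flow_zero_comp, drive_zero_comp, drive_one_comp]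
    have hi := hω i
    have hsc := Real.sin_sq_add_cos_sq (ω i * s)
    field_simp
    linear_combination (u s) * hsc

/-! ### Efficiency of the sign feedback -/

theorem IsSignFeedback.exists_normalized {ω : Fin N → ℝ} (hω : ∀ i, ω i ≠ 0) {U v : ℝ}
    {x : State N} (hx : x ≠ 0) (h : IsSignFeedback ω U x v) :
    ∃ p, supportFn ω p = 1 ∧ x ⬝ᵥ p = rho ω x ∧ (0 < sysB N ⬝ᵥ p → v = -U) ∧
      (sysB N ⬝ᵥ p < 0 → v = U) := by
  obtain ⟨p, hp, -, h1, h2⟩ := h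
  obtain ⟨hp0, hp1⟩ := (isMomentum_iff hω hx p).mp hp
  have hH := supportFn_pos hω hp0
  have hinv : 0 < (supportFn ω p)⁻¹ := inv_pos.mpr hH
  refine ⟨(supportFn ω p)⁻¹ • p, ?_, ?_, fun h => h1 ?_, fun h => h2 ?_⟩
  · rw [supportFn_smul, abs_of_pos hinv, inv_mul_cancel₀ hH.ne']
  · rw [dotProduct_smul, hp1, smul_eq_mul]
    field_simp
  · rw [dotProduct_smul, smul_eq_mul] at h
    exact pos_of_mul_pos_right h hinv.le
  · rw [dotProduct_smul, smul_eq_mul] at h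
    by_contra hcon
    have := mul_nonneg hinv.le (not_lt.mp hcon)
    linarith

theorem IsTrajectory.flow_neg_sub_eq {ω : Fin N → ℝ} (hω : ∀ i, ω i ≠ 0) {x : State N}
    {y : ℝ → State N} {u : ℝ → ℝ} (h : IsTrajectory ω x y u) {a b : ℝ} (ha : 0 ≤ a)
    (hab : a ≤ b) :
    flow ω (-b) (y b) - flow ω (-a) (y a) = ∫ s in a..b, u s • drive ω s := by
  rw [h.flow_neg_eq hω ha, h.flow_neg_eq hω (ha.trans hab), add_sub_add_left_eq_sub,
    intervalIntegral.integral_interval_sub_left]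
  · exact intervalIntegrable_smul_drive ω (h.intervalIntegrable b (ha.trans hab))
  · exact intervalIntegrable_smul_drive ω (h.intervalIntegrable a ha)

theorem IsTrajectory.intervalIntegrable_control {ω : Fin N → ℝ} {x : State N}
    {y : ℝ → State N} {u : ℝ → ℝ} (h : IsTrajectory ω x y u) {a b : ℝ} (ha : 0 ≤ a)
    (hb : 0 ≤ b) : IntervalIntegrable u volume a b :=
  (h.intervalIntegrable a ha).symm.trans (h.intervalIntegrable b hb)

theorem IsTrajectory.exists_norm_flow_neg_sub_le {ω : Fin N → ℝ} (hω : ∀ i, ω i ≠ 0) :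
    ∃ M : ℝ, 0 < M ∧ ∀ (x : State N) (y : ℝ → State N) (u : ℝ → ℝ) (U : ℝ),
      IsTrajectory ω x y u → ∀ a b, 0 ≤ a → a ≤ b →
      (∀ᵐ t, t ∈ Set.Ioc a b → |u t| ≤ U) →
      ‖flow ω (-b) (y b) - flow ω (-a) (y a)‖ ≤ M * U * (b - a) := by
  obtain ⟨M, hM, h⟩ := exists_norm_drive_le ω
  refine ⟨M, hM, fun x y u U htr a b ha hab hu => ?_⟩
  rw [htr.flow_neg_sub_eq hω ha hab]
  have := intervalIntegral.norm_integral_le_of_norm_le_const_ae (a := a) (b := b) (C := M * U)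
    (f := fun s => u s • drive ω s) (by
      filter_upwards [hu] with t ht hmem
      rw [Set.uIoc_of_le hab] at hmem
      rw [norm_smul, mul_comm, Real.norm_eq_abs]
      exact mul_le_mul (h t) (ht hmem) (abs_nonneg _) hM.le)
  rwa [abs_of_nonneg (by linarith)] at this

theorem IsTrajectory.dotProduct_flow_neg_sub_eq {ω : Fin N → ℝ} (hω : ∀ i, ω i ≠ 0) {x : State N}
    {y : ℝ → State N} {u : ℝ → ℝ} (h : IsTrajectory ω x y u) {a b : ℝ} (ha : 0 ≤ a)
    (hab : a ≤ b) (p : State N) :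
    p ⬝ᵥ (flow ω (-b) (y b) - flow ω (-a) (y a)) = ∫ s in a..b, u s * (p ⬝ᵥ drive ω s) := by
  rw [h.flow_neg_sub_eq hω ha hab]
  have hint := intervalIntegrable_smul_drive ω (h.intervalIntegrable_control ha (ha.trans hab))
  have := (dotForm p).intervalIntegral_comp_comm hint
  simp only [dotForm_apply] at this
  rw [dotProduct_comm, ← this]
  refine intervalIntegral.integral_congr fun s _ => ?_
  simp only [smul_dotProduct, smul_eq_mul, dotProduct_comm p]

/-- The feedback follows the sign of β, the true switching function, while the estimate concerns β',
the one of the frozen momentum. Where the signs agree nothing is lost; elsewhere |β'| ≤ ε and the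
loss is at most 2Uε. -/
theorem mul_le_of_sign_feedback {U v β β' ε : ℝ} (hU : 0 < U) (hv : |v| ≤ U)
    (h1 : 0 < β → v = -U) (h2 : β < 0 → v = U) (hβ : |β' - β| ≤ ε) :
    v * β' ≤ U * (2 * ε) - U * |β'| := by
  have hε := abs_le.mp hβ
  have hv' := abs_le.mp hv
  rcases lt_trichotomy β 0 with hb | hb | hb
  · rw [h2 hb]
    rcases abs_cases β' with hc | hc
    · rw [hc.1]; nlinarith
    · rw [hc.1]; nlinarith [abs_nonneg (β' - β)]
  · have h3 : |β'| ≤ ε := by rw [hb, sub_zero] at hβ; exact hβ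
    have h4 : v * β' ≤ |v| * |β'| := by rw [← abs_mul]; exact le_abs_self _
    nlinarith [abs_nonneg v, abs_nonneg β']
  · rw [h1 hb]
    rcases abs_cases β' with hc | hc
    · rw [hc.1]; nlinarith [abs_nonneg (β' - β)]
    · rw [hc.1]; nlinarith

/-- Over sufficiently long time intervals the sign feedback decreases the polar radius at almost
the maximal rate, outside of the inefficiency domain. -/
theorem exists_window_decrease {ω : Fin N → ℝ} (hN : 0 < N) (hω : ∀ i, ω i ≠ 0)
    (hres : ∀ m : Fin N → ℤ, ∑ i, (m i : ℝ) * ω i = 0 → m = 0) {ε : ℝ} (hε : 0 < ε) :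
    ∃ L C : ℝ, 0 < L ∧ 0 < C ∧ ∀ (x : State N) (y : ℝ → State N) (u : ℝ → ℝ) (U : ℝ), 0 < U →
      IsTrajectory ω x y u → ∀ a, 0 ≤ a →
      (∀ᵐ t, t ∈ Set.Ioc a (a + L) → IsSignFeedback ω U (y t) (u t)) →
      (∀ t ∈ Set.Icc a (a + L), U * C ≤ rho ω (y t)) →
      rho ω (y (a + L)) ≤ rho ω (y a) - (1 - ε) * U * L := by
  obtain ⟨L, hL, hmean⟩ := exists_mean_drive_uniform hω hres (show 0 < ε / 2 by positivity)
  obtain ⟨M, hM, hdot⟩ := exists_abs_dotProduct_torusPhase_le ω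
  obtain ⟨M', hM', hz⟩ := IsTrajectory.exists_norm_flow_neg_sub_le hω
  obtain ⟨δ, hδ, hmom⟩ := momentum_uniformContinuous hN hω (show 0 < ε / (4 * M) by positivity)
  -- With ρ ≥ UC for this C, the displacement M'UL of the moving-frame state over one window is at
  -- most δρ, within reach of the momentum estimate.
  refine ⟨L, M' * L / δ, hL, by positivity, fun x y u U hU htr a ha hsign hrho => ?_⟩
  have hab : a ≤ a + L := by linarith
  set z : ℝ → State N := fun t => flow ω (-t) (y t) with hzdef
  have hrz : ∀ t, rho ω (z t) = rho ω (y t) := fun t => rho_flow hN hω _ _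
  -- The momentum is frozen at the end of the window: there the pairing with q equals ρ, while at
  -- the beginning it is at most ρ, so the drop of the pairing bounds the drop of ρ from below.
  obtain ⟨q, hq, hqz⟩ := exists_dotProduct_eq_rho hN hω (z (a + L))
  have hpos : ∀ t ∈ Set.Icc a (a + L), 0 < rho ω (y t) := fun t ht =>
    lt_of_lt_of_le (by positivity) (hrho t ht)
  have hbound : ∀ᵐ t, t ∈ Set.Ioc a (a + L) → |u t| ≤ U := by
    filter_upwards [hsign] with t ht hmem
    obtain ⟨p, -, h, -⟩ := ht hmem
    exact h
  have hkey : ∀ᵐ t, t ∈ Set.Ioc a (a + L) →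
      u t * (q ⬝ᵥ drive ω t) ≤ U * (2 * (ε / 4)) - U * |q ⬝ᵥ drive ω t| := by
    filter_upwards [hsign, hbound] with t ht hut hmem
    have hmem' := Set.Ioc_subset_Icc_self hmem
    have hy0 : y t ≠ 0 := by
      intro h0
      have := hpos t hmem'
      rw [h0, rho_zero] at this
      exact lt_irrefl _ this
    obtain ⟨p, hp, hpy, h1, h2⟩ := (ht hmem).exists_normalized hω hy0
    have hβ : drive ω t ⬝ᵥ coflow ω t p = sysB N ⬝ᵥ p := drive_dotProduct_coflow hω t p
    rw [← hβ] at h1 h2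
    refine mul_le_of_sign_feedback hU (hut hmem) h1 h2 ?_
    -- In the moving frame the momentum at time t is p carried along by the adjoint flow.
    have hclose : ‖coflow ω t p - q‖ < ε / (4 * M) := by
      refine hmom (z t) (z (a + L)) _ q (by rw [supportFn_coflow hω, hp]) hq ?_ hqz ?_ ?_
      · rw [hzdef]
        simp only
        rw [flow_neg_dotProduct_coflow hω, hpy, rho_flow hN hω]
      · rw [hrz]; exact hpos _ ⟨hab, le_rfl⟩
      · rw [norm_sub_rev, hrz]
        have h3 := hz x y u U htr t (a + L) (ha.trans hmem'.1) hmem'.2 (by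
          filter_upwards [hbound] with s hs hs'
          exact hs ⟨hmem.1.trans hs'.1, hs'.2⟩)
        have h4 := hrho (a + L) ⟨hab, le_rfl⟩
        calc ‖z (a + L) - z t‖ ≤ M' * U * (a + L - t) := h3
          _ ≤ M' * U * L := by gcongr; linarith [hmem.1]
          _ = δ * (U * (M' * L / δ)) := by field_simp
          _ ≤ δ * rho ω (y (a + L)) := by gcongr
    rw [dotProduct_comm (drive ω t), ← sub_dotProduct, drive_eq_torusPhase]
    refine (hdot _ _).trans ?_
    rw [norm_sub_rev] at hclose
    calc M * ‖q - coflow ω t p‖ ≤ M * (ε / (4 * M)) := by gcongr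
      _ = ε / 4 := by field_simp
  have hint1 : IntervalIntegrable (fun s => u s * (q ⬝ᵥ drive ω s)) volume a (a + L) :=
    (htr.intervalIntegrable_control ha (ha.trans hab)).mul_continuousOn
      (continuous_dotProduct_drive ω q).continuousOn
  have hint2 : IntervalIntegrable (fun s => |q ⬝ᵥ drive ω s|) volume a (a + L) :=
    (continuous_dotProduct_drive ω q).abs.intervalIntegrable _ _
  have hI : ∫ s in a..(a + L), u s * (q ⬝ᵥ drive ω s) ≤
      ∫ s in a..(a + L), (U * (2 * (ε / 4)) - U * |q ⬝ᵥ drive ω s|) := by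
    refine intervalIntegral.integral_mono_ae_restrict hab hint1
      (intervalIntegrable_const.sub (hint2.const_mul U)) ?_
    rw [Filter.EventuallyLE, ← restrict_Ioc_eq_restrict_Icc, ae_restrict_iff' measurableSet_Ioc]
    exact hkey
  rw [intervalIntegral.integral_sub intervalIntegrable_const (hint2.const_mul U),
    intervalIntegral.integral_const, smul_eq_mul, intervalIntegral.integral_const_mul,
    ← htr.dotProduct_flow_neg_sub_eq hω ha hab q, dotProduct_sub] at hI
  have h5 := (abs_le.mp (hmean L le_rfl a q hq)).1
  have h6 := dotProduct_le_rho_mul hω (z a) q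
  rw [hq, mul_one, hrz, dotProduct_comm] at h6
  have h7 : q ⬝ᵥ z (a + L) = rho ω (y (a + L)) := by rw [dotProduct_comm, hqz, hrz]
  have h8 : q ⬝ᵥ flow ω (-(a + L)) (y (a + L)) = q ⬝ᵥ z (a + L) := rfl
  have h9 : q ⬝ᵥ flow ω (-a) (y a) = q ⬝ᵥ z a := rfl
  rw [h8, h9, h7] at hI
  have h10 := mul_le_mul_of_nonneg_left h5 hU.le
  linarith

/-- The time which the sign feedback spends outside of the inefficiency domain. -/
theorem exists_decay {ω : Fin N → ℝ} (hN : 0 < N) (hω : ∀ i, ω i ≠ 0)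
    (hres : ∀ m : Fin N → ℤ, ∑ i, (m i : ℝ) * ω i = 0 → m = 0) {ε : ℝ} (hε : 0 < ε) :
    ∃ C K : ℝ, 0 < C ∧ 0 < K ∧ ∀ (x : State N) (y : ℝ → State N) (u : ℝ → ℝ) (U : ℝ), 0 < U →
      IsTrajectory ω x y u → ∀ a b, 0 ≤ a → a ≤ b →
      (∀ᵐ t, t ∈ Set.Ioc a b → IsSignFeedback ω U (y t) (u t)) →
      (∀ t ∈ Set.Icc a b, U * C ≤ rho ω (y t)) →
      (1 - ε) * U * (b - a) ≤ rho ω (y a) - rho ω (y b) + U * K := by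
  obtain ⟨L, C, hL, hC, hwin⟩ := exists_window_decrease hN hω hres hε
  obtain ⟨M', hM', hz⟩ := IsTrajectory.exists_norm_flow_neg_sub_le hω
  obtain ⟨M₁, hM₁, hrho⟩ := abs_rho_sub_le hN hω
  -- Both terms pay for the incomplete last window: its duration is below L, and ρ can grow there by
  -- at most M₁M'LU.
  refine ⟨C, L + M₁ * M' * L, hC, by positivity,
    fun x y u U hU htr a b ha hab hsign hlow => ?_⟩
  have hstep : ∀ n : ℕ, a + n * L ≤ b →
      rho ω (y (a + n * L)) ≤ rho ω (y a) - (1 - ε) * U * (n * L) := by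
    intro n
    induction n with
    | zero => intro _; simp
    | succ n ih =>
      intro hn
      push_cast at hn ⊢
      have e : a + (n + 1) * L = a + n * L + L := by ring
      have hnL : 0 ≤ n * L := by positivity
      rw [e] at hn ⊢
      have h1 := ih (by linarith)
      have h2 := hwin x y u U hU htr (a + n * L) (by linarith) (by
        filter_upwards [hsign] with t ht hmem
        exact ht ⟨by linarith [hmem.1], hmem.2.trans hn⟩)
        (fun t ht => hlow t ⟨by linarith [ht.1], ht.2.trans hn⟩)
      calc _ ≤ _ := h2
        _ ≤ _ := by linarith
  set n := ⌊(b - a) / L⌋₊ with hn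
  have hn1 : n * L ≤ b - a := by
    have := Nat.floor_le (show 0 ≤ (b - a) / L from div_nonneg (by linarith) hL.le)
    rwa [le_div_iff₀ hL] at this
  have hn2 : b - a < (n + 1) * L := by
    have := Nat.lt_floor_add_one ((b - a) / L)
    rwa [div_lt_iff₀ hL] at this
  set c := a + n * L with hc
  have hac : a ≤ c := by
    have : 0 ≤ n * L := by positivity
    linarith
  have hcb : c ≤ b := by linarith
  have h1 := hstep n hcb
  have h2 := hz x y u U htr c b (ha.trans hac) hcb (by
    filter_upwards [hsign] with t ht hmem
    obtain ⟨p, -, h, -⟩ := ht ⟨lt_of_le_of_lt hac hmem.1, hmem.2⟩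
    exact h)
  have h3 := hrho (flow ω (-b) (y b)) (flow ω (-c) (y c))
  rw [rho_flow hN hω, rho_flow hN hω] at h3
  have h4 : M₁ * ‖flow ω (-b) (y b) - flow ω (-c) (y c)‖ ≤ M₁ * M' * L * U := by
    calc _ ≤ M₁ * (M' * U * (b - c)) := by gcongr
      _ ≤ M₁ * (M' * U * L) := by gcongr; linarith
      _ = _ := by ring
  have h5 := (abs_le.mp (h3.trans h4)).2
  have h6 : (1 - ε) * U * (b - a) ≤ (1 - ε) * U * (n * L) + U * L := by
    have h7 : 0 ≤ b - a - n * L := by linarith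
    have h8 : b - a - n * L ≤ L := by linarith
    nlinarith [mul_nonneg hU.le h7, mul_nonneg (mul_nonneg hε.le hU.le) h7,
      mul_le_mul_of_nonneg_left h8 hU.le]
  change rho ω (y c) ≤ _ at h1
  nlinarith

/-- Any admissible control needs at least about the time `ρ(x)` to damp the system. -/
theorem exists_rho_le_time {ω : Fin N → ℝ} (hN : 0 < N) (hω : ∀ i, ω i ≠ 0)
    (hres : ∀ m : Fin N → ℤ, ∑ i, (m i : ℝ) * ω i = 0 → m = 0) {ε : ℝ} (hε : 0 < ε) :
    ∃ K : ℝ, 0 < K ∧ ∀ (x : State N) (y : ℝ → State N) (u : ℝ → ℝ), IsTrajectory ω x y u →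
      IsAdmissible u → ∀ T, 0 ≤ T → y T = 0 → rho ω x ≤ (1 + ε) * T + K := by
  obtain ⟨L, hL, hmean⟩ := exists_mean_drive_uniform hω hres hε
  refine ⟨(1 + ε) * L, by positivity, fun x y u htr hu T hT hyT => ?_⟩
  obtain ⟨q, hq, hqx⟩ := exists_dotProduct_eq_rho hN hω x
  have h1 := htr.dotProduct_flow_neg_sub_eq hω le_rfl hT q
  rw [hyT, flow_apply_zero, neg_zero, flow_zero, htr.apply_zero_eq, zero_sub, dotProduct_neg,
    dotProduct_comm, hqx] at h1
  have hint : ∀ b, IntervalIntegrable (fun s => |q ⬝ᵥ drive ω s|) volume 0 b := fun b =>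
    (continuous_dotProduct_drive ω q).abs.intervalIntegrable _ _
  have h2 : rho ω x ≤ ∫ s in (0 : ℝ)..T, |q ⬝ᵥ drive ω s| := by
    have h3 : rho ω x = ∫ s in (0 : ℝ)..T, -(u s * (q ⬝ᵥ drive ω s)) := by
      rw [intervalIntegral.integral_neg, ← h1, neg_neg]
    rw [h3]
    refine intervalIntegral.integral_mono_ae_restrict hT
      ((htr.intervalIntegrable T hT).mul_continuousOn
        (continuous_dotProduct_drive ω q).continuousOn).neg (hint T) ?_
    filter_upwards [ae_restrict_of_ae_restrict_of_subset
      (fun _ hs => hs.1 : Set.Icc (0 : ℝ) T ⊆ Set.Ici 0) hu] with s hs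
    calc -(u s * (q ⬝ᵥ drive ω s)) ≤ |u s * (q ⬝ᵥ drive ω s)| := neg_le_abs _
      _ = |u s| * |q ⬝ᵥ drive ω s| := abs_mul _ _
      _ ≤ 1 * |q ⬝ᵥ drive ω s| := by gcongr
      _ = _ := one_mul _
  -- The interval is prolonged by L so that the uniform mean estimate applies even to small T.
  have h3 : ∫ s in (0 : ℝ)..T, |q ⬝ᵥ drive ω s| ≤ ∫ s in (0 : ℝ)..(0 + (T + L)),
      |q ⬝ᵥ drive ω s| :=
    intervalIntegral.integral_mono_interval le_rfl hT (by linarith)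
      (Eventually.of_forall fun _ => abs_nonneg _) (hint _)
  have h4 := (abs_le.mp (hmean (T + L) (by linarith) 0 q hq)).2
  linarith

/-! ### Existence of motions under discontinuous feedbacks -/

theorem intervalIntegrable_of_bounded {u : ℝ → ℝ} {U : ℝ} (hm : Measurable u)
    (hb : ∀ t, |u t| ≤ U) (a b : ℝ) : IntervalIntegrable u volume a b :=
  (intervalIntegrable_const (c := U)).mono_fun hm.aestronglyMeasurable
    (Eventually.of_forall fun t => (hb t).trans (le_abs_self U))

/-- The states, in the coordinates moving with the free flow, of the motion under the feedback `f`
sampled with the step `h`. -/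
noncomputable def sampledState (ω : Fin N → ℝ) (f : State N → ℝ) (h : ℝ) (x : State N) :
    ℕ → State N
  | 0 => x
  | k + 1 => sampledState ω f h x k + f (flow ω (k * h) (sampledState ω f h x k)) •
      ∫ s in (k * h)..((k + 1) * h), drive ω s

/-- Sample-and-hold: the control is constant between multiples of h and equals the feedback at the
state of its own motion at the last sampling time. No regularity of f is needed. -/
theorem exists_sampled_control (ω : Fin N → ℝ) {f : State N → ℝ} {U : ℝ} (hf : ∀ x, |f x| ≤ U)
    {h : ℝ} (hh : 0 < h) (x : State N) :
    ∃ u : ℝ → ℝ, Measurable u ∧ (∀ t, |u t| ≤ U) ∧ ∀ t, 0 ≤ t → ∃ τ, 0 ≤ τ ∧ τ ≤ t ∧ t < τ + h ∧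
      u t = f (flow ω τ (x + ∫ s in (0 : ℝ)..τ, u s • drive ω s)) := by
  set c : ℕ → ℝ := fun k => f (flow ω (k * h) (sampledState ω f h x k)) with hc
  set u : ℝ → ℝ := fun t => c ⌊t / h⌋₊ with hu
  have hm : Measurable u :=
    (measurable_from_nat (f := c)).comp (Nat.measurable_floor.comp (measurable_id.div_const h))
  have hb : ∀ t, |u t| ≤ U := fun t => hf _
  have hint : ∀ a b, IntervalIntegrable (fun s => u s • drive ω s) volume a b := fun a b =>
    intervalIntegrable_smul_drive ω (intervalIntegrable_of_bounded hm hb a b)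
  have hfloor : ∀ (k : ℕ) (s : ℝ), k * h ≤ s → s < (k + 1) * h → u s = c k := by
    intro k s h1 h2
    have : ⌊s / h⌋₊ = k := by
      have hs : 0 ≤ s := le_trans (by positivity) h1
      rw [Nat.floor_eq_iff (by positivity)]
      exact ⟨by rwa [le_div_iff₀ hh], by rwa [div_lt_iff₀ hh]⟩
    simp only [hu, this]
  have hstate : ∀ k : ℕ, x + ∫ s in (0 : ℝ)..(k * h), u s • drive ω s =
      sampledState ω f h x k := by
    intro k
    induction k with
    | zero => simp [sampledState]
    | succ k ih =>
      have hle : (k : ℝ) * h ≤ (k + 1) * h := by nlinarith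
      rw [sampledState, ← ih, add_assoc]
      congr 1
      have h1 : f (flow ω (k * h) (x + ∫ s in (0 : ℝ)..(k * h), u s • drive ω s)) = c k := by
        rw [ih]
      rw [h1]
      push_cast
      rw [← intervalIntegral.integral_add_adjacent_intervals (hint 0 (k * h)) (hint _ _)]
      congr 1
      rw [← intervalIntegral.integral_smul]
      refine intervalIntegral.integral_congr_ae ?_
      filter_upwards [(Set.countable_singleton (((k : ℝ) + 1) * h)).ae_notMem volume]
        with s hs hmem
      rw [Set.uIoc_of_le hle] at hmem
      rw [hfloor k s hmem.1.le (lt_of_le_of_ne hmem.2 hs)]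
  refine ⟨u, hm, hb, fun t ht => ⟨⌊t / h⌋₊ * h, by positivity, ?_, ?_, ?_⟩⟩
  · have := Nat.floor_le (show 0 ≤ t / h by positivity)
    rwa [le_div_iff₀ hh] at this
  · have := Nat.lt_floor_add_one (t / h)
    rw [div_lt_iff₀ hh] at this
    linarith
  · rw [hstate]

/-- One ultrafilter yields limits at all times at once, in place of extracting subsequences. -/
theorem exists_ultrafilter_limit {E : Type*} [NormedAddCommGroup E] [ProperSpace E]
    {s : ℕ → E} {M : ℝ} (h : ∀ n, ‖s n‖ ≤ M) (𝒰 : Ultrafilter ℕ) :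
    ∃ l, Tendsto s 𝒰 (𝓝 l) := by
  obtain ⟨l, -, hl⟩ := (isCompact_closedBall (0 : E) M).ultrafilter_le_nhds (𝒰.map s) (by
    rw [le_principal_iff, Ultrafilter.mem_coe, Ultrafilter.mem_map]
    exact Filter.mem_of_superset Filter.univ_mem fun n _ => mem_closedBall_zero_iff.mpr (h n))
  exact ⟨l, hl⟩

theorem exists_norm_drive_sub_le (ω : Fin N → ℝ) :
    ∃ D : ℝ, 0 < D ∧ ∀ s t, ‖drive ω s - drive ω t‖ ≤ D * |s - t| := by
  refine ⟨1 + ‖ω‖, by positivity, fun s t => ?_⟩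
  have key : ∀ i, |ω i * s - ω i * t| = |ω i| * |s - t| := fun i => by
    rw [← mul_sub, abs_mul]
  rw [pi_norm_le_iff_of_nonneg (by positivity)]
  rintro ⟨i, k⟩
  have hi : |ω i| ≤ ‖ω‖ := norm_le_pi_norm ω i
  rw [Pi.sub_apply, Real.norm_eq_abs]
  fin_cases k
  · change |drive ω s (i, 0) - drive ω t (i, 0)| ≤ _
    rw [drive_zero_comp, drive_zero_comp]
    have e : -((ω i)⁻¹ * Real.sin (ω i * s)) - -((ω i)⁻¹ * Real.sin (ω i * t)) =
        -((ω i)⁻¹ * (Real.sin (ω i * s) - Real.sin (ω i * t))) := by ring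
    rw [e, abs_neg, abs_mul, abs_inv]
    calc |ω i|⁻¹ * |Real.sin (ω i * s) - Real.sin (ω i * t)|
        ≤ |ω i|⁻¹ * (|ω i| * |s - t|) := by
          gcongr; rw [← key]; exact Real.abs_sin_sub_sin_le _ _
      _ = (|ω i|⁻¹ * |ω i|) * |s - t| := by ring
      _ ≤ 1 * |s - t| := by gcongr; exact inv_mul_le_one
      _ ≤ _ := by gcongr; linarith [norm_nonneg ω]
  · change |drive ω s (i, 1) - drive ω t (i, 1)| ≤ _
    rw [drive_one_comp, drive_one_comp]
    calc |Real.cos (ω i * s) - Real.cos (ω i * t)| ≤ |ω i| * |s - t| := by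
          rw [← key]; exact Real.abs_cos_sub_cos_le _ _
      _ ≤ _ := by gcongr; linarith

/-- The quadratic bound survives pointwise limits, unlike the controls themselves. It lets the
relation ż = v̇ e^{-At}B be recovered after the limit from the integrated control v. -/
theorem hasDerivAt_of_quadratic_bound {E : Type*} [NormedAddCommGroup E] [NormedSpace ℝ E]
    {z : ℝ → E} {v : ℝ → ℝ} {d : E} {s K v' : ℝ}
    (h : ∀ t, ‖z t - z s - (v t - v s) • d‖ ≤ K * (t - s) ^ 2) (hv : HasDerivAt v v' s) :
    HasDerivAt z (v' • d) s := by
  have h1 : HasFDerivAt (fun t => z t - z s - (v t - v s) • d) (0 : ℝ →L[ℝ] E) s := by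
    refine Asymptotics.IsBigO.hasFDerivAt (n := 2) ?_ one_lt_two
    refine Asymptotics.IsBigO.of_bound K (Eventually.of_forall fun t => ?_)
    simpa using h t
  have h2 : HasDerivAt (fun t => z t - z s - (v t - v s) • d) 0 s := by
    simpa using h1.hasDerivAt
  have h3 : HasDerivAt (fun t => (v t - v s) • d + z s) (v' • d) s :=
    ((hv.sub_const (v s)).smul_const d).add_const (z s)
  have h4 := h2.add h3
  rw [zero_add] at h4
  refine h4.congr_of_eventuallyEq (Eventually.of_forall fun t => ?_)
  simp only [Pi.add_apply]
  abel

/-- For every bounded feedback there is a motion which follows it wherever the feedback is locally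
constant. -/
theorem exists_motion_of_feedback {ω : Fin N → ℝ} (hω : ∀ i, ω i ≠ 0) {f : State N → ℝ} {U : ℝ}
    (hf : ∀ x, |f x| ≤ U) (x : State N) :
    ∃ (y : ℝ → State N) (u : ℝ → ℝ), IsTrajectory ω x y u ∧ (∀ t, |u t| ≤ U) ∧
      ∀ᵐ t, 0 ≤ t → ∀ c, (∀ᶠ x' in 𝓝 (y t), f x' = c) → u t = c := by
  have hU : 0 ≤ U := (abs_nonneg _).trans (hf 0)
  obtain ⟨M, hM, hdrive⟩ := exists_norm_drive_le ω
  obtain ⟨D, hD, hlip⟩ := exists_norm_drive_sub_le ω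
  choose w hwm hwb hw using fun n : ℕ =>
    exists_sampled_control ω hf (show (0 : ℝ) < 1 / (n + 1) by positivity) x
  have hwi : ∀ n a b, IntervalIntegrable (w n) volume a b := fun n =>
    intervalIntegrable_of_bounded (hwm n) (hwb n)
  have hwd : ∀ n a b, IntervalIntegrable (fun s => w n s • drive ω s) volume a b := fun n a b =>
    intervalIntegrable_smul_drive ω (hwi n a b)
  set vn : ℕ → ℝ → ℝ := fun n t => ∫ s in (0 : ℝ)..t, w n s with hvn
  set zn : ℕ → ℝ → State N := fun n t => x + ∫ s in (0 : ℝ)..t, w n s • drive ω s with hzn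
  have hvsub : ∀ n s t, vn n t - vn n s = ∫ r in s..t, w n r := fun n s t =>
    intervalIntegral.integral_interval_sub_left (hwi n _ _) (hwi n _ _)
  have hzsub : ∀ n s t, zn n t - zn n s = ∫ r in s..t, w n r • drive ω r := by
    intro n s t
    simp only [hzn, add_sub_add_left_eq_sub]
    exact intervalIntegral.integral_interval_sub_left (hwd n _ _) (hwd n _ _)
  have hvlip : ∀ n s t, |vn n t - vn n s| ≤ U * |t - s| := by
    intro n s t
    rw [hvsub, ← Real.norm_eq_abs]
    exact intervalIntegral.norm_integral_le_of_norm_le_const fun r _ => hwb n r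
  have hzlip : ∀ n s t, ‖zn n t - zn n s‖ ≤ U * M * |t - s| := by
    intro n s t
    rw [hzsub]
    refine intervalIntegral.norm_integral_le_of_norm_le_const fun r _ => ?_
    rw [norm_smul]
    exact mul_le_mul (hwb n r) (hdrive r) (norm_nonneg _) hU
  -- Over a short interval the increment of the state is the increment of the integrated control
  -- times the forcing vector, up to the Lipschitz variation of that vector.
  have hquad : ∀ n s t, ‖zn n t - zn n s - (vn n t - vn n s) • drive ω s‖ ≤
      U * D * (t - s) ^ 2 := by
    intro n s t
    have e : zn n t - zn n s - (vn n t - vn n s) • drive ω s =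
        ∫ r in s..t, w n r • (drive ω r - drive ω s) := by
      have h1 : IntervalIntegrable (fun r => w n r • drive ω s) volume s t :=
        intervalIntegrable_state fun c => (hwi n s t).mul_const _
      simp_rw [smul_sub]
      rw [intervalIntegral.integral_sub (hwd n s t) h1, hzsub, hvsub,
        intervalIntegral.integral_smul_const]
    rw [e]
    have h1 : ∀ r ∈ Set.uIoc s t, ‖w n r • (drive ω r - drive ω s)‖ ≤ U * D * |t - s| := by
      intro r hr
      rw [norm_smul, mul_assoc]
      refine mul_le_mul (hwb n r) ((hlip r s).trans ?_) (norm_nonneg _) hU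
      have : |r - s| ≤ |t - s| := Set.abs_sub_left_of_mem_uIcc (Set.uIoc_subset_uIcc hr)
      gcongr
    have h2 := intervalIntegral.norm_integral_le_of_norm_le_const h1
    calc _ ≤ _ := h2
      _ = U * D * |t - s| ^ 2 := by ring
      _ = _ := by rw [sq_abs]
  set 𝒰 := hyperfilter ℕ with h𝒰
  have hv0 : ∀ n, vn n 0 = 0 := fun n => by simp [hvn]
  have hz0 : ∀ n, zn n 0 = x := fun n => by simp [hzn]
  choose v hv using fun t => exists_ultrafilter_limit (s := fun n => vn n t) (M := U * |t|)
    (fun n => by simpa [hv0] using hvlip n 0 t) 𝒰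
  choose z hz using fun t => exists_ultrafilter_limit (s := fun n => zn n t)
    (M := ‖x‖ + U * M * |t|) (fun n => by
      have h1 := hzlip n 0 t
      rw [hz0, sub_zero] at h1
      calc ‖zn n t‖ = ‖x + (zn n t - x)‖ := by congr 1; abel
        _ ≤ ‖x‖ + ‖zn n t - x‖ := norm_add_le _ _
        _ ≤ _ := by gcongr) 𝒰
  have hvl : LipschitzWith ⟨U, hU⟩ v := LipschitzWith.of_dist_le_mul fun t s => by
    rw [Real.dist_eq, Real.dist_eq]
    exact le_of_tendsto (((hv t).sub (hv s)).abs) (Eventually.of_forall fun n => hvlip n s t)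
  have hzl : LipschitzWith ⟨U * M, by positivity⟩ z := LipschitzWith.of_dist_le_mul fun t s => by
    rw [dist_eq_norm, Real.dist_eq]
    exact le_of_tendsto (((hz t).sub (hz s)).norm) (Eventually.of_forall fun n => hzlip n s t)
  have hq : ∀ s t, ‖z t - z s - (v t - v s) • drive ω s‖ ≤ U * D * (t - s) ^ 2 := fun s t =>
    le_of_tendsto ((((hz t).sub (hz s)).sub (((hv t).sub (hv s)).smul_const _)).norm)
      (Eventually.of_forall fun n => hquad n s t)
  have hzx : z 0 = x := by
    refine tendsto_nhds_unique (hz 0) ?_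
    simp_rw [hz0]
    exact tendsto_const_nhds
  -- The limit control is the derivative of the limit of the integrated controls, which are
  -- uniformly Lipschitz.
  set u : ℝ → ℝ := deriv v with hu
  have hub : ∀ t, |u t| ≤ U := fun t => norm_deriv_le_of_lipschitz hvl
  have hum : Measurable u := measurable_deriv v
  have hui := intervalIntegrable_of_bounded hum hub
  have hvd : ∀ᵐ t, HasDerivAt v (u t) t := by
    filter_upwards [hvl.ae_differentiableAt_real] with t ht
    exact ht.hasDerivAt
  have hzint : ∀ t, z t = x + ∫ s in (0 : ℝ)..t, u s • drive ω s := by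
    intro t
    funext a
    rw [Pi.add_apply, integral_apply (intervalIntegrable_smul_drive ω (hui 0 t)), ← hzx]
    have hal : LipschitzWith ⟨U * M, by positivity⟩ fun s => z s a :=
      LipschitzWith.of_dist_le_mul fun t s =>
        (dist_le_pi_dist (z t) (z s) a).trans (hzl.dist_le_mul t s)
    have h1 := ((hal.lipschitzOnWith (s := Set.uIcc 0 t)).absolutelyContinuousOnInterval
      ).integral_deriv_eq_sub
    have h2 : ∫ s in (0 : ℝ)..t, deriv (fun s => z s a) s =
        ∫ s in (0 : ℝ)..t, (u s • drive ω s) a := by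
      refine intervalIntegral.integral_congr_ae ?_
      filter_upwards [hvd] with s hs _
      exact (hasDerivAt_pi.mp (hasDerivAt_of_quadratic_bound (hq s) hs) a).deriv
    rw [h2] at h1
    rw [h1]
    ring
  have htraj := isTrajectory_of_flow hω (fun t _ => hui 0 t) hzl.continuous.continuousOn
    (fun t _ => hzint t)
  refine ⟨fun t => flow ω t (z t), u, htraj, hub, ?_⟩
  filter_upwards [hvd, (Set.countable_singleton (0 : ℝ)).ae_notMem volume] with t ht ht0 hpos c hc
  have htpos : 0 < t := lt_of_le_of_ne hpos (Ne.symm ht0)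
  have hc' : ∀ᶠ q in 𝓝 (t, z t), f (flow ω q.1 q.2) = c :=
    ((continuous_flow ω).tendsto (t, z t)).eventually hc
  obtain ⟨δ, hδ, hball⟩ := Metric.eventually_nhds_iff.mp hc'
  -- The bound t/2 keeps the times positive. The other two account for a sampling time within 2η of
  -- t, in time and, through the Lipschitz bound, in state.
  set η := min (t / 2) (min (δ / 4) (δ / (8 * (U * M + 1)))) with hη
  have hUM : 0 ≤ U * M := by positivity
  have hηpos : 0 < η := by positivity
  have hη1 : η ≤ t / 2 := min_le_left _ _
  have hη2 : η ≤ δ / 4 := (min_le_right _ _).trans (min_le_left _ _)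
  have hη3 : U * M * (2 * η) ≤ δ / 4 := by
    have h1 : η ≤ δ / (8 * (U * M + 1)) := (min_le_right _ _).trans (min_le_right _ _)
    rw [le_div_iff₀ (by positivity)] at h1
    nlinarith
  have hnear : ∀ᶠ n in (𝒰 : Filter ℕ), ‖zn n t - z t‖ < δ / 4 := by
    have := Metric.tendsto_nhds.mp (hz t) (δ / 4) (by positivity)
    simpa [dist_eq_norm] using this
  have hsmall : ∀ᶠ n : ℕ in (𝒰 : Filter ℕ), 1 / ((n : ℝ) + 1) < η :=
    Nat.hyperfilter_le_atTop ((tendsto_order.mp tendsto_one_div_add_atTop_nhds_zero_nat).2 _ hηpos)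
  -- Late in the sequence every sampled state used near t lies where the feedback equals c, so the
  -- integrated controls have slope c there, and so does their limit.
  have hconst : ∀ s, |s - t| < η → v s - v t = c * (s - t) := by
    intro s hs
    refine tendsto_nhds_unique ((hv s).sub (hv t)) ?_
    refine tendsto_const_nhds.congr' ?_
    filter_upwards [hnear, hsmall] with n hn1 hn2
    rw [hvsub]
    have : ∀ r ∈ Set.uIcc t s, w n r = c := by
      intro r hr
      have hrt : |r - t| < η := lt_of_le_of_lt (Set.abs_sub_left_of_mem_uIcc hr) hs
      have hrt' := abs_lt.mp hrt
      obtain ⟨τ, hτ0, hτ1, hτ2, hτ⟩ := hw n r (by linarith)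
      rw [hτ]
      have hτt : |τ - t| < 2 * η := by
        rw [abs_lt]
        constructor <;> linarith
      refine hball (y := (τ, zn n τ)) ?_
      rw [Prod.dist_eq, max_lt_iff, Real.dist_eq, dist_eq_norm]
      refine ⟨by linarith, ?_⟩
      calc ‖zn n τ - z t‖ = ‖(zn n τ - zn n t) + (zn n t - z t)‖ := by congr 1; abel
        _ ≤ ‖zn n τ - zn n t‖ + ‖zn n t - z t‖ := norm_add_le _ _
        _ ≤ U * M * |τ - t| + ‖zn n t - z t‖ := by gcongr; exact hzlip n t τ
        _ ≤ U * M * (2 * η) + ‖zn n t - z t‖ := by gcongr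
        _ < δ := by linarith
    rw [intervalIntegral.integral_congr this, intervalIntegral.integral_const, smul_eq_mul,
      mul_comm]
  have h1 : HasDerivAt (fun s => v t + c * (s - t)) c t := by
    simpa using (((hasDerivAt_id t).sub_const t).const_mul c).const_add (v t)
  have h2 : v =ᶠ[𝓝 t] fun s => v t + c * (s - t) := by
    filter_upwards [Metric.ball_mem_nhds t hηpos] with s hs
    rw [Metric.mem_ball, Real.dist_eq] at hs
    rw [← hconst s hs]
    ring
  exact ht.unique (h1.congr_of_eventuallyEq h2)

/-- The switching function of a normalized momentum is continuous away from 0, so the feedback is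
locally constant wherever this function is not 0. Where it vanishes, any value in [-U, U] is allowed
and nothing remains to check. -/
theorem exists_sign_motion {ω : Fin N → ℝ} (hN : 0 < N) (hω : ∀ i, ω i ≠ 0) {U : ℝ}
    (hU : 0 ≤ U) (x : State N) :
    ∃ (y : ℝ → State N) (u : ℝ → ℝ), IsTrajectory ω x y u ∧
      ∀ᵐ t, 0 ≤ t → y t ≠ 0 → IsSignFeedback ω U (y t) (u t) := by
  choose P hP1 hP2 using exists_dotProduct_eq_rho hN hω
  set β : State N → ℝ := fun x => sysB N ⬝ᵥ P x with hβ
  have hcont : ∀ x, x ≠ 0 → ContinuousAt β x := by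
    intro x hx
    rw [Metric.continuousAt_iff]
    intro ε hε
    obtain ⟨δ, hδ, h⟩ := momentum_uniformContinuous hN hω
      (show 0 < ε / (2 * N * ‖sysB N‖ + 1) by positivity)
    have hr := rho_pos hω hx
    refine ⟨δ * rho ω x, by positivity, fun {x'} hx' => ?_⟩
    rw [dist_eq_norm] at hx'
    have h1 := h x' x (P x') (P x) (hP1 _) (hP1 _) (hP2 _) (hP2 _) hr hx'.le
    rw [Real.dist_eq, hβ]
    simp only
    rw [← dotProduct_sub]
    rw [lt_div_iff₀ (by positivity)] at h1
    refine lt_of_le_of_lt (abs_dotProduct_le _ _) ?_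
    nlinarith [norm_nonneg (P x' - P x)]
  obtain ⟨y, u, htr, hub, hae⟩ := exists_motion_of_feedback hω
    (f := fun x => if 0 < β x then -U else if β x < 0 then U else 0) (U := U) (fun x => by
      split_ifs
      · rw [abs_neg, abs_of_nonneg hU]
      · rw [abs_of_nonneg hU]
      · simpa using hU) x
  refine ⟨y, u, htr, ?_⟩
  filter_upwards [hae] with t ht ht0 hy
  refine ⟨P (y t), (isMomentum_iff hω hy _).mpr ⟨?_, ?_⟩, hub t, fun hpos => ?_, fun hneg => ?_⟩
  · intro h0
    have := hP1 (y t)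
    rw [h0, supportFn_zero] at this
    exact zero_ne_one this
  · rw [hP1, hP2, mul_one]
  · refine ht ht0 (-U) ?_
    filter_upwards [(hcont _ hy).eventually (lt_mem_nhds hpos)] with x' hx'
    rw [if_pos hx']
  · refine ht ht0 U ?_
    filter_upwards [(hcont _ hy).eventually (gt_mem_nhds hneg)] with x' hx'
    rw [if_neg (not_lt.mpr hx'.le), if_pos hx']

/-! ### The matrices of the terminal control -/

theorem pos_eq_finProdFinEquiv (a : Fin N × Fin 2) : pos a = (finProdFinEquiv a : ℕ) + 1 := by
  simp only [pos, finProdFinEquiv_apply_val]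
  ring

theorem pos_injective : Function.Injective (pos (N := N)) := by
  intro a b h
  rw [pos_eq_finProdFinEquiv, pos_eq_finProdFinEquiv] at h
  exact finProdFinEquiv.injective (Fin.ext (by omega))

theorem one_le_pos (a : Fin N × Fin 2) : 1 ≤ pos a := by simp [pos]

theorem pos_le (a : Fin N × Fin 2) : pos a ≤ 2 * N := by
  rw [pos_eq_finProdFinEquiv]
  have := (finProdFinEquiv a).isLt
  omega

theorem exists_pos_eq {k : ℕ} (h1 : 1 ≤ k) (h2 : k ≤ 2 * N) : ∃ a : Fin N × Fin 2, pos a = k := by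
  refine ⟨finProdFinEquiv.symm ⟨k - 1, by omega⟩, ?_⟩
  rw [pos_eq_finProdFinEquiv, Equiv.apply_symm_apply]
  simp only
  omega

theorem sum_pos_eq : ∑ a : Fin N × Fin 2, (pos a : ℝ) = N * (2 * N + 1) := by
  rw [Fintype.sum_prod_type]
  simp only [pos, Fin.sum_univ_two]
  have : ∀ i : Fin N, (((2 * (i : ℕ) + ((0 : Fin 2) : ℕ) + 1 : ℕ) : ℝ) +
      ((2 * (i : ℕ) + ((1 : Fin 2) : ℕ) + 1 : ℕ) : ℝ)) = 4 * ((i : ℕ) : ℝ) + 3 := by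
    intro i
    push_cast
    simp
    ring
  simp_rw [this]
  rw [Fin.sum_univ_eq_sum_range (fun k => 4 * (k : ℝ) + 3), Finset.sum_add_distrib,
    ← Finset.mul_sum]
  have h2 : ∀ n : ℕ, (∑ k ∈ Finset.range n, (k : ℝ)) * 2 = n * (n - 1) := by
    intro n
    induction n with
    | zero => simp
    | succ n ih => rw [Finset.sum_range_succ, add_mul, ih]; push_cast; ring
  have h3 := h2 N
  simp only [Finset.sum_const, Finset.card_range, nsmul_eq_mul]
  linarith

/-- The matrix `𝔄` of the canonical system. -/
noncomputable def canonA (N : ℕ) : Mat N := fun a b =>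
  if pos a = pos b + 1 then -(pos b : ℝ) else 0

/-- The matrix `diag(1, …, 2N)`. -/
noncomputable def canonM (N : ℕ) : Mat N := diagonal fun a => (pos a : ℝ)

/-- The Hilbert matrix. -/
noncomputable def hilbertMat (N : ℕ) : Mat N := fun a b => ((pos a : ℝ) + pos b - 1)⁻¹

theorem sum_canonA_mul (a : Fin N × Fin 2) (g : ℕ → ℝ) :
    ∑ c, canonA N a c * g (pos c) = -((pos a : ℝ) - 1) * g (pos a - 1) := by
  by_cases h : pos a = 1
  · rw [h, Finset.sum_eq_zero]
    · simp
    · intro c _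
      have := one_le_pos c
      rw [canonA, if_neg (by omega), zero_mul]
  · have h1 := one_le_pos a
    obtain ⟨c, hc⟩ := exists_pos_eq (N := N) (k := pos a - 1) (by omega)
      (by have := pos_le a; omega)
    rw [Finset.sum_eq_single c]
    · rw [canonA, if_pos (by omega), hc, Nat.cast_sub h1]
      simp
    · intro d _ hd
      rw [canonA, if_neg, zero_mul]
      intro h2
      exact hd (pos_injective (by omega))
    · simp

theorem matq_symm (a b : Fin N × Fin 2) : matq N a b = matq N b a := by
  rw [matq, matq, add_comm]

/-- Entrywise with i, j the positions: the two terms with `canonA` add up to -1/(i + j - 1) and the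
two with `canonM` to +1/(i + j - 1). Only for i = j = 1, where the factors i - 1 and j - 1 vanish,
does 1 survive. This identity drives the whole terminal stage. -/
theorem riccati (N : ℕ) :
    canonA N * matq N + matq N * (canonA N)ᵀ + canonM N * matq N + matq N * canonM N =
      vecMulVec (canonB N) (canonB N) := by
  have key : ∀ a b : Fin N × Fin 2, (canonA N * matq N) a b =
      -((pos a : ℝ) - 1) * ((((pos a : ℝ) - 1) + pos b) * ((pos a : ℝ) - 1 + pos b - 1))⁻¹ := by
    intro a b
    rw [mul_apply]
    have := sum_canonA_mul a fun k => (((k : ℝ) + pos b) * ((k : ℝ) + pos b - 1))⁻¹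
    rw [Nat.cast_sub (one_le_pos a), Nat.cast_one] at this
    exact this
  have key2 : ∀ a b : Fin N × Fin 2, (matq N * (canonA N)ᵀ) a b = (canonA N * matq N) b a := by
    intro a b
    rw [mul_apply, mul_apply]
    refine Finset.sum_congr rfl fun c _ => ?_
    rw [transpose_apply, matq_symm a c, mul_comm]
  ext a b
  rw [Matrix.add_apply, Matrix.add_apply, Matrix.add_apply, key2, key, key, canonM, diagonal_mul,
    mul_diagonal,
    vecMulVec_apply, canonB, canonB, matq]
  have ha : (1 : ℝ) ≤ pos a := by exact_mod_cast one_le_pos a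
  have hb : (1 : ℝ) ≤ pos b := by exact_mod_cast one_le_pos b
  by_cases h : pos a = 1 ∧ pos b = 1
  · rw [if_pos h.1, if_pos h.2, h.1, h.2]
    norm_num
  · have h2 : (0 : ℝ) < (pos a : ℝ) + pos b - 2 := by
      have h3 : 3 ≤ pos a + pos b := by
        have := one_le_pos a
        have := one_le_pos b
        omega
      have h4 : (3 : ℝ) ≤ pos a + pos b := by exact_mod_cast h3
      linarith
    have hz : (if pos a = 1 then (1 : ℝ) else 0) * (if pos b = 1 then (1 : ℝ) else 0) = 0 := by
      by_cases h3 : pos a = 1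
      · rw [if_neg (fun h4 => h ⟨h3, h4⟩), mul_zero]
      · rw [if_neg h3, zero_mul]
    rw [hz]
    generalize (pos a : ℝ) = i at *
    generalize (pos b : ℝ) = j at *
    have e1 : i - 1 + j = i + j - 1 := by ring
    have e2 : i + j - 1 - 1 = i + j - 2 := by ring
    have e3 : j - 1 + i = i + j - 1 := by ring
    rw [e1, e2, e3, e2]
    have h5 : i + j - 2 ≠ 0 := h2.ne'
    have h6 : i + j - 1 ≠ 0 := by intro h7; linarith
    have h7 : i + j ≠ 0 := by intro h7; linarith
    field_simp
    ring

theorem canonM_matq (N : ℕ) : canonM N * matq N + matq N * canonM N = hilbertMat N := by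
  ext a b
  rw [Matrix.add_apply, canonM, diagonal_mul, mul_diagonal, matq, hilbertMat]
  have ha : (1 : ℝ) ≤ pos a := by exact_mod_cast one_le_pos a
  have hb : (1 : ℝ) ≤ pos b := by exact_mod_cast one_le_pos b
  have h6 : (pos a : ℝ) + pos b - 1 ≠ 0 := by intro h7; linarith
  have h7 : (pos a : ℝ) + pos b ≠ 0 := by intro h7; linarith
  field_simp

/-! ### Positivity of 𝔮 and of the Hilbert matrix, and the value of (𝔔𝔅, 𝔅). -/

/-- The polynomial with the coefficients `v`. -/
noncomputable def coeffPoly (v : State N) (t : ℝ) : ℝ := ∑ a, v a * t ^ (pos a - 1)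

theorem continuous_coeffPoly (v : State N) : Continuous (coeffPoly v) := by
  unfold coeffPoly; fun_prop

theorem exists_coeffPoly_ne_zero {v : State N} (hv : v ≠ 0) :
    ∃ t ∈ Set.Ioo (0 : ℝ) 1, coeffPoly v t ≠ 0 := by
  by_contra! hcon
  set P : Polynomial ℝ := ∑ a, Polynomial.C (v a) * Polynomial.X ^ (pos a - 1) with hP
  have heval : ∀ t, P.eval t = coeffPoly v t := by
    intro t
    simp [hP, coeffPoly, Polynomial.eval_finsetSum]
  have hP0 : P = 0 := by
    refine Polynomial.eq_zero_of_infinite_isRoot P ((Set.Ioo_infinite one_pos).mono ?_)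
    intro t ht
    change P.eval t = 0
    rw [heval, hcon t ht]
  refine hv (funext fun a => ?_)
  have h1 : P.coeff (pos a - 1) = v a := by
    rw [hP, Polynomial.finsetSum_coeff, Finset.sum_eq_single a]
    · simp
    · intro b _ hb
      rw [Polynomial.coeff_C_mul_X_pow, if_neg]
      intro h2
      have := one_le_pos a
      have := one_le_pos b
      exact hb (pos_injective (by omega))
    · simp
  rw [← h1, hP0]
  simp

theorem integral_coeffPoly_sq (v : State N) (k : ℕ → ℝ) (r : ℝ → ℝ) (hr : Continuous r)
    (hk : ∀ m, ∫ t in (0 : ℝ)..1, r t * t ^ m = k m) :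
    ∫ t in (0 : ℝ)..1, r t * coeffPoly v t ^ 2 =
      ∑ a, ∑ b, v a * k (pos a + pos b - 2) * v b := by
  have h1 : ∀ t, r t * coeffPoly v t ^ 2 =
      ∑ a, ∑ b, (v a * v b) * (r t * t ^ (pos a + pos b - 2)) := by
    intro t
    rw [coeffPoly, sq, Finset.sum_mul_sum, Finset.mul_sum]
    refine Finset.sum_congr rfl fun a _ => ?_
    rw [Finset.mul_sum]
    refine Finset.sum_congr rfl fun b _ => ?_
    have e : pos a + pos b - 2 = (pos a - 1) + (pos b - 1) := by
      have := one_le_pos a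
      have := one_le_pos b
      omega
    rw [e, pow_add]
    ring
  simp_rw [h1]
  have hc : ∀ a b : Fin N × Fin 2,
      Continuous fun t : ℝ => (v a * v b) * (r t * t ^ (pos a + pos b - 2)) := by
    intro a b; fun_prop
  rw [intervalIntegral.integral_finsetSum fun a _ =>
    (continuous_finsetSum _ fun b _ => hc a b).intervalIntegrable _ _]
  refine Finset.sum_congr rfl fun a _ => ?_
  rw [intervalIntegral.integral_finsetSum fun b _ => (hc a b).intervalIntegrable _ _]
  refine Finset.sum_congr rfl fun b _ => ?_
  rw [intervalIntegral.integral_const_mul, hk]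
  ring

theorem dotProduct_mulVec_eq_sum (A : Mat N) (v w : State N) :
    v ⬝ᵥ A *ᵥ w = ∑ a, ∑ b, v a * A a b * w b := by
  simp only [dotProduct, mulVec, Finset.mul_sum, mul_assoc]

/-- The form is the integral over [0, 1] of the square of the polynomial with coefficients v. -/
theorem dotProduct_hilbertMat_pos {v : State N} (hv : v ≠ 0) :
    0 < v ⬝ᵥ hilbertMat N *ᵥ v := by
  have h := integral_coeffPoly_sq v (fun m => ((m : ℝ) + 1)⁻¹) (fun _ => 1) continuous_const
    (fun m => by simp [integral_pow])
  have h1 : v ⬝ᵥ hilbertMat N *ᵥ v = ∫ t in (0 : ℝ)..1, 1 * coeffPoly v t ^ 2 := by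
    rw [h, dotProduct_mulVec_eq_sum]
    refine Finset.sum_congr rfl fun a _ => Finset.sum_congr rfl fun b _ => ?_
    have e : pos a + pos b - 2 + 1 = pos a + pos b - 1 := by
      have := one_le_pos a
      have := one_le_pos b
      omega
    have e2 : (((pos a + pos b - 2 : ℕ) : ℝ) + 1) = (pos a : ℝ) + pos b - 1 := by
      rw [← Nat.cast_succ, Nat.succ_eq_add_one, e, Nat.cast_sub (by have := one_le_pos a; omega)]
      push_cast
      ring
    rw [e2, hilbertMat]
  rw [h1]
  obtain ⟨t, ht, hne⟩ := exists_coeffPoly_ne_zero hv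
  refine intervalIntegral.integral_pos one_pos
    (continuous_const.mul ((continuous_coeffPoly v).pow 2)).continuousOn (fun t _ => by positivity)
    ⟨t, Set.Ioo_subset_Icc_self ht, by positivity⟩

/-- 1/((m + 1)(m + 2)) is the m-th moment of the weight 1 - t on [0, 1]; with m = i + j - 2 the form
becomes a weighted integral of a squared polynomial. -/
theorem dotProduct_matq_pos {v : State N} (hv : v ≠ 0) : 0 < v ⬝ᵥ matq N *ᵥ v := by
  have h := integral_coeffPoly_sq v (fun m => ((m : ℝ) + 1)⁻¹ - ((m : ℝ) + 2)⁻¹) (fun t => 1 - t)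
    (by fun_prop) (fun m => by
      have e : ∀ t : ℝ, (1 - t) * t ^ m = t ^ m - t ^ (m + 1) := fun t => by ring
      simp_rw [e]
      rw [intervalIntegral.integral_sub (intervalIntegral.intervalIntegrable_pow m)
        (intervalIntegral.intervalIntegrable_pow (m + 1))]
      simp [integral_pow]
      ring)
  have h1 : v ⬝ᵥ matq N *ᵥ v = ∫ t in (0 : ℝ)..1, (1 - t) * coeffPoly v t ^ 2 := by
    rw [h, dotProduct_mulVec_eq_sum]
    refine Finset.sum_congr rfl fun a _ => Finset.sum_congr rfl fun b _ => ?_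
    have ha := one_le_pos a
    have hb := one_le_pos b
    have e2 : ((pos a + pos b - 2 : ℕ) : ℝ) = (pos a : ℝ) + pos b - 2 := by
      rw [Nat.cast_sub (by omega)]
      push_cast
      ring
    rw [e2, matq]
    have ha' : (1 : ℝ) ≤ pos a := by exact_mod_cast ha
    have hb' : (1 : ℝ) ≤ pos b := by exact_mod_cast hb
    have h6 : (pos a : ℝ) + pos b - 1 ≠ 0 := by intro h7; linarith
    have h7 : (pos a : ℝ) + pos b ≠ 0 := by intro h7; linarith
    congr 2
    have e3 : (pos a : ℝ) + pos b - 2 + 1 = (pos a : ℝ) + pos b - 1 := by ring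
    have e4 : (pos a : ℝ) + pos b - 2 + 2 = (pos a : ℝ) + pos b := by ring
    rw [e3, e4]
    field_simp
    ring
  rw [h1]
  obtain ⟨t, ht, hne⟩ := exists_coeffPoly_ne_zero hv
  refine intervalIntegral.integral_pos one_pos
    ((by fun_prop : Continuous fun t : ℝ => 1 - t).mul
      ((continuous_coeffPoly v).pow 2)).continuousOn
    (fun t ht => mul_nonneg (by linarith [ht.2]) (by positivity))
    ⟨t, Set.Ioo_subset_Icc_self ht, mul_pos (by linarith [ht.2]) (by positivity)⟩

theorem matq_posDef (N : ℕ) : (matq N).PosDef := by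
  refine Matrix.PosDef.of_dotProduct_mulVec_pos ?_ fun v hv => by
    simpa using dotProduct_matq_pos hv
  ext a b
  simp [matq_symm a b]

theorem matQ_posDef (N : ℕ) : (matQ N).PosDef := (matq_posDef N).inv

theorem dotProduct_matQ_pos {v : State N} (hv : v ≠ 0) : 0 < v ⬝ᵥ matQ N *ᵥ v := by
  simpa using (matQ_posDef N).dotProduct_mulVec_pos hv

theorem matQ_mul_matq (N : ℕ) : matQ N * matq N = 1 :=
  nonsing_inv_mul _ ((isUnit_iff_isUnit_det _).mp (matq_posDef N).isUnit)

theorem matq_mul_matQ (N : ℕ) : matq N * matQ N = 1 :=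
  mul_nonsing_inv _ ((isUnit_iff_isUnit_det _).mp (matq_posDef N).isUnit)

theorem matQ_transpose (N : ℕ) : (matQ N)ᵀ = matQ N := by
  have := (matQ_posDef N).isHermitian
  rwa [IsHermitian, conjTranspose_eq_transpose_of_trivial] at this

theorem dotProduct_matQ_comm (v w : State N) : v ⬝ᵥ matQ N *ᵥ w = w ⬝ᵥ matQ N *ᵥ v := by
  rw [dotProduct_mulVec, ← mulVec_transpose, matQ_transpose, dotProduct_comm]

/-- Multiply the Riccati identity by 𝔔 and take traces: `canonA` is traceless and `canonM`
contributes twice 1 + ⋯ + 2N. The value is the reciprocal of κ², whence the bound 1/2 for the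
canonical control. -/
theorem canonB_dotProduct_matQ_canonB (N : ℕ) :
    canonB N ⬝ᵥ matQ N *ᵥ canonB N = 2 * N * (2 * N + 1) := by
  have h := congrArg (fun A : Mat N => (A * matQ N).trace) (riccati N)
  simp only [add_mul, trace_add] at h
  have hA : (canonA N).trace = 0 := by
    refine Finset.sum_eq_zero fun a _ => ?_
    rw [diag_apply, canonA, if_neg (by omega)]
  have hM : (canonM N).trace = N * (2 * N + 1) := by
    rw [canonM, trace_diagonal, sum_pos_eq]
  rw [mul_assoc, matq_mul_matQ, mul_one, mul_assoc (canonM N), matq_mul_matQ, mul_one,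
    trace_mul_comm, ← mul_assoc, matQ_mul_matq, one_mul, trace_transpose,
    trace_mul_comm (matq N * canonM N), ← mul_assoc, matQ_mul_matq, one_mul, hA, hM,
    trace_mul_comm, mul_vecMulVec, trace_vecMulVec, dotProduct_comm] at h
  linarith

/-! ### The closed loop of the linear feedback is nilpotent -/

/-- The matrix `A + BC`. -/
noncomputable def closedA (ω : Fin N → ℝ) : Mat N :=
  sysA ω + vecMulVec (sysB N) (feedbackC ω)

theorem closedA_mulVec (ω : Fin N → ℝ) (x : State N) :
    closedA ω *ᵥ x = sysA ω *ᵥ x + (feedbackC ω ⬝ᵥ x) • sysB N := by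
  rw [closedA, add_mulVec, vecMulVec_mulVec]
  congr 1
  ext a
  simp [mul_comm]

/-- The vectors with the positions, or velocities, `(-ω_i²)^{-j}`. -/
noncomputable def chainVec (ω : Fin N → ℝ) (j : ℕ) (k : Fin 2) : State N := fun a =>
  if a.2 = k then ((-(ω a.1) ^ 2)⁻¹) ^ j else 0

theorem feedbackC_dotProduct_velocity (ω : Fin N → ℝ) (j : ℕ) :
    feedbackC ω ⬝ᵥ chainVec ω j 1 = 0 := by
  rw [dotProduct_eq_sum]
  simp [feedbackC, chainVec]

/-- With nodes s_i = -ω_i² the c_i are chosen so that this sum is minus the Lagrange formula for the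
coefficient of X^{N-1} in X^{N-j}. -/
theorem feedbackC_dotProduct_chainVec {ω : Fin N → ℝ} (hω : ∀ i, ω i ≠ 0)
    (hsq : Function.Injective fun i => (ω i) ^ 2) {j : ℕ} (h1 : 1 ≤ j) (hj : j ≤ N) :
    feedbackC ω ⬝ᵥ chainVec ω j 0 = if j = 1 then -1 else 0 := by
  set s : Fin N → ℝ := fun i => -(ω i) ^ 2 with hs
  have hinj : Set.InjOn s (Finset.univ : Finset (Fin N)) := by
    intro a _ b _ hab
    exact hsq (neg_injective hab)
  have hN : 0 < N := by omega
  have hlag := Lagrange.coeff_eq_sum (s := Finset.univ) (v := s) hinj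
    (P := (Polynomial.X : Polynomial ℝ) ^ (N - j)) (by
      rw [Polynomial.degree_X_pow, Finset.card_univ, Fintype.card_fin]
      exact_mod_cast (by omega : N - j < N))
  rw [Finset.card_univ, Fintype.card_fin, Polynomial.coeff_X_pow] at hlag
  have hsum : feedbackC ω ⬝ᵥ chainVec ω j 0 =
      -∑ i, Polynomial.eval (s i) ((Polynomial.X : Polynomial ℝ) ^ (N - j)) /
        ∏ k ∈ Finset.univ.erase i, (s i - s k) := by
    rw [dotProduct_eq_sum, ← Finset.sum_neg_distrib]
    refine Finset.sum_congr rfl fun i _ => ?_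
    simp only [feedbackC, chainVec, if_true, one_ne_zero, if_false, zero_mul, add_zero,
      Polynomial.eval_pow, Polynomial.eval_X]
    have hprod : ∏ k ∈ Finset.univ.erase i, ((ω k) ^ 2 - (ω i) ^ 2)⁻¹ =
        (∏ k ∈ Finset.univ.erase i, (s i - s k))⁻¹ := by
      rw [← Finset.prod_inv_distrib]
      refine Finset.prod_congr rfl fun k _ => ?_
      simp only [hs]
      congr 1
      ring
    have hsi : s i ≠ 0 := neg_ne_zero.mpr (pow_ne_zero 2 (hω i))
    have hpow : (-1 : ℝ) ^ (N + 1) * ω i ^ (2 * N) = -(s i) ^ N := by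
      rw [hs, pow_mul]
      simp only
      rw [neg_pow ((ω i) ^ 2), pow_succ]
      ring
    rw [hprod, hpow]
    have hpj : (s i) ^ N = (s i) ^ (N - j) * (s i) ^ j := by rw [← pow_add]; congr 1; omega
    rw [hpj, inv_pow, div_eq_mul_inv]
    have : (s i) ^ j ≠ 0 := pow_ne_zero j hsi
    change -((s i) ^ (N - j) * (s i) ^ j) * _ * ((s i) ^ j)⁻¹ = _
    field_simp
  rw [hsum, ← hlag]
  by_cases hj1 : j = 1
  · rw [if_pos hj1, if_pos (by omega)]
  · rw [if_neg hj1, if_neg (by omega), neg_zero]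

theorem closedA_mulVec_velocity (ω : Fin N → ℝ) (j : ℕ) :
    closedA ω *ᵥ chainVec ω j 1 = chainVec ω j 0 := by
  rw [closedA_mulVec, feedbackC_dotProduct_velocity, zero_smul, add_zero]
  refine state_ext (fun i => ?_) (fun i => ?_)
  · rw [sysA_mulVec_zero_comp]; simp [chainVec]
  · rw [sysA_mulVec_one_comp]; simp [chainVec]

/-- The free matrix lowers the exponent by one. At j = 1 the result would be B itself, and the
feedback, equal to -1 there, cancels it, so the chain terminates. -/
theorem closedA_mulVec_chainVec {ω : Fin N → ℝ} (hω : ∀ i, ω i ≠ 0)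
    (hsq : Function.Injective fun i => (ω i) ^ 2) {j : ℕ} (h1 : 1 ≤ j) (hj : j ≤ N) :
    closedA ω *ᵥ chainVec ω j 0 = if j = 1 then 0 else chainVec ω (j - 1) 1 := by
  rw [closedA_mulVec, feedbackC_dotProduct_chainVec hω hsq h1 hj]
  have hstep : sysA ω *ᵥ chainVec ω j 0 = chainVec ω (j - 1) 1 := by
    refine state_ext (fun i => ?_) (fun i => ?_)
    · rw [sysA_mulVec_zero_comp]; simp [chainVec]
    · rw [sysA_mulVec_one_comp]
      simp only [chainVec, if_true]
      obtain ⟨m, rfl⟩ : ∃ m, j = m + 1 := ⟨j - 1, by omega⟩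
      rw [pow_succ _ m, Nat.add_sub_cancel]
      have : -(ω i) ^ 2 ≠ 0 := neg_ne_zero.mpr (pow_ne_zero 2 (hω i))
      rw [mul_comm, mul_assoc, inv_mul_cancel₀ this, mul_one]
  rw [hstep]
  split_ifs with h
  · subst h
    refine state_ext (fun i => ?_) (fun i => ?_)
    · simp [chainVec, sysB]
    · simp [chainVec, sysB]
  · simp

theorem closedA_pow_mulVec_chainVec {ω : Fin N → ℝ} (hω : ∀ i, ω i ≠ 0)
    (hsq : Function.Injective fun i => (ω i) ^ 2) (j : ℕ) (hj : j + 1 ≤ N) :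
    closedA ω ^ (2 * (j + 1)) *ᵥ chainVec ω (j + 1) 1 = 0 := by
  induction j with
  | zero =>
    rw [show 2 * (0 + 1) = 1 + 1 by norm_num, pow_add, pow_one, ← mulVec_mulVec,
      closedA_mulVec_velocity, closedA_mulVec_chainVec hω hsq le_rfl (by omega), if_pos rfl]
  | succ j ih =>
    rw [show 2 * (j + 1 + 1) = 2 * (j + 1) + 1 + 1 by ring, pow_succ, pow_succ, ← mulVec_mulVec,
      ← mulVec_mulVec, closedA_mulVec_velocity, closedA_mulVec_chainVec hω hsq (by omega) hj,
      if_neg (by omega)]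
    exact ih (by omega)

/-- The monic polynomial with roots s_i = -ω_i² vanishes at each of them; dividing by s_i^N
expresses 1 through the negative powers of s_i, with the same coefficients for all i. -/
theorem sysB_eq_sum_chainVec {ω : Fin N → ℝ} (hω : ∀ i, ω i ≠ 0) :
    ∃ c : Fin N → ℝ, sysB N = ∑ j : Fin N, c j • chainVec ω (N - j) 1 := by
  set s : Fin N → ℝ := fun i => -(ω i) ^ 2 with hs
  set P : Polynomial ℝ := Lagrange.nodal Finset.univ s with hP
  have hdeg : P.natDegree = N := by simp [hP, Lagrange.natDegree_nodal]
  have hmon : P.Monic := Lagrange.nodal_monic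
  refine ⟨fun j => -P.coeff j, state_ext (fun i => ?_) (fun i => ?_)⟩
  · simp [sysB, chainVec]
  · have hsi : s i ≠ 0 := neg_ne_zero.mpr (pow_ne_zero 2 (hω i))
    have h0 : P.eval (s i) = 0 := by
      rw [hP]; exact Lagrange.eval_nodal_at_node (Finset.mem_univ i)
    rw [Polynomial.eval_eq_sum_range, hdeg, Finset.sum_range_succ, ← hdeg] at h0
    rw [hmon.coeff_natDegree, hdeg, one_mul,
      ← Fin.sum_univ_eq_sum_range (fun k => P.coeff k * s i ^ k)] at h0
    simp only [sysB, if_true, Finset.sum_apply, Pi.smul_apply, chainVec, smul_eq_mul]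
    have hpN : (s i) ^ N ≠ 0 := pow_ne_zero N hsi
    refine mul_right_cancel₀ hpN ?_
    rw [Finset.sum_mul, one_mul]
    have : ∀ j : Fin N, -P.coeff j * (-(ω i) ^ 2)⁻¹ ^ (N - (j : ℕ)) * s i ^ N =
        -(P.coeff j * s i ^ (j : ℕ)) := by
      intro j
      have e : (s i) ^ N = (s i) ^ (N - (j : ℕ)) * (s i) ^ (j : ℕ) := by
        rw [← pow_add]; congr 1; have := j.isLt; omega
      have h2 : (s i) ^ (N - (j : ℕ)) ≠ 0 := pow_ne_zero _ hsi
      rw [e, inv_pow]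
      change -P.coeff j * ((s i) ^ (N - (j : ℕ)))⁻¹ * _ = _
      field_simp
    simp_rw [this]
    rw [Finset.sum_neg_distrib]
    linarith

theorem closedA_pow_mulVec_sysB {ω : Fin N → ℝ} (hω : ∀ i, ω i ≠ 0)
    (hsq : Function.Injective fun i => (ω i) ^ 2) : closedA ω ^ (2 * N) *ᵥ sysB N = 0 := by
  obtain ⟨c, hc⟩ := sysB_eq_sum_chainVec hω
  rw [hc, mulVec_sum]
  refine Finset.sum_eq_zero fun j _ => ?_
  have hj := j.isLt
  obtain ⟨m, hm⟩ : ∃ m, N - (j : ℕ) = m + 1 := ⟨N - j - 1, by omega⟩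
  rw [mulVec_smul, hm, show 2 * N = 2 * (N - (m + 1)) + 2 * (m + 1) by omega, pow_add,
    ← mulVec_mulVec, closedA_pow_mulVec_chainVec hω hsq m (by omega), mulVec_zero, smul_zero]

/-! ### Canonical coordinates -/

theorem sysA_pow_even (ω : Fin N → ℝ) (m : ℕ) : sysA ω ^ (2 * m) *ᵥ sysB N =
    fun a => if a.2 = 1 then (-(ω a.1) ^ 2) ^ m else 0 := by
  induction m with
  | zero => simp only [mul_zero, pow_zero, one_mulVec]; rfl
  | succ m ih =>
    rw [show 2 * (m + 1) = 1 + 1 + 2 * m by ring, pow_add, ← mulVec_mulVec, ih, pow_add, pow_one,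
      ← mulVec_mulVec]
    refine state_ext (fun i => ?_) (fun i => ?_)
    · rw [sysA_mulVec_zero_comp, sysA_mulVec_one_comp]; simp
    · rw [sysA_mulVec_one_comp, sysA_mulVec_zero_comp]
      simp only [if_true]
      rw [pow_succ]
      ring

theorem sysA_pow_odd (ω : Fin N → ℝ) (m : ℕ) : sysA ω ^ (2 * m + 1) *ᵥ sysB N =
    fun a => if a.2 = 0 then (-(ω a.1) ^ 2) ^ m else 0 := by
  rw [add_comm, pow_add, ← mulVec_mulVec, sysA_pow_even, pow_one]
  refine state_ext (fun i => ?_) (fun i => ?_)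
  · rw [sysA_mulVec_zero_comp]; simp
  · rw [sysA_mulVec_one_comp]; simp

/-- Controllability: the odd powers test the positions and the even powers the velocities, each by a
Vandermonde system with distinct nodes. -/
theorem eq_zero_of_dotProduct_sysA_pow {ω : Fin N → ℝ}
    (hsq : Function.Injective fun i => (ω i) ^ 2) {p : State N}
    (h : ∀ k, k < 2 * N → p ⬝ᵥ (sysA ω ^ k *ᵥ sysB N) = 0) : p = 0 := by
  have hinj : Function.Injective fun i => -(ω i) ^ 2 := fun a b hab => hsq (neg_injective hab)
  have h0 : (fun i => p (i, 0)) = 0 := by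
    refine eq_zero_of_forall_pow_sum_mul_pow_eq_zero hinj fun m => ?_
    have := h (2 * m + 1) (by have := m.isLt; omega)
    rw [sysA_pow_odd, dotProduct_eq_sum] at this
    simpa using this
  have h1 : (fun i => p (i, 1)) = 0 := by
    refine eq_zero_of_forall_pow_sum_mul_pow_eq_zero hinj fun m => ?_
    have := h (2 * m) (by have := m.isLt; omega)
    rw [sysA_pow_even, dotProduct_eq_sum] at this
    simpa using this
  exact state_ext (fun i => congrFun h0 i) (fun i => congrFun h1 i)

theorem gaugeD_column (ω : Fin N → ℝ) (b : Fin N × Fin 2) : (fun a => gaugeD ω a b) =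
    ((-1 : ℝ) ^ (pos b - 1) / ((pos b - 1).factorial : ℝ)) •
      (closedA ω ^ (pos b - 1) *ᵥ sysB N) := rfl

/-- State feedback does not affect controllability: a covector orthogonal to all columns of D is
orthogonal to the vectors A^kB, hence zero. -/
theorem gaugeD_det_ne_zero {ω : Fin N → ℝ} (hsq : Function.Injective fun i => (ω i) ^ 2) :
    (gaugeD ω).det ≠ 0 := by
  intro hdet
  obtain ⟨p, hp, hpD⟩ := exists_vecMul_eq_zero_iff.mpr hdet
  refine hp (eq_zero_of_dotProduct_sysA_pow hsq ?_)
  have hclosed : ∀ k, k < 2 * N → p ⬝ᵥ (closedA ω ^ k *ᵥ sysB N) = 0 := by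
    intro k hk
    obtain ⟨b, hb⟩ := exists_pos_eq (N := N) (k := k + 1) (by omega) (by omega)
    have h1 : p ⬝ᵥ (fun a => gaugeD ω a b) = 0 := congrFun hpD b
    rw [gaugeD_column, hb, Nat.add_sub_cancel, dotProduct_smul, smul_eq_mul, mul_eq_zero] at h1
    refine h1.resolve_left (div_ne_zero (pow_ne_zero _ (by norm_num)) ?_)
    exact_mod_cast k.factorial_ne_zero
  -- Factors of A are traded one at a time for factors of A + BC; each exchange costs a multiple of
  -- a lower power of A + BC applied to B.
  have hmix : ∀ k j, j + k < 2 * N →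
      p ⬝ᵥ (closedA ω ^ j *ᵥ (sysA ω ^ k *ᵥ sysB N)) = 0 := by
    intro k
    induction k with
    | zero => intro j hj; rw [pow_zero, one_mulVec]; exact hclosed j hj
    | succ k ih =>
      intro j hj
      have h1 : sysA ω ^ (k + 1) *ᵥ sysB N = closedA ω *ᵥ (sysA ω ^ k *ᵥ sysB N) -
          (feedbackC ω ⬝ᵥ (sysA ω ^ k *ᵥ sysB N)) • sysB N := by
        rw [closedA_mulVec, add_sub_cancel_right, mulVec_mulVec, ← pow_succ']
      rw [h1, mulVec_sub, mulVec_smul, dotProduct_sub, dotProduct_smul, hclosed j (by omega),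
        smul_zero, sub_zero, mulVec_mulVec, ← pow_succ]
      exact ih (j + 1) (by omega)
  intro k hk
  have := hmix k 0 (by omega)
  rwa [pow_zero, one_mulVec] at this

/-- The columns of D are the iterates of B under A + BC, and the factors (-1)^k/k! turn the shift
into the entries -k of `canonA`. -/
theorem gaugeD_mul_canonA {ω : Fin N → ℝ} (hω : ∀ i, ω i ≠ 0)
    (hsq : Function.Injective fun i => (ω i) ^ 2) :
    gaugeD ω * canonA N = closedA ω * gaugeD ω := by
  have hcol : ∀ b, (fun a => (closedA ω * gaugeD ω) a b) =
      closedA ω *ᵥ (fun a => gaugeD ω a b) := fun b => rfl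
  suffices h : ∀ b, (fun a => (gaugeD ω * canonA N) a b) =
      fun a => (closedA ω * gaugeD ω) a b by
    ext a b
    exact congrFun (h b) a
  intro b
  rw [hcol, gaugeD_column, mulVec_smul, mulVec_mulVec, ← pow_succ',
    Nat.sub_add_cancel (one_le_pos b)]
  by_cases hb : pos b = 2 * N
  · rw [hb, closedA_pow_mulVec_sysB hω hsq, smul_zero]
    funext a
    rw [mul_apply]
    refine Finset.sum_eq_zero fun c _ => ?_
    have := pos_le c
    rw [canonA, if_neg (by omega), mul_zero]
  · obtain ⟨c, hc⟩ := exists_pos_eq (N := N) (k := pos b + 1) (by omega)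
      (by have := pos_le b; omega)
    funext a
    rw [mul_apply, Finset.sum_eq_single c]
    · have h1 : gaugeD ω a c = ((-1 : ℝ) ^ (pos c - 1) / ((pos c - 1).factorial : ℝ)) *
          (closedA ω ^ (pos c - 1) *ᵥ sysB N) a := rfl
      rw [h1, canonA, if_pos hc, hc, Nat.add_sub_cancel, Pi.smul_apply, smul_eq_mul]
      obtain ⟨m, hm⟩ : ∃ m, pos b = m + 1 := ⟨pos b - 1, by have := one_le_pos b; omega⟩
      rw [hm, Nat.add_sub_cancel, Nat.factorial_succ]
      have h2 : (m.factorial : ℝ) ≠ 0 := by exact_mod_cast m.factorial_ne_zero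
      have h3 : (m : ℝ) + 1 ≠ 0 := by positivity
      push_cast
      rw [pow_succ]
      field_simp
    · intro d _ hd
      rw [canonA, if_neg, mul_zero]
      intro h2
      exact hd (pos_injective (by omega))
    · simp

theorem gaugeD_mulVec_canonB (hN : 0 < N) (ω : Fin N → ℝ) :
    gaugeD ω *ᵥ canonB N = sysB N := by
  obtain ⟨c, hc⟩ := exists_pos_eq (N := N) (k := 1) le_rfl (by omega)
  funext a
  rw [mulVec, dotProduct, Finset.sum_eq_single c]
  · have h1 : gaugeD ω a c = ((-1 : ℝ) ^ (pos c - 1) / ((pos c - 1).factorial : ℝ)) *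
        (closedA ω ^ (pos c - 1) *ᵥ sysB N) a := rfl
    rw [h1, canonB, if_pos hc, hc]
    simp
  · intro d _ hd
    rw [canonB, if_neg, mul_zero]
    intro h2
    exact hd (pos_injective (by omega))
  · simp

theorem gaugeD_mulVec_canon {ω : Fin N → ℝ} (hsq : Function.Injective fun i => (ω i) ^ 2)
    (x : State N) : gaugeD ω *ᵥ canon ω x = x := by
  rw [canon, mulVec_mulVec, mul_nonsing_inv _ (isUnit_iff_ne_zero.mpr (gaugeD_det_ne_zero hsq)),
    one_mulVec]

theorem canon_gaugeD_mulVec {ω : Fin N → ℝ} (hsq : Function.Injective fun i => (ω i) ^ 2)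
    (w : State N) : canon ω (gaugeD ω *ᵥ w) = w := by
  rw [canon, mulVec_mulVec, nonsing_inv_mul _ (isUnit_iff_ne_zero.mpr (gaugeD_det_ne_zero hsq)),
    one_mulVec]

/-- The system in the canonical coordinates. -/
theorem canon_rhs (hN : 0 < N) {ω : Fin N → ℝ} (hω : ∀ i, ω i ≠ 0)
    (hsq : Function.Injective fun i => (ω i) ^ 2) (x : State N) (v : ℝ) :
    canon ω (sysA ω *ᵥ x + (v + feedbackC ω ⬝ᵥ x) • sysB N) =
      canonA N *ᵥ canon ω x + v • canonB N := by
  have h1 : sysA ω *ᵥ x + (v + feedbackC ω ⬝ᵥ x) • sysB N =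
      gaugeD ω *ᵥ (canonA N *ᵥ canon ω x + v • canonB N) := by
    rw [mulVec_add, mulVec_smul, gaugeD_mulVec_canonB hN, mulVec_mulVec,
      gaugeD_mul_canonA hω hsq, ← mulVec_mulVec, gaugeD_mulVec_canon hsq, closedA_mulVec]
    module
  rw [h1, canon_gaugeD_mulVec hsq]

/-! ### The terminal time function -/

/-- The anisotropic dilation `w_a ↦ s^{pos a} w_a`. -/
noncomputable def dilate (s : ℝ) (w : State N) : State N := fun a => s ^ pos a * w a

theorem delta_mulVec (T : ℝ) (w : State N) : delta N T *ᵥ w = dilate T⁻¹ w := by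
  funext a
  rw [delta, mulVec_diagonal, dilate, inv_pow]

theorem dilate_dilate (s r : ℝ) (w : State N) : dilate s (dilate r w) = dilate (s * r) w := by
  funext a
  simp only [dilate, mul_pow, mul_assoc]

theorem dilate_one (w : State N) : dilate 1 w = w := by
  funext a
  simp [dilate]

theorem dilate_zero_left (w : State N) : dilate 0 w = 0 := by
  funext a
  simp [dilate, (one_le_pos a).trans_lt' one_pos |>.ne']

theorem dilate_zero_right (s : ℝ) : dilate s (0 : State N) = 0 := by
  funext a
  simp [dilate]

theorem dilate_ne_zero {s : ℝ} (hs : s ≠ 0) {w : State N} (hw : w ≠ 0) : dilate s w ≠ 0 := by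
  intro h
  refine hw ?_
  rw [← dilate_one w, ← inv_mul_cancel₀ hs, ← dilate_dilate, h, dilate_zero_right]

theorem dilate_add (s : ℝ) (v w : State N) : dilate s (v + w) = dilate s v + dilate s w := by
  funext a
  simp [dilate, mul_add]

theorem dilate_smul (s r : ℝ) (w : State N) : dilate s (r • w) = r • dilate s w := by
  funext a
  simp [dilate, mul_left_comm]

theorem dilate_canonA (s : ℝ) (w : State N) :
    dilate s (canonA N *ᵥ w) = s • canonA N *ᵥ dilate s w := by
  funext a
  simp only [dilate, mulVec, dotProduct, Pi.smul_apply, smul_eq_mul, Finset.mul_sum, canonA]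
  refine Finset.sum_congr rfl fun b _ => ?_
  split_ifs with h
  · rw [h, pow_succ]
    ring
  · simp

theorem dilate_canonB (s : ℝ) : dilate s (canonB N) = s • canonB N := by
  funext a
  simp only [dilate, canonB, Pi.smul_apply, smul_eq_mul]
  split_ifs with h
  · rw [h, pow_one]
  · simp

theorem continuous_dilate : Continuous fun z : ℝ × State N => dilate z.1 z.2 := by
  unfold dilate
  fun_prop

theorem kappaSq_pos (hN : 0 < N) : 0 < kappaSq N := by
  have : (0 : ℝ) < N := by exact_mod_cast hN
  rw [kappaSq]
  positivity

/-- The quadratic form of `𝔔`. -/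
noncomputable def energy (v : State N) : ℝ := v ⬝ᵥ matQ N *ᵥ v

theorem lyapunov_eq (T : ℝ) (w : State N) : lyapunov T w = energy (dilate T⁻¹ w) := by
  rw [lyapunov, delta_mulVec, dotProduct_comm, energy]

theorem energy_pos {v : State N} (hv : v ≠ 0) : 0 < energy v := dotProduct_matQ_pos hv

theorem energy_zero : energy (0 : State N) = 0 := by simp [energy]

theorem continuous_energy : Continuous (energy (N := N)) := by
  unfold energy
  simp_rw [dotProduct_mulVec_eq_sum]
  fun_prop

theorem hasDerivAt_energy {v : ℝ → State N} {v' : State N} {t : ℝ} (hv : HasDerivAt v v' t) :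
    HasDerivAt (fun t => energy (v t)) (2 * ((matQ N *ᵥ v t) ⬝ᵥ v')) t := by
  have h1 : (fun t => energy (v t)) = fun t => ∑ a, ∑ b, v t a * matQ N a b * v t b := by
    funext t
    rw [energy, dotProduct_mulVec_eq_sum]
  have hc := hasDerivAt_pi.mp hv
  have h2 : HasDerivAt (fun t => ∑ a, ∑ b, v t a * matQ N a b * v t b)
      (∑ a, ∑ b, (v' a * matQ N a b * v t b + v t a * matQ N a b * v' b)) t :=
    HasDerivAt.fun_sum fun a _ => HasDerivAt.fun_sum fun b _ =>
      ((hc a).mul_const (matQ N a b)).mul (hc b)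
  rw [h1]
  convert h2 using 1
  simp only [Finset.sum_add_distrib]
  rw [← dotProduct_mulVec_eq_sum, ← dotProduct_mulVec_eq_sum, dotProduct_matQ_comm (v t) v',
    dotProduct_comm v']
  ring

theorem matq_mulVec_matQ_mulVec (v : State N) : matq N *ᵥ matQ N *ᵥ v = v := by
  rw [mulVec_mulVec, matq_mul_matQ, one_mulVec]

theorem matQ_mulVec_ne_zero {v : State N} (hv : v ≠ 0) : matQ N *ᵥ v ≠ 0 := by
  intro h
  exact hv (by rw [← matq_mulVec_matQ_mulVec v, h, mulVec_zero])

theorem dotProduct_mulVec_transpose (A : Mat N) (v w : State N) :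
    v ⬝ᵥ Aᵀ *ᵥ w = w ⬝ᵥ A *ᵥ v := by
  rw [dotProduct_mulVec, vecMul_transpose, dotProduct_comm]

/-- Writing v = 𝔮p, the quantity is half of the form of M𝔮 + 𝔮M at p, that is, of the Hilbert form.
It gives the monotonicity in T of the equation defining the terminal time. -/
theorem dotProduct_canonM_pos {v : State N} (hv : v ≠ 0) :
    0 < (matQ N *ᵥ v) ⬝ᵥ (canonM N *ᵥ v) := by
  set p := matQ N *ᵥ v with hp
  have h := dotProduct_hilbertMat_pos (matQ_mulVec_ne_zero hv)
  rw [← hp, ← canonM_matq, add_mulVec, dotProduct_add] at h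
  have h1 : p ⬝ᵥ (matq N * canonM N) *ᵥ p = p ⬝ᵥ (canonM N * matq N) *ᵥ p := by
    rw [← dotProduct_mulVec_transpose, transpose_mul]
    congr 3
    · rw [canonM, diagonal_transpose]
    · ext a b
      rw [transpose_apply, matq_symm]
  rw [h1, ← mulVec_mulVec, hp, matq_mulVec_matQ_mulVec] at h
  linarith

/-- The feedback `𝔲` makes the rescaled closed loop preserve the quadratic form of `𝔔`. -/
theorem dotProduct_closedLoop (v : State N) :
    (matQ N *ᵥ v) ⬝ᵥ (canonA N *ᵥ v + (canonC N ⬝ᵥ v) • canonB N + canonM N *ᵥ v) = 0 := by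
  set p := matQ N *ᵥ v with hp
  have hv : matq N *ᵥ p = v := matq_mulVec_matQ_mulVec v
  have h := congrArg (fun A : Mat N => p ⬝ᵥ A *ᵥ p) (riccati N)
  have hqT : (matq N)ᵀ = matq N := by
    ext a b
    rw [transpose_apply, matq_symm]
  have h1 : p ⬝ᵥ (matq N * (canonA N)ᵀ) *ᵥ p = p ⬝ᵥ canonA N *ᵥ v := by
    rw [← dotProduct_mulVec_transpose, transpose_mul, transpose_transpose, hqT, ← mulVec_mulVec,
      hv]
  have h2 : p ⬝ᵥ (matq N * canonM N) *ᵥ p = p ⬝ᵥ canonM N *ᵥ v := by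
    rw [← dotProduct_mulVec_transpose, transpose_mul, hqT, canonM, diagonal_transpose, ← canonM,
      ← mulVec_mulVec, hv]
  have h3 : canonC N ⬝ᵥ v = -(1 / 2) * (canonB N ⬝ᵥ p) := by
    rw [canonC, smul_dotProduct, ← dotProduct_mulVec, smul_eq_mul]
  simp only [add_mulVec, dotProduct_add, h1, h2] at h
  rw [← mulVec_mulVec, ← mulVec_mulVec, hv, vecMulVec_mulVec] at h
  have h4 : p ⬝ᵥ (MulOpposite.op (canonB N ⬝ᵥ p) • canonB N) =
      (canonB N ⬝ᵥ p) * (canonB N ⬝ᵥ p) := by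
    rw [show MulOpposite.op (canonB N ⬝ᵥ p) • canonB N = (canonB N ⬝ᵥ p) • canonB N by
      ext a; simp [mul_comm], dotProduct_smul, smul_eq_mul, dotProduct_comm p]
  rw [h4] at h
  rw [dotProduct_add, dotProduct_add, dotProduct_smul, h3, smul_eq_mul,
    dotProduct_comm p (canonB N)]
  linarith

theorem hasDerivAt_dilate {s : ℝ → ℝ} {s' t : ℝ} {w : ℝ → State N} {w' : State N}
    (hs : HasDerivAt s s' t) (hw : HasDerivAt w w' t) (h0 : s t ≠ 0) :
    HasDerivAt (fun t => dilate (s t) (w t))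
      ((s' / s t) • canonM N *ᵥ dilate (s t) (w t) + dilate (s t) w') t := by
  refine hasDerivAt_pi.mpr fun a => ?_
  have h := (hs.fun_pow (pos a)).mul (hasDerivAt_pi.mp hw a)
  refine h.congr_deriv ?_
  rw [Pi.add_apply, Pi.smul_apply, canonM, mulVec_diagonal]
  simp only [dilate, smul_eq_mul]
  obtain ⟨m, hm⟩ : ∃ m, pos a = m + 1 := ⟨pos a - 1, by have := one_le_pos a; omega⟩
  rw [hm, Nat.add_sub_cancel, pow_succ]
  field_simp

/-- For s > 0 the derivative is 2/s times (𝔔v, Mv) at the dilated vector v. Hence the terminal time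
is unique. -/
theorem strictMonoOn_energy_dilate {w : State N} (hw : w ≠ 0) :
    StrictMonoOn (fun s => energy (dilate s w)) (Set.Ici 0) := by
  refine strictMonoOn_of_deriv_pos (convex_Ici 0) ?_ fun s hs => ?_
  · exact (continuous_energy.comp (continuous_dilate.comp
      (continuous_id.prodMk continuous_const))).continuousOn
  · rw [interior_Ici] at hs
    have hs0 : s ≠ 0 := (Set.mem_Ioi.mp hs).ne'
    have h := hasDerivAt_energy (hasDerivAt_dilate (hasDerivAt_id' s)
      (hasDerivAt_const s w) hs0)
    rw [h.deriv]
    have h1 := dotProduct_canonM_pos (dilate_ne_zero hs0 hw)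
    have h2 : dilate s (0 : State N) = 0 := dilate_zero_right s
    simp only [h2, add_zero, dotProduct_smul, smul_eq_mul]
    have : 0 < s := hs
    positivity

theorem exists_energy_ge (N : ℕ) : ∃ c > 0, ∀ v : State N, c * ‖v‖ ^ 2 ≤ energy v := by
  by_cases hS : (Metric.sphere (0 : State N) 1).Nonempty
  · obtain ⟨v₀, hv₀, hmin⟩ := (isCompact_sphere (0 : State N) 1).exists_isMinOn hS
      continuous_energy.continuousOn
    have hv₀' : v₀ ≠ 0 := by
      rintro rfl
      simp at hv₀
    refine ⟨energy v₀, energy_pos hv₀', fun v => ?_⟩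
    by_cases hv : v = 0
    · simp [hv, energy_zero]
    have hn : 0 < ‖v‖ := norm_pos_iff.mpr hv
    have h1 := isMinOn_iff.mp hmin (‖v‖⁻¹ • v) (by simp [norm_smul, hn.ne'])
    have h2 : energy (‖v‖⁻¹ • v) = (‖v‖⁻¹) ^ 2 * energy v := by
      rw [energy, energy, mulVec_smul, dotProduct_smul, smul_dotProduct, smul_eq_mul, smul_eq_mul]
      ring
    rw [h2, inv_pow] at h1
    rwa [inv_mul_eq_div, le_div_iff₀ (by positivity)] at h1
  · refine ⟨1, one_pos, fun v => ?_⟩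
    have hv : v = 0 := by
      by_contra hv
      exact hS ⟨‖v‖⁻¹ • v, by simp [norm_smul, norm_ne_zero_iff.mpr hv]⟩
    simp [hv, energy_zero]

theorem norm_dilate_ge {s : ℝ} (hs : 1 ≤ s) (w : State N) : s * ‖w‖ ≤ ‖dilate s w‖ := by
  have h0 : 0 < s := by linarith
  rw [← le_div_iff₀' h0, pi_norm_le_iff_of_nonneg (by positivity)]
  intro a
  rw [le_div_iff₀' h0]
  refine le_trans ?_ (norm_le_pi_norm (dilate s w) a)
  rw [dilate, norm_mul, Real.norm_of_nonneg (by positivity : 0 ≤ s ^ pos a)]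
  exact mul_le_mul_of_nonneg_right (le_self_pow₀ hs (by have := one_le_pos a; omega))
    (norm_nonneg _)

theorem norm_dilate_le {s : ℝ} (h0 : 0 ≤ s) (hs : s ≤ 1) (w : State N) :
    ‖dilate s w‖ ≤ s * ‖w‖ := by
  rw [pi_norm_le_iff_of_nonneg (by positivity)]
  intro a
  rw [dilate, norm_mul, Real.norm_of_nonneg (by positivity : 0 ≤ s ^ pos a)]
  exact mul_le_mul (pow_le_of_le_one h0 hs (by have := one_le_pos a; omega))
    (norm_le_pi_norm w a) (norm_nonneg _) h0

theorem exists_energy_dilate_eq (hN : 0 < N) {w : State N} (hw : w ≠ 0) :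
    ∃ s > 0, energy (dilate s w) = kappaSq N := by
  obtain ⟨c, hc, hcv⟩ := exists_energy_ge N
  have hn : 0 < ‖w‖ := norm_pos_iff.mpr hw
  have hk := kappaSq_pos hN
  -- Since S ≥ 1, the energy at S is at least c(S‖w‖)² ≥ S·c‖w‖², and this already exceeds κ².
  set S := 1 + kappaSq N / (c * ‖w‖ ^ 2) with hS
  have hS1 : 1 ≤ S := by
    have : 0 ≤ kappaSq N / (c * ‖w‖ ^ 2) := by positivity
    linarith
  have hbig : kappaSq N ≤ energy (dilate S w) := by
    refine le_trans ?_ (hcv _)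
    have h1 := norm_dilate_ge hS1 w
    have h2 : (S * ‖w‖) ^ 2 ≤ ‖dilate S w‖ ^ 2 := by gcongr
    have h3 : S * (c * ‖w‖ ^ 2) = c * ‖w‖ ^ 2 + kappaSq N := by
      rw [hS]
      field_simp
    have h5 : S * (c * ‖w‖ ^ 2) ≤ S * (S * (c * ‖w‖ ^ 2)) :=
      le_mul_of_one_le_left (by positivity) hS1
    have h6 : 0 < c * ‖w‖ ^ 2 := by positivity
    nlinarith
  have hcont : ContinuousOn (fun s => energy (dilate s w)) (Set.Icc 0 S) :=
    (continuous_energy.comp (continuous_dilate.comp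
      (continuous_id.prodMk continuous_const))).continuousOn
  obtain ⟨s, hs, hsk⟩ := intermediate_value_Icc (by linarith) hcont
    (show kappaSq N ∈ Set.Icc _ _ from ⟨by simp [dilate_zero_left, energy_zero, hk.le], hbig⟩)
  refine ⟨s, lt_of_le_of_ne hs.1 ?_, hsk⟩
  rintro rfl
  simp [dilate_zero_left, energy_zero] at hsk
  exact hk.ne hsk

theorem terminalTime_unique {w : State N} (hw : w ≠ 0) {T : ℝ} (hT : 0 < T)
    (h : energy (dilate T⁻¹ w) = kappaSq N) : terminalTime w = T := by
  have hset : {T : ℝ | 0 < T ∧ lyapunov T w = kappaSq N} = {T} := by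
    ext r
    simp only [Set.mem_ofPred_eq, Set.mem_singleton_iff, lyapunov_eq]
    constructor
    · rintro ⟨hr, hr2⟩
      have := (strictMonoOn_energy_dilate hw).injOn (inv_pos.mpr hr).le (inv_pos.mpr hT).le
        (hr2.trans h.symm)
      exact inv_injective this
    · rintro rfl
      exact ⟨hT, h⟩
  rw [terminalTime, hset, csInf_singleton]

theorem terminalTime_spec (hN : 0 < N) {w : State N} (hw : w ≠ 0) :
    0 < terminalTime w ∧ energy (dilate (terminalTime w)⁻¹ w) = kappaSq N := by
  obtain ⟨s, hs, hsk⟩ := exists_energy_dilate_eq hN hw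
  have h1 : energy (dilate (s⁻¹)⁻¹ w) = kappaSq N := by rwa [inv_inv]
  have h := terminalTime_unique hw (inv_pos.mpr hs) h1
  rw [h]
  exact ⟨inv_pos.mpr hs, h1⟩

theorem terminalTime_zero (hN : 0 < N) : terminalTime (0 : State N) = 0 := by
  have hset : {T : ℝ | 0 < T ∧ lyapunov T (0 : State N) = kappaSq N} = ∅ := by
    refine Set.eq_empty_of_forall_notMem fun T hT => ?_
    rw [Set.mem_ofPred_eq, lyapunov_eq, dilate_zero_right, energy_zero] at hT
    exact (kappaSq_pos hN).ne hT.2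
  -- The convention that the infimum of the empty set is 0 gives the prescribed value at the origin.
  rw [terminalTime, hset, Real.sInf_empty]

theorem terminalTime_nonneg (hN : 0 < N) (w : State N) : 0 ≤ terminalTime w := by
  by_cases hw : w = 0
  · rw [hw, terminalTime_zero hN]
  · exact (terminalTime_spec hN hw).1.le

theorem terminalTime_le_iff (hN : 0 < N) (w : State N) {Θ : ℝ} (hΘ : 0 < Θ) :
    terminalTime w ≤ Θ ↔ energy (dilate Θ⁻¹ w) ≤ kappaSq N := by
  by_cases hw : w = 0
  · simp [hw, terminalTime_zero hN, dilate_zero_right, energy_zero, hΘ.le, (kappaSq_pos hN).le]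
  · obtain ⟨hT, hk⟩ := terminalTime_spec hN hw
    rw [← hk, (strictMonoOn_energy_dilate hw).le_iff_le (inv_pos.mpr hΘ).le (inv_pos.mpr hT).le,
      inv_le_inv₀ hΘ hT]

theorem terminalTime_lt_iff (hN : 0 < N) (w : State N) {Θ : ℝ} (hΘ : 0 < Θ) :
    terminalTime w < Θ ↔ energy (dilate Θ⁻¹ w) < kappaSq N := by
  by_cases hw : w = 0
  · simp [hw, terminalTime_zero hN, dilate_zero_right, energy_zero, hΘ, kappaSq_pos hN]
  · obtain ⟨hT, hk⟩ := terminalTime_spec hN hw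
    rw [← hk, (strictMonoOn_energy_dilate hw).lt_iff_lt (inv_pos.mpr hΘ).le (inv_pos.mpr hT).le,
      inv_lt_inv₀ hΘ hT]

/-- At a fixed positive level Θ, comparing the terminal time with Θ amounts to comparing a
continuous function of w with κ², so both strict level sets are open. -/
theorem continuous_terminalTime (hN : 0 < N) : Continuous (terminalTime (N := N)) := by
  have hc : ∀ Θ : ℝ, Continuous fun w : State N => energy (dilate Θ⁻¹ w) := fun Θ =>
    continuous_energy.comp (continuous_dilate.comp (continuous_const.prodMk continuous_id))
  refine continuous_iff_continuousAt.mpr fun w => tendsto_order.mpr ⟨fun r hr => ?_, fun r hr => ?_⟩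
  · by_cases h0 : r < 0
    · exact Eventually.of_forall fun v => h0.trans_le (terminalTime_nonneg hN v)
    obtain ⟨r', hr1, hr2⟩ := exists_between hr
    have hr' : 0 < r' := by linarith
    have h1 : ¬ terminalTime w ≤ r' := not_le.mpr hr2
    rw [terminalTime_le_iff hN w hr', not_le] at h1
    filter_upwards [(hc r').continuousAt.eventually_const_lt h1] with v hv
    refine hr1.trans (not_le.mp fun h => ?_)
    rw [terminalTime_le_iff hN v hr'] at h
    exact absurd hv (not_lt.mpr h)
  · have hr' : 0 < r := (terminalTime_nonneg hN w).trans_lt hr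
    rw [gt_iff_lt, terminalTime_lt_iff hN w hr'] at hr
    filter_upwards [(hc r).continuousAt.eventually_lt_const hr] with v hv
    rwa [terminalTime_lt_iff hN v hr']

/-! ### The terminal control -/

/-- The feedback `𝔲` of the canonical system. -/
noncomputable def canonControl (w : State N) : ℝ := canonC N ⬝ᵥ dilate (terminalTime w)⁻¹ w

theorem terminalControl_eq (ω : Fin N → ℝ) (x : State N) :
    terminalControl ω x = canonControl (canon ω x) + feedbackC ω ⬝ᵥ x := by
  rw [terminalControl, delta_mulVec, canonControl]

theorem canonC_dotProduct (v : State N) :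
    canonC N ⬝ᵥ v = -(1 / 2) * (canonB N ⬝ᵥ matQ N *ᵥ v) := by
  rw [canonC, smul_dotProduct, ← dotProduct_mulVec, smul_eq_mul]

theorem energy_nonneg (v : State N) : 0 ≤ energy v := by
  by_cases hv : v = 0
  · rw [hv, energy_zero]
  · exact (energy_pos hv).le

/-- Cauchy–Schwarz for the form of 𝔔, using that (𝔔𝔅, 𝔅) is the reciprocal of κ². -/
theorem abs_canonC_dotProduct_le (hN : 0 < N) {v : State N} (hv : energy v ≤ kappaSq N) :
    |canonC N ⬝ᵥ v| ≤ 1 / 2 := by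
  set a := canonB N ⬝ᵥ matQ N *ᵥ v with ha
  set E : ℝ := 2 * N * (2 * N + 1) with hE
  have hN' : (0 : ℝ) < N := by exact_mod_cast hN
  have hE0 : 0 < E := by positivity
  have hB : canonB N ⬝ᵥ matQ N *ᵥ canonB N = E := canonB_dotProduct_matQ_canonB N
  have h := energy_nonneg (E • v - a • canonB N)
  have hexp : energy (E • v - a • canonB N) = E * (E * energy v - a ^ 2) := by
    have h1 : v ⬝ᵥ matQ N *ᵥ canonB N = a := by rw [dotProduct_matQ_comm]
    simp only [energy, mulVec_sub, mulVec_smul, dotProduct_sub, sub_dotProduct, dotProduct_smul,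
      smul_dotProduct, smul_eq_mul, hB, h1, ← ha]
    ring
  rw [hexp] at h
  have h2 : 0 ≤ E * energy v - a ^ 2 := nonneg_of_mul_nonneg_right h hE0
  have h3 : E * energy v ≤ 1 := by
    calc E * energy v ≤ E * kappaSq N := by gcongr
      _ = 1 := by rw [kappaSq, ← hE]; field_simp
  have h4 : |a| ≤ 1 := abs_le_one_iff_mul_self_le_one.mpr (by nlinarith)
  rw [canonC_dotProduct, abs_mul, ← ha]
  norm_num
  linarith

theorem abs_canonControl_le (hN : 0 < N) (w : State N) : |canonControl w| ≤ 1 / 2 := by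
  refine abs_canonC_dotProduct_le hN ?_
  by_cases hw : w = 0
  · rw [hw, dilate_zero_right, energy_zero]
    exact (kappaSq_pos hN).le
  · exact (terminalTime_spec hN hw).2.le

theorem measurable_canonControl (hN : 0 < N) : Measurable (canonControl (N := N)) := by
  have h1 : Measurable fun w : State N => (terminalTime w)⁻¹ :=
    (continuous_terminalTime hN).measurable.inv
  unfold canonControl dotProduct dilate
  exact Finset.measurable_sum _ fun a _ => measurable_const.mul
    ((h1.pow_const _).mul (measurable_pi_apply a))

theorem continuousAt_canonControl (hN : 0 < N) {w : State N} (hw : w ≠ 0) :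
    ContinuousAt canonControl w := by
  have h1 : ContinuousAt (fun w : State N => (terminalTime w)⁻¹) w :=
    (continuous_terminalTime hN).continuousAt.inv₀ (terminalTime_spec hN hw).1.ne'
  unfold canonControl dotProduct dilate
  exact tendsto_finsetSum _ fun a _ => tendsto_const_nhds.mul
    ((h1.pow (pos a)).mul (continuous_apply a).continuousAt)

theorem canonControl_eq_of_energy {w : State N} (hw : w ≠ 0) {T : ℝ} (hT : 0 < T)
    (h : energy (dilate T⁻¹ w) = kappaSq N) : canonControl w = canonC N ⬝ᵥ dilate T⁻¹ w := by
  rw [canonControl, terminalTime_unique hw hT h]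

/-- As a continuous linear map, the change of coordinates `D⁻¹`. -/
noncomputable def canonCLM (ω : Fin N → ℝ) : State N →L[ℝ] State N :=
  LinearMap.toContinuousLinearMap (gaugeD ω)⁻¹.mulVecLin

theorem continuous_canon (ω : Fin N → ℝ) : Continuous (canon ω) := (canonCLM ω).continuous

theorem canon_zero (ω : Fin N → ℝ) : canon ω 0 = 0 := (canonCLM ω).map_zero

theorem canon_ne_zero {ω : Fin N → ℝ} (hsq : Function.Injective fun i => (ω i) ^ 2) {x : State N}
    (hx : x ≠ 0) : canon ω x ≠ 0 := by
  intro h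
  refine hx ?_
  rw [← gaugeD_mulVec_canon hsq x, h, mulVec_zero]

theorem isClosed_terminalDomain (hN : 0 < N) (ω : Fin N → ℝ) (Θ : ℝ) :
    IsClosed (terminalDomain ω Θ) :=
  isClosed_le ((continuous_terminalTime hN).comp (continuous_canon ω)) continuous_const

theorem zero_mem_terminalDomain (hN : 0 < N) (ω : Fin N → ℝ) {Θ : ℝ} (hΘ : 0 < Θ) :
    (0 : State N) ∈ terminalDomain ω Θ := by
  rw [terminalDomain, Set.mem_ofPred_eq, canon_zero, terminalTime_zero hN]
  exact hΘ.le

theorem exists_norm_canon_le (hN : 0 < N) (ω : Fin N → ℝ) : ∃ K > 0, ∀ Θ : ℝ, 0 < Θ → Θ ≤ 1 →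
    ∀ x ∈ terminalDomain ω Θ, ‖canon ω x‖ ≤ K * Θ := by
  obtain ⟨c, hc, hcv⟩ := exists_energy_ge N
  refine ⟨Real.sqrt (kappaSq N / c), Real.sqrt_pos.mpr (div_pos (kappaSq_pos hN) hc),
    fun Θ hΘ hΘ1 x hx => ?_⟩
  have h1 := (terminalTime_le_iff hN (canon ω x) hΘ).mp hx
  set v := dilate Θ⁻¹ (canon ω x) with hv
  have h2 : canon ω x = dilate Θ v := by
    rw [hv, dilate_dilate, mul_inv_cancel₀ hΘ.ne', dilate_one]
  have h3 : ‖v‖ ≤ Real.sqrt (kappaSq N / c) := by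
    refine Real.le_sqrt_of_sq_le ?_
    rw [le_div_iff₀' hc]
    exact (hcv v).trans h1
  rw [h2, mul_comm]
  exact (norm_dilate_le hΘ.le hΘ1 v).trans (mul_le_mul_of_nonneg_left h3 hΘ.le)

theorem eventually_inStrip (hN : 0 < N) {ω : Fin N → ℝ}
    (hsq : Function.Injective fun i => (ω i) ^ 2) : ∀ᶠ Θ in 𝓝[>] (0 : ℝ), InStrip ω Θ := by
  obtain ⟨K, hK, h⟩ := exists_norm_canon_le hN ω
  have hcont : Continuous fun w : State N => |feedbackC ω ⬝ᵥ gaugeD ω *ᵥ w| := by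
    simp_rw [dotProduct_mulVec_eq_sum]
    fun_prop
  have h0 : |feedbackC ω ⬝ᵥ gaugeD ω *ᵥ (0 : State N)| < 1 / 2 := by simp
  obtain ⟨r, hr, hball⟩ := Metric.eventually_nhds_iff.mp
    (hcont.continuousAt.eventually_lt_const h0)
  have hm : (0 : ℝ) < min 1 (r / (2 * K)) := by positivity
  filter_upwards [Ioo_mem_nhdsGT hm] with Θ hΘ x hx
  have h1 := h Θ hΘ.1 (hΘ.2.le.trans (min_le_left _ _)) x hx
  have h2 : K * Θ < r := by
    have : Θ < r / (2 * K) := hΘ.2.trans_le (min_le_right _ _)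
    rw [lt_div_iff₀ (by positivity)] at this
    nlinarith [mul_pos hK hΘ.1]
  have h3 := hball (y := canon ω x) (by rw [dist_zero_right]; linarith)
  rw [gaugeD_mulVec_canon hsq] at h3
  exact h3.le

theorem eventually_coversInefficient (hN : 0 < N) {ω : Fin N → ℝ} (hω : ∀ i, ω i ≠ 0) {C : ℝ}
    (hC : 0 < C) {Θ : ℝ} (hΘ : 0 < Θ) : ∀ᶠ U in 𝓝[>] (0 : ℝ), CoversInefficient ω C Θ U := by
  obtain ⟨M, hM, h⟩ := exists_norm_le_rho hω
  have hcont : Continuous fun x : State N => terminalTime (canon ω x) :=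
    (continuous_terminalTime hN).comp (continuous_canon ω)
  have h0 : terminalTime (canon ω (0 : State N)) < Θ := by
    rwa [canon_zero, terminalTime_zero hN]
  obtain ⟨r, hr, hball⟩ := Metric.eventually_nhds_iff.mp
    (hcont.continuousAt.eventually_lt_const h0)
  have hm : (0 : ℝ) < r / (M * C) := by positivity
  filter_upwards [Ioo_mem_nhdsGT hm] with U hU x hx
  refine (hball ?_).le
  rw [dist_zero_right]
  refine (h x).trans_lt ?_
  have h1 : U * (M * C) < r := (lt_div_iff₀ (by positivity)).mp hU.2
  have h2 : rho ω x ≤ U * C := hx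
  nlinarith [mul_le_mul_of_nonneg_left h2 hM.le]

/-! ### Motions under the terminal control -/

/-- Along the closed loop the terminal time decreases with unit rate. -/
theorem terminalTime_le_of_hasDerivAt_of_lt (hN : 0 < N) {w : ℝ → State N} {a b : ℝ} (hab : a ≤ b)
    (hw : ∀ t ∈ Set.Icc a b, w t ≠ 0)
    (hd : ∀ t ∈ Set.Icc a b,
      HasDerivAt w (canonA N *ᵥ w t + canonControl (w t) • canonB N) t)
    (hlt : b - a < terminalTime (w a)) :
    terminalTime (w b) ≤ terminalTime (w a) - (b - a) := by
  set T₀ := terminalTime (w a) with hT₀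
  refine le_of_forall_pos_le_add fun η hη => ?_
  -- The barrier comparison needs a strict inequality between derivatives, so the terminal time is
  -- compared with a line of slope -(1 - ε). The loss ε(b - a) stays below η.
  set ε := η / (b - a + 1) with hε
  have hba : 0 < b - a + 1 := by linarith
  have hε0 : 0 < ε := by positivity
  have hεη : ε * (b - a) ≤ η := by
    rw [hε, div_mul_eq_mul_div, div_le_iff₀ hba]
    nlinarith
  set τ : ℝ → ℝ := fun t => T₀ - (1 - ε) * (t - a) with hτ
  have hτpos : ∀ t ∈ Set.Icc a b, 0 < τ t := by
    intro t ht
    simp only [hτ]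
    nlinarith [ht.1, ht.2, mul_nonneg hε0.le (sub_nonneg.mpr ht.1)]
  have hdτ : ∀ t ∈ Set.Icc a b,
      HasDerivAt (fun t => (τ t)⁻¹) ((1 - ε) / (τ t) ^ 2) t := by
    intro t ht
    have h1 : HasDerivAt τ (-(1 - ε)) t := by
      have := (((hasDerivAt_id' t).sub_const a).const_mul (1 - ε)).const_sub T₀
      simpa using this
    refine (h1.fun_inv (hτpos t ht).ne').congr_deriv ?_
    rw [neg_neg]
  have hder : ∀ t ∈ Set.Icc a b, HasDerivAt (fun t => energy (dilate (τ t)⁻¹ (w t)))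
      (2 * ((matQ N *ᵥ dilate (τ t)⁻¹ (w t)) ⬝ᵥ
        ((((1 - ε) / (τ t) ^ 2) / (τ t)⁻¹) • canonM N *ᵥ dilate (τ t)⁻¹ (w t) +
        dilate (τ t)⁻¹ (canonA N *ᵥ w t + canonControl (w t) • canonB N)))) t := fun t ht =>
    hasDerivAt_energy (hasDerivAt_dilate (hdτ t ht) (hd t ht) (inv_pos.mpr (hτpos t ht)).ne')
  have hmain := image_le_of_deriv_right_lt_deriv_boundary'
    (fun t ht => (hder t ht).continuousAt.continuousWithinAt)
    (fun t ht => (hder t (Set.Ico_subset_Icc_self ht)).hasDerivWithinAt)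
    (B := fun _ => kappaSq N) (B' := fun _ => 0) ?_ continuousOn_const
    (fun t _ => (hasDerivAt_const t _).hasDerivWithinAt) ?_ (Set.right_mem_Icc.mpr hab)
  · have h1 := (terminalTime_le_iff hN (w b) (hτpos b (Set.right_mem_Icc.mpr hab))).mpr hmain
    simp only [hτ] at h1
    nlinarith
  · have h1 := (terminalTime_spec hN (hw a (Set.left_mem_Icc.mpr hab))).2
    rw [← hT₀] at h1
    simp only [hτ, sub_self, mul_zero, sub_zero]
    exact h1.le
  -- Only contact points matter: there the candidate time is the terminal time, so the feedback is
  -- the linear one. The closed-loop identity then leaves a derivative that is a negative multiple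
  -- of ε(𝔔v, Mv).
  · intro t ht heq
    have ht' := Set.Ico_subset_Icc_self ht
    have hτt := hτpos t ht'
    rw [canonControl_eq_of_energy (hw t ht') hτt heq]
    have hv := dilate_ne_zero (inv_pos.mpr hτt).ne' (hw t ht')
    set v := dilate (τ t)⁻¹ (w t) with hvdef
    have hM := dotProduct_canonM_pos hv
    have hcl := dotProduct_closedLoop v
    rw [dilate_add, dilate_canonA, dilate_smul, dilate_canonB, ← hvdef]
    simp only [dotProduct_add, dotProduct_smul, smul_eq_mul] at hcl ⊢
    set m := (matQ N *ᵥ v) ⬝ᵥ canonM N *ᵥ v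
    set α := (matQ N *ᵥ v) ⬝ᵥ canonA N *ᵥ v
    set β := (matQ N *ᵥ v) ⬝ᵥ canonB N
    have e1 : (1 - ε) / (τ t) ^ 2 / (τ t)⁻¹ = (1 - ε) * (τ t)⁻¹ := by field_simp
    have e2 : 2 * ((1 - ε) / (τ t) ^ 2 / (τ t)⁻¹ * m +
        ((τ t)⁻¹ * α + canonC N ⬝ᵥ v * ((τ t)⁻¹ * β))) = -(2 * ε * (τ t)⁻¹ * m) := by
      rw [e1]
      have : α = -(canonC N ⬝ᵥ v * β) - m := by linarith
      rw [this]
      ring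
    rw [e2]
    have := inv_pos.mpr hτt
    have : 0 < 2 * ε * (τ t)⁻¹ * m := by positivity
    linarith

/-- A motion avoiding 0 for the full time T₀ would, by the unit rate and continuity, have terminal
time at most 0 at a + T₀, although its state there is nonzero. -/
theorem terminalTime_le_of_hasDerivAt (hN : 0 < N) {w : ℝ → State N} {a b : ℝ} (hab : a ≤ b)
    (hw : ∀ t ∈ Set.Icc a b, w t ≠ 0)
    (hd : ∀ t ∈ Set.Icc a b,
      HasDerivAt w (canonA N *ᵥ w t + canonControl (w t) • canonB N) t) :
    b - a < terminalTime (w a) ∧ terminalTime (w b) ≤ terminalTime (w a) - (b - a) := by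
  have key : b - a < terminalTime (w a) := by
    by_contra hle
    rw [not_lt] at hle
    set T₀ := terminalTime (w a) with hT₀
    have hT₀pos : 0 < T₀ := (terminalTime_spec hN (hw a (Set.left_mem_Icc.mpr hab))).1
    have hmem : a + T₀ ∈ Set.Icc a b := ⟨by linarith, by linarith⟩
    have hcont : ContinuousAt (fun t => terminalTime (w t) - (T₀ - (t - a))) (a + T₀) :=
      (((continuous_terminalTime hN).continuousAt.comp (hd _ hmem).continuousAt)).sub
        (by fun_prop)
    have hlim : terminalTime (w (a + T₀)) - (T₀ - (a + T₀ - a)) ≤ 0 := by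
      refine le_of_tendsto (hcont.tendsto.mono_left (nhdsWithin_le_nhds (s := Set.Iio (a + T₀)))) ?_
      filter_upwards [Ioo_mem_nhdsLT (by linarith : a < a + T₀)] with t ht
      have := terminalTime_le_of_hasDerivAt_of_lt hN ht.1.le
        (fun s hs => hw s ⟨hs.1, hs.2.trans (ht.2.le.trans hmem.2)⟩)
        (fun s hs => hd s ⟨hs.1, hs.2.trans (ht.2.le.trans hmem.2)⟩) (by linarith [ht.2])
      linarith
    have := (terminalTime_spec hN (hw _ hmem)).1
    linarith
  exact ⟨key, terminalTime_le_of_hasDerivAt_of_lt hN hab hw hd key⟩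

theorem IsTrajectory.sub_eq_integral {ω : Fin N → ℝ} {x : State N} {y : ℝ → State N}
    {u : ℝ → ℝ} (h : IsTrajectory ω x y u) {a b : ℝ} (ha : 0 ≤ a) (hb : 0 ≤ b) :
    y b = y a + ∫ s in a..b, (sysA ω *ᵥ y s + u s • sysB N) := by
  rw [h.eq_integral a ha, h.eq_integral b hb, add_assoc,
    intervalIntegral.integral_add_adjacent_intervals
    (h.intervalIntegrable_rhs ha) ((h.intervalIntegrable_rhs ha).symm.trans
      (h.intervalIntegrable_rhs hb))]

theorem continuous_feedbackC_dotProduct (ω : Fin N → ℝ) :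
    Continuous fun x : State N => feedbackC ω ⬝ᵥ x := by
  unfold dotProduct
  fun_prop

theorem continuous_sysA_mulVec (ω : Fin N → ℝ) : Continuous fun x : State N => sysA ω *ᵥ x :=
  (LinearMap.toContinuousLinearMap (sysA ω).mulVecLin).continuous

/-- The control agrees with the feedback only almost everywhere. The feedback is continuous away
from 0, so on [a, b] the trajectory coincides with a genuinely differentiable solution. -/
theorem IsTrajectory.terminalTime_le (hN : 0 < N) {ω : Fin N → ℝ} (hω : ∀ i, ω i ≠ 0)
    (hsq : Function.Injective fun i => (ω i) ^ 2) {x : State N} {y : ℝ → State N} {u : ℝ → ℝ}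
    (h : IsTrajectory ω x y u) {a b : ℝ} (ha : 0 ≤ a) (hab : a ≤ b)
    (hu : ∀ᵐ t, t ∈ Set.Icc a b → u t = terminalControl ω (y t))
    (hy : ∀ t ∈ Set.Icc a b, y t ≠ 0) :
    b - a < terminalTime (canon ω (y a)) ∧
      terminalTime (canon ω (y b)) ≤ terminalTime (canon ω (y a)) - (b - a) := by
  -- Freezing the right-hand side outside [a, b] makes it continuous on the whole line, so two-sided
  -- derivatives exist at the endpoints.
  set clip : ℝ → ℝ := fun t => max a (min t b) with hclip
  have hclip_mem : ∀ t, clip t ∈ Set.Icc a b := fun t =>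
    ⟨le_max_left _ _, max_le hab (min_le_right _ _)⟩
  have hclip_eq : ∀ t ∈ Set.Icc a b, clip t = t := by
    intro t ht
    simp only [hclip]
    rw [min_eq_left ht.2, max_eq_right ht.1]
  set f : ℝ → State N := fun t =>
    sysA ω *ᵥ y (clip t) + terminalControl ω (y (clip t)) • sysB N with hf
  have hyc : Continuous fun t => y (clip t) :=
    h.continuousOn.comp_continuous (by simp only [hclip]; fun_prop)
      fun t => ha.trans (hclip_mem t).1
  have hctrl : Continuous fun t => terminalControl ω (y (clip t)) := by
    simp_rw [terminalControl_eq]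
    refine Continuous.add ?_ ((continuous_feedbackC_dotProduct ω).comp hyc)
    refine continuous_iff_continuousAt.mpr fun t => ?_
    exact (continuousAt_canonControl hN (canon_ne_zero hsq (hy _ (hclip_mem t)))).comp
      (f := fun t => canon ω (y (clip t))) ((continuous_canon ω).comp hyc).continuousAt
  have hcont : Continuous f :=
    ((continuous_sysA_mulVec ω).comp hyc).add (hctrl.smul continuous_const)
  set g : ℝ → State N := fun t => y a + ∫ s in a..t, f s with hg
  have hgd : ∀ t, HasDerivAt g (f t) t := fun t =>
    (hcont.integral_hasStrictDerivAt a t).hasDerivAt.const_add (y a)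
  have hgy : ∀ t ∈ Set.Icc a b, g t = y t := by
    intro t ht
    rw [h.sub_eq_integral ha (ha.trans ht.1)]
    simp only [hg]
    congr 1
    refine intervalIntegral.integral_congr_ae ?_
    filter_upwards [hu] with s hs hst
    rw [Set.uIoc_of_le ht.1] at hst
    have hs' : s ∈ Set.Icc a b := ⟨hst.1.le, hst.2.trans ht.2⟩
    simp only [hf]
    rw [hclip_eq s hs', hs hs']
  have hgw : ∀ t ∈ Set.Icc a b, canon ω (g t) ≠ 0 := fun t ht => by
    rw [hgy t ht]
    exact canon_ne_zero hsq (hy t ht)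
  have hmain := terminalTime_le_of_hasDerivAt hN (w := fun t => canon ω (g t)) hab hgw
    (fun t ht => by
      have h1 : HasDerivAt (fun t => canon ω (g t)) (canon ω (f t)) t :=
        (canonCLM ω).hasFDerivAt.comp_hasDerivAt t (hgd t)
      refine h1.congr_deriv ?_
      simp only [hf]
      rw [hclip_eq t ht, terminalControl_eq, canon_rhs hN hω hsq, hgy t ht])
  simp only [hgy a (Set.left_mem_Icc.mpr hab), hgy b (Set.right_mem_Icc.mpr hab)] at hmain
  exact hmain

theorem IsTrajectory.exists_arrival_of_terminalControl (hN : 0 < N) {ω : Fin N → ℝ}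
    (hω : ∀ i, ω i ≠ 0) (hsq : Function.Injective fun i => (ω i) ^ 2) {x : State N}
    {y : ℝ → State N} {u : ℝ → ℝ} (h : IsTrajectory ω x y u) {a : ℝ} (ha : 0 ≤ a)
    (hu : ∀ᵐ t, a ≤ t → u t = terminalControl ω (y t)) :
    ∃ t ∈ Set.Icc a (a + terminalTime (canon ω (y a))), y t = 0 := by
  by_contra! hne
  have := (h.terminalTime_le hN hω hsq ha
    (le_add_of_nonneg_right (terminalTime_nonneg hN (canon ω (y a))))
    (hu.mono fun t ht hm => ht hm.1) hne).1
  linarith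

/-- Passage through 0 must be covered, since the motion continues after arrival. Starting just after
the last zero the terminal time is arbitrarily small and cannot increase, so the motion never leaves
0. -/
theorem IsTrajectory.terminalTime_le_of_terminalControl (hN : 0 < N) {ω : Fin N → ℝ}
    (hω : ∀ i, ω i ≠ 0) (hsq : Function.Injective fun i => (ω i) ^ 2) {x : State N}
    {y : ℝ → State N} {u : ℝ → ℝ} (h : IsTrajectory ω x y u) {a : ℝ} (ha : 0 ≤ a)
    (hu : ∀ᵐ t, a ≤ t → u t = terminalControl ω (y t)) {t : ℝ} (hat : a ≤ t) :
    terminalTime (canon ω (y t)) ≤ terminalTime (canon ω (y a)) := by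
  by_cases hz : ∃ s ∈ Set.Icc a t, y s = 0
  · set S : Set ℝ := Set.Icc a t ∩ y ⁻¹' {0} with hS
    have hyc : ContinuousOn y (Set.Icc a t) := h.continuousOn.mono fun s hs => ha.trans hs.1
    have hSc : IsCompact S :=
      isCompact_Icc.of_isClosed_subset (hyc.preimage_isClosed_of_isClosed isClosed_Icc
        isClosed_singleton) Set.inter_subset_left
    obtain ⟨c, hc, hmax⟩ := hSc.exists_isGreatest (by
      obtain ⟨s, hs, hs0⟩ := hz
      exact ⟨s, hs, hs0⟩)
    have hc0 : y c = 0 := hc.2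
    refine le_trans ?_ (terminalTime_nonneg hN _)
    rcases hc.1.2.eq_or_lt with rfl | hct
    · rw [hc0, canon_zero, terminalTime_zero hN]
    have hcw : ContinuousWithinAt (fun s => terminalTime (canon ω (y s))) (Set.Ioo c t) c :=
      ((continuous_terminalTime hN).comp (continuous_canon ω)).continuousAt.comp_continuousWithinAt
        ((h.continuousOn c (ha.trans hc.1.1)).mono fun s hs => (ha.trans hc.1.1).trans hs.1.le)
    have hlim : terminalTime (canon ω (y t)) ≤ terminalTime (canon ω (y c)) := by
      have hne : (𝓝[Set.Ioo c t] c).NeBot := by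
        rw [nhdsWithin_Ioo_eq_nhdsGT hct]
        infer_instance
      refine ge_of_tendsto hcw (eventually_nhdsWithin_of_forall fun s hs => ?_)
      have := (h.terminalTime_le hN hω hsq ((ha.trans hc.1.1).trans hs.1.le) hs.2.le
        (hu.mono fun r hr hm => hr ((hc.1.1.trans hs.1.le).trans hm.1)) (fun r hr hr0 => by
          have := hmax (show r ∈ S from ⟨⟨(hc.1.1.trans hs.1.le).trans hr.1, hr.2⟩, hr0⟩)
          linarith [hs.1, hr.1])).2
      linarith [hs.2]
    rwa [hc0, canon_zero, terminalTime_zero hN] at hlim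
  · push Not at hz
    have := (h.terminalTime_le hN hω hsq ha hat (hu.mono fun r hr hm => hr hm.1) hz).2
    linarith

/-! ### Existence of motions under the terminal control -/

/-- The matrix of the closed loop in logarithmic time. -/
noncomputable def loopMat (N : ℕ) : Mat N :=
  canonA N + vecMulVec (canonB N) (canonC N) + canonM N

theorem loopMat_mulVec (v : State N) :
    loopMat N *ᵥ v = canonA N *ᵥ v + (canonC N ⬝ᵥ v) • canonB N + canonM N *ᵥ v := by
  rw [loopMat, add_mulVec, add_mulVec, vecMulVec_mulVec]
  congr 2
  ext a
  simp [mul_comm]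

theorem exists_linear_flow (A : Mat N) (v : State N) :
    ∃ V : ℝ → State N, V 0 = v ∧ ∀ r, HasDerivAt V (A *ᵥ V r) r := by
  set L : State N →L[ℝ] State N := LinearMap.toContinuousLinearMap A.mulVecLin with hL
  refine ⟨fun r => NormedSpace.exp (r • L) v, by simp, fun r => ?_⟩
  have h := hasDerivAt_exp_smul_const' (𝕂 := ℝ) L r
  exact (ContinuousLinearMap.apply ℝ (State N) v).hasFDerivAt.comp_hasDerivAt r h

/-- By the Riccati identity the rescaled loop stays on the ellipsoid that defines the terminal time,
so the feedback remains linear along it. -/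
theorem energy_eq_of_loop {V : ℝ → State N} (hV : ∀ r, HasDerivAt V (loopMat N *ᵥ V r) r) (r : ℝ) :
    energy (V r) = energy (V 0) := by
  have h : ∀ r, HasDerivAt (fun r => energy (V r)) 0 r := fun r => by
    refine (hasDerivAt_energy (hV r)).congr_deriv ?_
    rw [loopMat_mulVec, dotProduct_closedLoop, mul_zero]
  exact is_const_of_deriv_eq_zero (fun r => (h r).differentiableAt) (fun r => (h r).deriv) r 0

theorem dilate_canonM (s : ℝ) (w : State N) :
    dilate s (canonM N *ᵥ w) = canonM N *ᵥ dilate s w := by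
  funext a
  simp only [dilate, canonM, mulVec_diagonal]
  ring

theorem canonControl_zero : canonControl (0 : State N) = 0 := by
  rw [canonControl, dilate_zero_right, dotProduct_zero]

/-- The closed loop of the canonical system has a motion from every state, smooth except at the
time of arrival. -/
theorem exists_canon_motion (hN : 0 < N) {w₀ : State N} (hw₀ : w₀ ≠ 0) :
    ∃ (w : ℝ → State N) (T : ℝ), Continuous w ∧ w 0 = w₀ ∧ ∀ t, t ≠ T →
      HasDerivAt w (canonA N *ᵥ w t + canonControl (w t) • canonB N) t := by
  obtain ⟨hT₀, hk⟩ := terminalTime_spec hN hw₀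
  set T₀ := terminalTime w₀ with hT₀def
  obtain ⟨V, hV0, hV⟩ := exists_linear_flow (loopMat N) (dilate T₀⁻¹ w₀)
  have hen : ∀ r, energy (V r) = kappaSq N := fun r => by rw [energy_eq_of_loop hV, hV0, hk]
  have hVne : ∀ r, V r ≠ 0 := by
    intro r h0
    have := hen r
    rw [h0, energy_zero] at this
    exact (kappaSq_pos hN).ne this
  -- Dilation by the remaining time T₀ - t, composed with the logarithmic time log(T₀/(T₀ - t)),
  -- turns the linear flow into the closed loop.
  set ζ : ℝ → State N := fun t => dilate (T₀ - t) (V (Real.log T₀ - Real.log (T₀ - t))) with hζ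
  set w : ℝ → State N := fun t => if t < T₀ then ζ t else 0 with hw
  have hlt : ∀ t, t < T₀ → w =ᶠ[𝓝 t] ζ := fun t ht => by
    filter_upwards [Iio_mem_nhds ht] with s hs
    exact if_pos hs
  have hgt : ∀ t, T₀ < t → w =ᶠ[𝓝 t] fun _ => 0 := fun t ht => by
    filter_upwards [Ioi_mem_nhds ht] with s hs
    exact if_neg (not_lt.mpr (le_of_lt hs))
  have hderlt : ∀ t, t < T₀ →
      HasDerivAt w (canonA N *ᵥ w t + canonControl (w t) • canonB N) t := by
    intro t ht
    have hτ : 0 < T₀ - t := by linarith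
    have hwt : w t = ζ t := if_pos ht
    set r := Real.log T₀ - Real.log (T₀ - t) with hr
    have h1 : HasDerivAt (fun t => T₀ - t) (-1) t := by
      simpa using (hasDerivAt_id' t).const_sub T₀
    have h2 : HasDerivAt (fun t => Real.log T₀ - Real.log (T₀ - t)) ((T₀ - t)⁻¹) t := by
      refine ((h1.log hτ.ne').const_sub (Real.log T₀)).congr_deriv ?_
      field_simp
    have h3 : HasDerivAt (fun t => V (Real.log T₀ - Real.log (T₀ - t)))
        ((T₀ - t)⁻¹ • loopMat N *ᵥ V r) t := (hV r).scomp t h2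
    have h4 := hasDerivAt_dilate h1 h3 hτ.ne'
    have h5 : dilate (T₀ - t)⁻¹ (ζ t) = V r := by
      simp only [hζ]
      rw [dilate_dilate, inv_mul_cancel₀ hτ.ne', dilate_one]
    have hne : ζ t ≠ 0 := dilate_ne_zero hτ.ne' (hVne r)
    have h6 : canonControl (ζ t) = canonC N ⬝ᵥ V r := by
      rw [canonControl_eq_of_energy hne hτ (by rw [h5, hen]), h5]
    refine (h4.congr_of_eventuallyEq (hlt t ht)).congr_deriv ?_
    rw [hwt, h6]
    have h7 : dilate (T₀ - t) (V r) = ζ t := rfl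
    rw [dilate_smul, loopMat_mulVec, dilate_add, dilate_add, dilate_canonA, dilate_smul,
      dilate_canonB, dilate_canonM, ← hr, h7]
    simp only [smul_add, smul_smul]
    rw [inv_mul_cancel₀ hτ.ne', one_smul, mul_left_comm, inv_mul_cancel₀ hτ.ne', mul_one, neg_div,
      one_div]
    module
  refine ⟨w, T₀, ?_, ?_, fun t ht => ?_⟩
  · refine continuous_iff_continuousAt.mpr fun t => ?_
    rcases lt_trichotomy t T₀ with h | rfl | h
    · exact (hderlt t h).continuousAt
    -- On arrival the logarithmic time goes to infinity, but the linear flow stays on a bounded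
    -- ellipsoid and the dilation factor goes to 0.
    · obtain ⟨c, hc, hcv⟩ := exists_energy_ge N
      set K := Real.sqrt (kappaSq N / c) with hK
      have hVb : ∀ r, ‖V r‖ ≤ K := fun r => by
        refine Real.le_sqrt_of_sq_le ?_
        rw [le_div_iff₀' hc, ← hen r]
        exact hcv _
      have hw0 : w T₀ = 0 := if_neg (lt_irrefl _)
      rw [ContinuousAt, hw0]
      have hlim : Tendsto (fun t => |T₀ - t| * K) (𝓝 T₀) (𝓝 0) := by
        have : Continuous fun t => |T₀ - t| * K := by fun_prop
        simpa using this.tendsto T₀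
      refine squeeze_zero_norm' ?_ hlim
      filter_upwards [Ioi_mem_nhds (by linarith : T₀ - 1 < T₀)] with t ht
      simp only [hw]
      split_ifs with h
      · have h0 : 0 < T₀ - t := by linarith
        rw [abs_of_pos h0]
        exact (norm_dilate_le h0.le (by linarith [Set.mem_Ioi.mp ht]) _).trans
          (mul_le_mul_of_nonneg_left (hVb _) h0.le)
      · rw [norm_zero]
        positivity
    · exact (continuousAt_const (y := (0 : State N))).congr (hgt t h).symm
  · simp only [hw, if_pos hT₀, hζ, sub_zero, sub_self, hV0]
    rw [dilate_dilate, mul_inv_cancel₀ hT₀.ne', dilate_one]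
  · rcases lt_or_gt_of_ne ht with h | h
    · exact hderlt t h
    · have hwt : w t = 0 := if_neg (not_lt.mpr h.le)
      rw [hwt, mulVec_zero, canonControl_zero, zero_smul, add_zero]
      exact (hasDerivAt_const t (0 : State N)).congr_of_eventuallyEq (hgt t h)

theorem exists_terminal_motion (hN : 0 < N) {ω : Fin N → ℝ} (hω : ∀ i, ω i ≠ 0)
    (hsq : Function.Injective fun i => (ω i) ^ 2) (x : State N) :
    ∃ (y : ℝ → State N) (u : ℝ → ℝ), IsTrajectory ω x y u ∧
      ∀ t, u t = terminalControl ω (y t) := by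
  by_cases hx : x = 0
  · subst hx
    refine ⟨fun _ => 0, fun _ => 0, ⟨continuousOn_const, fun t _ => intervalIntegrable_const,
      fun t _ => by simp⟩, fun t => ?_⟩
    rw [terminalControl_eq, canon_zero, canonControl_zero, dotProduct_zero, add_zero]
  obtain ⟨w, T, hwc, hw0, hwd⟩ := exists_canon_motion hN (canon_ne_zero hsq hx)
  set L : State N →L[ℝ] State N := LinearMap.toContinuousLinearMap (gaugeD ω).mulVecLin with hL
  have hyc : Continuous fun t => gaugeD ω *ᵥ w t := L.continuous.comp hwc
  have hcanon : ∀ t, canon ω (gaugeD ω *ᵥ w t) = w t := fun t => canon_gaugeD_mulVec hsq _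
  have hu : ∀ a b, IntervalIntegrable (fun t => terminalControl ω (gaugeD ω *ᵥ w t)) volume a b := by
    intro a b
    simp_rw [terminalControl_eq, hcanon]
    exact (intervalIntegrable_of_bounded ((measurable_canonControl hN).comp hwc.measurable)
      (fun t => abs_canonControl_le hN _) a b).add
        (((continuous_feedbackC_dotProduct ω).comp hyc).intervalIntegrable a b)
  refine ⟨fun t => gaugeD ω *ᵥ w t, fun t => terminalControl ω (gaugeD ω *ᵥ w t),
    ⟨hyc.continuousOn, fun t _ => hu 0 t, fun t ht => ?_⟩, fun t => rfl⟩
  have hint : IntervalIntegrable (fun s => sysA ω *ᵥ (gaugeD ω *ᵥ w s) +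
      terminalControl ω (gaugeD ω *ᵥ w s) • sysB N) volume 0 t :=
    (((continuous_sysA_mulVec ω).comp hyc).intervalIntegrable 0 t).add
      (intervalIntegrable_state fun c => (hu 0 t).mul_const _)
  -- The derivative is missing only at the instant of arrival.
  have h := MeasureTheory.integral_eq_of_hasDerivAt_off_countable (fun t => gaugeD ω *ᵥ w t) _
    (s := {T}) (Set.countable_singleton T) hyc.continuousOn (fun s hs => by
      have h1 : HasDerivAt (fun t => gaugeD ω *ᵥ w t)
          (gaugeD ω *ᵥ (canonA N *ᵥ w s + canonControl (w s) • canonB N)) s :=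
        L.hasFDerivAt.comp_hasDerivAt s (hwd s hs.2)
      have h2 := canon_rhs hN hω hsq (gaugeD ω *ᵥ w s) (canonControl (w s))
      rw [hcanon] at h2
      rw [← h2, gaugeD_mulVec_canon hsq] at h1
      refine h1.congr_deriv ?_
      rw [terminalControl_eq, hcanon]) hint
  rw [h, hw0, gaugeD_mulVec_canon hsq]
  abel

/-! ### Concatenation of motions -/

theorem IsTrajectory.concat {ω : Fin N → ℝ} {x : State N} {y z : ℝ → State N} {u v : ℝ → ℝ}
    {t₁ : ℝ} (ht₁ : 0 ≤ t₁) (h : IsTrajectory ω x y u) (h' : IsTrajectory ω (y t₁) z v) :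
    IsTrajectory ω x (fun t => if t < t₁ then y t else z (t - t₁))
      (fun t => if t < t₁ then u t else v (t - t₁)) := by
  have hz0 : z 0 = y t₁ := h'.apply_zero_eq
  have hyl : ∀ t ≤ t₁, (if t < t₁ then y t else z (t - t₁)) = y t := by
    intro t ht
    rcases ht.lt_or_eq with h1 | rfl
    · rw [if_pos h1]
    · rw [if_neg (lt_irrefl _), sub_self, hz0]
  have hyr : ∀ t, t₁ ≤ t → (if t < t₁ then y t else z (t - t₁)) = z (t - t₁) := fun t ht =>
    if_neg (not_lt.mpr ht)
  have hul : ∀ t, 0 ≤ t → t ≤ t₁ →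
      IntervalIntegrable (fun t => if t < t₁ then u t else v (t - t₁)) volume 0 t := by
    intro t ht0 ht
    refine (h.intervalIntegrable t ht0).congr_ae ?_
    rw [Set.uIoc_of_le ht0]
    refine (ae_restrict_iff' measurableSet_Ioc).mpr ?_
    filter_upwards [compl_mem_ae_iff.mpr (measure_singleton t₁)] with s hs hst
    rw [if_pos (lt_of_le_of_ne (hst.2.trans ht) hs)]
  have hvr : ∀ t, t₁ ≤ t → IntervalIntegrable (fun s => v (s - t₁)) volume t₁ t := by
    intro t ht
    have := (h'.intervalIntegrable (t - t₁) (sub_nonneg.mpr ht)).comp_sub_right t₁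
    simpa using this
  have hur : ∀ t, t₁ ≤ t →
      IntervalIntegrable (fun t => if t < t₁ then u t else v (t - t₁)) volume t₁ t := by
    intro t ht
    refine (hvr t ht).congr fun s hs => ?_
    rw [Set.uIoc_of_le ht] at hs
    exact (if_neg (not_lt.mpr hs.1.le)).symm
  have hcl : ContinuousOn (fun t => if t < t₁ then y t else z (t - t₁)) (Set.Icc 0 t₁) :=
    (h.continuousOn.mono Set.Icc_subset_Ici_self).congr fun t ht => hyl t ht.2
  have hcr : ContinuousOn (fun t => if t < t₁ then y t else z (t - t₁)) (Set.Ici t₁) :=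
    ContinuousOn.congr (f := fun t => z (t - t₁))
      (h'.continuousOn.comp (by fun_prop) fun t ht =>
        Set.mem_Ici.mpr (sub_nonneg.mpr (Set.mem_Ici.mp ht))) fun t ht => hyr t ht
  have heql : ∀ t, 0 ≤ t → t ≤ t₁ → y t = x + ∫ s in (0 : ℝ)..t,
      (sysA ω *ᵥ (if s < t₁ then y s else z (s - t₁)) +
        (if s < t₁ then u s else v (s - t₁)) • sysB N) := by
    intro t ht0 ht
    rw [h.eq_integral t ht0]
    congr 1
    refine intervalIntegral.integral_congr_ae ?_
    filter_upwards [compl_mem_ae_iff.mpr (measure_singleton t₁)] with s hs hst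
    rw [Set.uIoc_of_le ht0] at hst
    rw [if_pos (lt_of_le_of_ne (hst.2.trans ht) hs), if_pos (lt_of_le_of_ne (hst.2.trans ht) hs)]
  refine ⟨?_, fun t ht => ?_, fun t ht => ?_⟩
  · rw [← Set.Icc_union_Ici_eq_Ici ht₁]
    exact hcl.union_of_isClosed hcr isClosed_Icc isClosed_Ici
  · rcases le_total t t₁ with h1 | h1
    · exact hul t ht h1
    · exact (hul t₁ ht₁ le_rfl).trans (hur t h1)
  · rcases le_total t t₁ with h1 | h1
    · rw [hyl t h1]
      exact heql t ht h1
    · have hrhs : ∀ a b, a ≤ b → ContinuousOn (fun t => if t < t₁ then y t else z (t - t₁))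
          (Set.Icc a b) →
          IntervalIntegrable (fun t => if t < t₁ then u t else v (t - t₁)) volume a b →
          IntervalIntegrable (fun s => sysA ω *ᵥ (if s < t₁ then y s else z (s - t₁)) +
            (if s < t₁ then u s else v (s - t₁)) • sysB N) volume a b := by
        intro a b hab hc hi
        refine IntervalIntegrable.add ?_ (intervalIntegrable_state fun c => hi.mul_const _)
        refine ContinuousOn.intervalIntegrable ?_
        rw [Set.uIcc_of_le hab]
        exact (continuous_sysA_mulVec ω).comp_continuousOn hc
      rw [hyr t h1, h'.eq_integral (t - t₁) (sub_nonneg.mpr h1), heql t₁ ht₁ le_rfl, add_assoc,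
        ← intervalIntegral.integral_add_adjacent_intervals
          (hrhs 0 t₁ ht₁ hcl (hul t₁ ht₁ le_rfl))
          (hrhs t₁ t h1 (hcr.mono Set.Icc_subset_Ici_self) (hur t h1))]
      congr 2
      have hshift := intervalIntegral.integral_comp_sub_right
        (fun s => sysA ω *ᵥ z s + v s • sysB N) t₁ (a := t₁) (b := t)
      rw [sub_self] at hshift
      rw [← hshift]
      refine intervalIntegral.integral_congr fun s hs => ?_
      rw [Set.uIcc_of_le h1] at hs
      rw [if_neg (not_lt.mpr hs.1), if_neg (not_lt.mpr hs.1)]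

theorem exists_first_hit {y : ℝ → State N} (hy : ContinuousOn y (Set.Ici 0)) {S : Set (State N)}
    (hS : IsClosed S) {a : ℝ} (ha : 0 ≤ a) (h : ∃ t, a ≤ t ∧ y t ∈ S) :
    ∃ t, a ≤ t ∧ y t ∈ S ∧ ∀ s, a ≤ s → s < t → y s ∉ S := by
  obtain ⟨b, hab, hb⟩ := h
  have hc : IsCompact (Set.Icc a b ∩ y ⁻¹' S) :=
    isCompact_Icc.of_isClosed_subset ((hy.mono fun s hs => ha.trans hs.1
      ).preimage_isClosed_of_isClosed isClosed_Icc hS) Set.inter_subset_left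
  obtain ⟨t, ht, hmin⟩ := hc.exists_isLeast ⟨b, ⟨hab, le_rfl⟩, hb⟩
  refine ⟨t, ht.1.1, ht.2, fun s has hst hs => ?_⟩
  exact absurd (hmin ⟨⟨has, hst.le.trans ht.1.2⟩, hs⟩) (not_le.mpr hst)

theorem ae_comp_sub {p : ℝ → Prop} (h : ∀ᵐ t, p t) (c : ℝ) : ∀ᵐ t, p (t - c) :=
  (measurePreserving_sub_right volume c).quasiMeasurePreserving.ae h

/-- Switching to another motion at the first visit to a closed set. -/
theorem exists_switch {ω : Fin N → ℝ} {S : Set (State N)} (hS : IsClosed S)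
    {F : State N → ℝ → Prop} {Q : (ℝ → State N) → (ℝ → ℝ) → Prop} {x : State N}
    (h : ∃ y u, IsTrajectory ω x y u ∧ ∀ᵐ t, 0 ≤ t → y t ∉ S → F (y t) (u t))
    (h' : ∀ x' ∈ S, ∃ z v, IsTrajectory ω x' z v ∧ Q z v) :
    ∃ y u, IsTrajectory ω x y u ∧ ((∀ t, 0 ≤ t → y t ∉ S) ∧ (∀ᵐ t, 0 ≤ t → F (y t) (u t)) ∨
      ∃ t₁, 0 ≤ t₁ ∧ y t₁ ∈ S ∧ (∀ t, 0 ≤ t → t < t₁ → y t ∉ S) ∧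
        (∀ᵐ t, 0 ≤ t → t < t₁ → F (y t) (u t)) ∧
        ∃ z v, Q z v ∧ ∀ t, t₁ ≤ t → y t = z (t - t₁) ∧ u t = v (t - t₁)) := by
  obtain ⟨y, u, hy, hF⟩ := h
  by_cases hhit : ∃ t, 0 ≤ t ∧ y t ∈ S
  · obtain ⟨t₁, ht₁, hmem, hfirst⟩ := exists_first_hit hy.continuousOn hS le_rfl hhit
    obtain ⟨z, v, hz, hQ⟩ := h' _ hmem
    refine ⟨_, _, hy.concat ht₁ hz, Or.inr ⟨t₁, ht₁, ?_, fun t ht0 ht => ?_, ?_, z, v, hQ,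
      fun t ht => ⟨if_neg (not_lt.mpr ht), if_neg (not_lt.mpr ht)⟩⟩⟩
    · simp only [lt_irrefl, if_false, sub_self]
      rwa [hz.apply_zero_eq]
    · simp only [if_pos ht]
      exact hfirst t ht0 ht
    · filter_upwards [hF] with t hFt ht0 ht
      simp only [if_pos ht]
      exact hFt ht0 (hfirst t ht0 ht)
  · push Not at hhit
    exact ⟨y, u, hy, Or.inl ⟨hhit, hF.mono fun t ht h0 => ht h0 (hhit t h0)⟩⟩

theorem exists_two_stage_motion (hN : 0 < N) {ω : Fin N → ℝ} (hω : ∀ i, ω i ≠ 0)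
    (hsq : Function.Injective fun i => (ω i) ^ 2) {U Θ : ℝ} (hU : 0 ≤ U) (hΘ : 0 < Θ)
    (x : State N) : ∃ y u, IsTrajectory ω x y u ∧ ∀ᵐ t, 0 ≤ t →
      ((∀ s ∈ Set.Icc 0 t, y s ∉ terminalDomain ω Θ) → IsSignFeedback ω U (y t) (u t)) ∧
      ((∃ s ∈ Set.Icc 0 t, y s ∈ terminalDomain ω Θ) → u t = terminalControl ω (y t)) := by
  obtain ⟨y, u, hy, hcase⟩ := exists_switch (isClosed_terminalDomain hN ω Θ)
    (F := IsSignFeedback ω U) (Q := fun z v => ∀ t, v t = terminalControl ω (z t)) (x := x)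
    (by
      obtain ⟨y, u, hy, hu⟩ := exists_sign_motion hN hω hU x
      -- The sign feedback is only guaranteed away from 0, but 0 lies in the set that ends this
      -- stage.
      refine ⟨y, u, hy, hu.mono fun t ht h0 hG => ht h0 fun hy0 => hG ?_⟩
      rw [hy0]
      exact zero_mem_terminalDomain hN ω hΘ)
    (fun x' _ => exists_terminal_motion hN hω hsq x')
  refine ⟨y, u, hy, ?_⟩
  rcases hcase with ⟨hne, hF⟩ | ⟨t₁, ht₁, hmem, hne, hF, z, v, hQ, hzv⟩
  · filter_upwards [hF] with t ht h0
    exact ⟨fun _ => ht h0, fun ⟨s, hs, hsG⟩ => absurd hsG (hne s hs.1)⟩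
  · filter_upwards [hF] with t ht h0
    refine ⟨fun hG => ?_, fun ⟨s, hs, hsG⟩ => ?_⟩
    · refine ht h0 (not_le.mp fun hle => hG t₁ ⟨ht₁, hle⟩ hmem)
    · have hle : t₁ ≤ t := not_lt.mp fun hlt => hne s hs.1 (hs.2.trans_lt hlt) hsG
      rw [(hzv t hle).1, (hzv t hle).2, hQ]

theorem exists_threeStageMotion (hN : 0 < N) {ω : Fin N → ℝ} (hω : ∀ i, ω i ≠ 0)
    (hsq : Function.Injective fun i => (ω i) ^ 2) {R U Θ : ℝ} (hR : 0 < R) (hU : 0 ≤ U)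
    (hΘ : 0 < Θ) (x : State N) : ∃ y u, IsThreeStageMotion ω R U Θ x y u := by
  have hS : IsClosed {x : State N | rho ω x ≤ R} :=
    isClosed_le (continuous_rho hN hω) continuous_const
  obtain ⟨y, u, hy, hcase⟩ := exists_switch hS
    (F := IsSignFeedback ω 1) (Q := fun z v => ∀ᵐ t, 0 ≤ t →
      ((∀ s ∈ Set.Icc 0 t, z s ∉ terminalDomain ω Θ) → IsSignFeedback ω U (z t) (v t)) ∧
      ((∃ s ∈ Set.Icc 0 t, z s ∈ terminalDomain ω Θ) → v t = terminalControl ω (z t))) (x := x)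
    (by
      obtain ⟨y, u, hy, hu⟩ := exists_sign_motion hN hω zero_le_one x
      refine ⟨y, u, hy, hu.mono fun t ht h0 hG => ht h0 fun hy0 => hG ?_⟩
      rw [hy0, Set.mem_ofPred_eq, rho_zero]
      exact hR.le)
    (fun x' _ => exists_two_stage_motion hN hω hsq hU hΘ x')
  refine ⟨y, u, ?_⟩
  rcases hcase with ⟨hne, hF⟩ | ⟨t₁, ht₁, hmem, hne, hF, z, v, hQ, hzv⟩
  · have hfirst : ∀ t, InFirstStage ω R y t := fun t s hs => not_le.mp (hne s hs.1)
    refine ⟨hy, ?_, ?_, ?_⟩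
    · refine (ae_restrict_iff' measurableSet_Ici).mpr (hF.mono fun t ht h0 _ => ht h0)
    · exact Eventually.of_forall fun t ht => absurd (hfirst t) ht
    · exact Eventually.of_forall fun t ⟨s, _, hs, _⟩ => absurd (hfirst s) hs
  · have hfirst : ∀ t, InFirstStage ω R y t ↔ t < t₁ := fun t =>
      ⟨fun h => not_le.mp fun hle => absurd hmem (not_le.mpr (h t₁ ⟨ht₁, hle⟩)),
        fun h s hs => not_le.mp (hne s hs.1 (hs.2.trans_lt h))⟩
    have hthird : ∀ t, InThirdStage ω R Θ y t ↔ t₁ ≤ t ∧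
        ∃ s ∈ Set.Icc 0 (t - t₁), z s ∈ terminalDomain ω Θ := by
      intro t
      constructor
      · rintro ⟨s, hs, hns, hsG⟩
        rw [hfirst, not_lt] at hns
        refine ⟨hns.trans hs.2, s - t₁, ⟨sub_nonneg.mpr hns, by linarith [hs.2]⟩, ?_⟩
        rwa [← (hzv s hns).1]
      · rintro ⟨hle, s, hs, hsG⟩
        refine ⟨s + t₁, ⟨by linarith [hs.1], by linarith [hs.2]⟩, ?_, ?_⟩
        · rw [hfirst, not_lt]
          linarith [hs.1]
        · rwa [(hzv (s + t₁) (by linarith [hs.1])).1, add_sub_cancel_right]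
    have hQ' := ae_comp_sub hQ t₁
    refine ⟨hy, ?_, ?_, ?_⟩
    · refine (ae_restrict_iff' measurableSet_Ici).mpr (hF.mono fun t ht h0 hf => ?_)
      exact ht h0 ((hfirst t).mp hf)
    · refine (ae_restrict_iff' measurableSet_Ici).mpr (hQ'.mono fun t ht h0 hf hG => ?_)
      rw [hfirst, not_lt] at hf
      rw [(hzv t hf).1, (hzv t hf).2]
      refine (ht (sub_nonneg.mpr hf)).1 fun s hs hsG => hG ((hthird t).mpr ⟨hf, s, hs, hsG⟩)
    · refine (ae_restrict_iff' measurableSet_Ici).mpr (hQ'.mono fun t ht h0 hG => ?_)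
      obtain ⟨hf, hG⟩ := (hthird t).mp hG
      rw [(hzv t hf).1, (hzv t hf).2]
      exact (ht (sub_nonneg.mpr hf)).2 hG

/-! ### Duration of the stages -/

/-- The sign feedback of amplitude `U` diminishes `ρ` at the rate `(1 - ε) U`, up to the total
error `U K`, as long as `ρ ≥ U C`. -/
def DecaysWith (ω : Fin N → ℝ) (ε C K : ℝ) : Prop :=
  ∀ (x : State N) (y : ℝ → State N) (u : ℝ → ℝ) (U : ℝ), 0 < U →
    IsTrajectory ω x y u → ∀ a b, 0 ≤ a → a ≤ b →
    (∀ᵐ t, t ∈ Set.Ioc a b → IsSignFeedback ω U (y t) (u t)) →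
    (∀ t ∈ Set.Icc a b, U * C ≤ rho ω (y t)) →
    (1 - ε) * U * (b - a) ≤ rho ω (y a) - rho ω (y b) + U * K

/-- The feedback and the lower bound are assumed on [a, b) only, since at the hitting time b another
control may take over; the estimate passes to the limit from the left. -/
theorem DecaysWith.duration_le {ω : Fin N → ℝ} {ε C K : ℝ} (hdec : DecaysWith ω ε C K)
    {x : State N} {y : ℝ → State N} {u : ℝ → ℝ} {U : ℝ} (hU : 0 < U) (hK : 0 ≤ K)
    (htr : IsTrajectory ω x y u) {a b : ℝ} (ha : 0 ≤ a) (hab : a ≤ b)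
    (hsign : ∀ᵐ t, a ≤ t → t < b → IsSignFeedback ω U (y t) (u t))
    (hlow : ∀ t, a ≤ t → t < b → U * C ≤ rho ω (y t)) :
    (1 - ε) * U * (b - a) ≤ rho ω (y a) + U * K := by
  rcases hab.eq_or_lt with rfl | hlt
  · rw [sub_self, mul_zero]
    have := rho_nonneg ω (y a)
    positivity
  have hc : ContinuousAt (fun t => (1 - ε) * U * (t - a)) b := by fun_prop
  refine le_of_tendsto (hc.tendsto.mono_left (nhdsWithin_le_nhds (s := Set.Iio b))) ?_
  filter_upwards [Ioo_mem_nhdsLT hlt] with t ht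
  have := hdec x y u U hU htr a t ha ht.1.le
    (hsign.mono fun s hs hm => hs hm.1.le (hm.2.trans_lt ht.2))
    (fun s hs => hlow s hs.1 (hs.2.trans_lt ht.2))
  linarith [rho_nonneg ω (y t)]

/-- While the target is avoided, ρ ≥ UC and ρ falls at rate at least U/2 up to a bounded error. As ρ
≥ 0, this cannot last. -/
theorem DecaysWith.exists_hit {ω : Fin N → ℝ} {C K : ℝ} (hdec : DecaysWith ω (1 / 2) C K)
    (hK : 0 ≤ K) {x : State N} {y : ℝ → State N} {u : ℝ → ℝ} {U : ℝ} (hU : 0 < U)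
    (htr : IsTrajectory ω x y u) {a : ℝ} (ha : 0 ≤ a) {S : Set (State N)} (hS : IsClosed S)
    (hCS : ∀ z, rho ω z < U * C → z ∈ S)
    (hsign : ∀ b, (∀ s, a ≤ s → s < b → y s ∉ S) →
      ∀ᵐ t, a ≤ t → t < b → IsSignFeedback ω U (y t) (u t)) :
    ∃ b, a ≤ b ∧ y b ∈ S ∧ (∀ s, a ≤ s → s < b → y s ∉ S) ∧
      U * (b - a) ≤ 2 * (rho ω (y a) + U * K) := by
  have hbound : ∀ b, a ≤ b → (∀ s, a ≤ s → s < b → y s ∉ S) →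
      U * (b - a) ≤ 2 * (rho ω (y a) + U * K) := by
    intro b hab hb
    have := hdec.duration_le hU hK htr ha hab (hsign b hb)
      (fun t h1 h2 => not_lt.mp fun h3 => hb t h1 h2 (hCS _ h3))
    linarith
  have hhit : ∃ t, a ≤ t ∧ y t ∈ S := by
    by_contra! hne
    set B := 2 * (rho ω (y a) + U * K) with hB
    have hB0 : 0 ≤ B := by
      have := rho_nonneg ω (y a)
      positivity
    -- A duration just beyond the permitted bound B/U.
    have h1 := hbound (a + (B + 1) / U) (le_add_of_nonneg_right (by positivity))
      fun s hs _ => hne s hs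
    rw [add_sub_cancel_left, mul_div_cancel₀ _ hU.ne'] at h1
    linarith
  obtain ⟨b, hab, hbS, hb⟩ := exists_first_hit htr.continuousOn hS ha hhit
  exact ⟨b, hab, hbS, hb, hbound b hab hb⟩

theorem DecaysWith.mono {ω : Fin N → ℝ} {ε C C' K : ℝ} (h : DecaysWith ω ε C K) (hC : C ≤ C') :
    DecaysWith ω ε C' K := fun x y u U hU htr a b ha hab hsign hlow =>
  h x y u U hU htr a b ha hab hsign fun t ht =>
    (mul_le_mul_of_nonneg_left hC hU.le).trans (hlow t ht)

/-- The switching times of a motion under the three-stage control. -/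
structure SwitchingTimes (ω : Fin N → ℝ) (R U Θ : ℝ) (y : ℝ → State N) (u : ℝ → ℝ)
    (t₁ t₂ : ℝ) : Prop where
  nonneg : 0 ≤ t₁
  le : t₁ ≤ t₂
  rho_le : rho ω (y t₁) ≤ R
  lt_rho : ∀ t, 0 ≤ t → t < t₁ → R < rho ω (y t)
  mem : y t₂ ∈ terminalDomain ω Θ
  first : ∀ᵐ t, 0 ≤ t → t < t₁ → IsSignFeedback ω 1 (y t) (u t)
  second : ∀ᵐ t, t₁ ≤ t → t < t₂ → IsSignFeedback ω U (y t) (u t)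
  third : ∀ᵐ t, t₂ ≤ t → u t = terminalControl ω (y t)

/-- The stages are defined through the past of y; the first hitting times turn them into consecutive
intervals. The inclusions {ρ < C} ⊂ {ρ ≤ R} and {ρ ≤ UC} ⊂ G_Θ ensure that both targets are hit. -/
theorem IsThreeStageMotion.exists_switchingTimes (hN : 0 < N) {ω : Fin N → ℝ}
    (hω : ∀ i, ω i ≠ 0) {C K R U Θ : ℝ} (hdec : DecaysWith ω (1 / 2) C K) (hK : 0 ≤ K)
    (hR : C ≤ R) (hU : 0 < U) (hcov : CoversInefficient ω C Θ U) {x : State N}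
    {y : ℝ → State N} {u : ℝ → ℝ} (h : IsThreeStageMotion ω R U Θ x y u) :
    ∃ t₁ t₂, SwitchingTimes ω R U Θ y u t₁ t₂ ∧ U * (t₂ - t₁) ≤ 2 * (R + U * K) := by
  have htr := h.trajectory
  have hfirst := (ae_restrict_iff' measurableSet_Ici).mp h.first
  have hsecond := (ae_restrict_iff' measurableSet_Ici).mp h.second
  have hthird := (ae_restrict_iff' measurableSet_Ici).mp h.third
  have hS : IsClosed {x : State N | rho ω x ≤ R} :=
    isClosed_le (continuous_rho hN hω) continuous_const
  have hfirst_of : ∀ b, (∀ s, 0 ≤ s → s < b → y s ∉ {x : State N | rho ω x ≤ R}) →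
      ∀ᵐ t, 0 ≤ t → t < b → IsSignFeedback ω 1 (y t) (u t) := fun b hb =>
    hfirst.mono fun t ht h0 htb =>
      ht h0 fun s hs => not_le.mp (hb s hs.1 (hs.2.trans_lt htb))
  obtain ⟨t₁, ht₁, hmem₁, hlt₁, -⟩ := hdec.exists_hit hK one_pos htr le_rfl hS
    (fun z hz => by rw [one_mul] at hz; exact hz.le.trans hR) hfirst_of
  have hF : ∀ t, InFirstStage ω R y t ↔ t < t₁ := fun t =>
    ⟨fun h => not_le.mp fun hle => absurd hmem₁ (not_le.mpr (h t₁ ⟨ht₁, hle⟩)),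
      fun h s hs => not_le.mp (hlt₁ s hs.1 (hs.2.trans_lt h))⟩
  have hsecond_of : ∀ b, (∀ s, t₁ ≤ s → s < b → y s ∉ terminalDomain ω Θ) →
      ∀ᵐ t, t₁ ≤ t → t < b → IsSignFeedback ω U (y t) (u t) := fun b hb =>
    hsecond.mono fun t ht h1 htb => ht (ht₁.trans h1) (by rw [hF, not_lt]; exact h1) (by
      rintro ⟨s, hs, hns, hsG⟩
      rw [hF, not_lt] at hns
      exact hb s hns (hs.2.trans_lt htb) hsG)
  obtain ⟨t₂, ht₂, hmem₂, hlt₂, hdur⟩ := hdec.exists_hit hK hU htr ht₁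
    (isClosed_terminalDomain hN ω Θ) (fun z hz => hcov hz.le) hsecond_of
  refine ⟨t₁, t₂, ⟨ht₁, ht₂, hmem₁, fun t h0 h1 => not_le.mp (hlt₁ t h0 h1), hmem₂,
    hfirst_of t₁ hlt₁, hsecond_of t₂ hlt₂, hthird.mono fun t ht hle => ?_⟩, ?_⟩
  · exact ht (ht₁.trans (ht₂.trans hle))
      ⟨t₂, ⟨ht₁.trans ht₂, hle⟩, by rw [hF, not_lt]; exact ht₂, hmem₂⟩
  · have : rho ω (y t₁) ≤ R := hmem₁
    linarith

/-- In the third stage the terminal time does not grow, so the motion stays in G_Θ and hence in the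
strip; the two parts of the control are then at most 1/2 each. -/
theorem SwitchingTimes.isAdmissible (hN : 0 < N) {ω : Fin N → ℝ} (hω : ∀ i, ω i ≠ 0)
    (hsq : Function.Injective fun i => (ω i) ^ 2) {R U Θ : ℝ} (hU : U ≤ 1)
    (hstrip : InStrip ω Θ) {x : State N} {y : ℝ → State N} {u : ℝ → ℝ} {t₁ t₂ : ℝ}
    (h : SwitchingTimes ω R U Θ y u t₁ t₂) (htr : IsTrajectory ω x y u) : IsAdmissible u := by
  refine (ae_restrict_iff' measurableSet_Ici).mpr ?_
  filter_upwards [h.first, h.second, h.third] with t hf hs ht h0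
  rcases lt_or_ge t t₁ with h1 | h1
  · obtain ⟨p, -, hu, -⟩ := hf h0 h1
    exact hu
  rcases lt_or_ge t t₂ with h2 | h2
  · obtain ⟨p, -, hu, -⟩ := hs h1 h2
    exact hu.trans hU
  · have h3 := htr.terminalTime_le_of_terminalControl hN hω hsq (h.nonneg.trans h.le) h.third h2
    have h4 : |feedbackC ω ⬝ᵥ y t| ≤ 1 / 2 := hstrip (show y t ∈ terminalDomain ω Θ from
      h3.trans h.mem)
    rw [ht h2, terminalControl_eq]
    have := abs_add_le (canonControl (canon ω (y t))) (feedbackC ω ⬝ᵥ y t)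
    linarith [abs_canonControl_le hN (canon ω (y t))]

theorem SwitchingTimes.exists_arrival (hN : 0 < N) {ω : Fin N → ℝ} (hω : ∀ i, ω i ≠ 0)
    (hsq : Function.Injective fun i => (ω i) ^ 2) {R U Θ : ℝ} {x : State N} {y : ℝ → State N}
    {u : ℝ → ℝ} {t₁ t₂ : ℝ} (h : SwitchingTimes ω R U Θ y u t₁ t₂)
    (htr : IsTrajectory ω x y u) : ∃ T, IsArrivalTime y T ∧ T ≤ t₂ + Θ := by
  obtain ⟨t, ht, hyt⟩ := htr.exists_arrival_of_terminalControl hN hω hsq (h.nonneg.trans h.le)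
    h.third
  have ht0 : 0 ≤ t := (h.nonneg.trans h.le).trans ht.1
  obtain ⟨T, hT0, hyT, hT⟩ := exists_first_hit htr.continuousOn (isClosed_singleton (x := 0))
    le_rfl ⟨t, ht0, hyt⟩
  have hleast : IsArrivalTime y T := ⟨⟨hT0, hyT⟩, fun s hs => not_lt.mp fun hlt =>
    hT s hs.1 hlt hs.2⟩
  refine ⟨T, hleast, (hleast.2 ⟨ht0, hyt⟩).trans (ht.2.trans ?_)⟩
  have : terminalTime (canon ω (y t₂)) ≤ Θ := h.mem
  linarith

/-- The threshold C' for rate 1 - ε may exceed the fixed R, so the first stage is split at the level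
R' = max(C', R). Above it the sharp rate applies; below it the rate 1/2 suffices, because the time
spent there is bounded independently of x. -/
theorem exists_arrival_le (hN : 0 < N) {ω : Fin N → ℝ} (hω : ∀ i, ω i ≠ 0)
    (hres : ∀ m : Fin N → ℤ, ∑ i, (m i : ℝ) * ω i = 0 → m = 0)
    (hsq : Function.Injective fun i => (ω i) ^ 2) {C K R U Θ : ℝ}
    (hdec : DecaysWith ω (1 / 2) C K) (hK : 0 ≤ K) (hR : C ≤ R) (hU : 0 < U)
    (hcov : CoversInefficient ω C Θ U) {ε : ℝ} (hε : 0 < ε) (hε1 : ε < 1) :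
    ∃ K' : ℝ, ∀ x T, IsMotionTime ω R U Θ x T → (1 - ε) * T ≤ rho ω x + K' := by
  obtain ⟨C', K₁, hC', hK₁, hdec'⟩ := exists_decay hN hω hres hε
  replace hdec' : DecaysWith ω ε C' K₁ := hdec'
  set R' := max C' R with hR'
  -- The terms bound, in order, the error of the sharp estimate, the first stage below R', the
  -- second stage and the terminal stage.
  refine ⟨K₁ + (1 - ε) * (2 * (R' + K) + 2 * (R + U * K) / U + Θ), fun x T hT => ?_⟩
  obtain ⟨y, u, hm, hT⟩ := hT
  have htr := hm.trajectory
  obtain ⟨t₁, t₂, hsw, hdur⟩ := hm.exists_switchingTimes hN hω hdec hK hR hU hcov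
  obtain ⟨T', hT', hle⟩ := hsw.exists_arrival hN hω hsq htr
  have hTT : T = T' := hT.unique hT'
  have hS : IsClosed {x : State N | rho ω x ≤ R'} :=
    isClosed_le (continuous_rho hN hω) continuous_const
  obtain ⟨s, hs0, hsmem, hs⟩ := exists_first_hit htr.continuousOn hS le_rfl
    ⟨t₁, hsw.nonneg, hsw.rho_le.trans (le_max_right _ _)⟩
  have hst : s ≤ t₁ := not_lt.mp fun hlt =>
    hs t₁ hsw.nonneg hlt (hsw.rho_le.trans (le_max_right _ _))
  have hlt : ∀ t, 0 ≤ t → t < s → R' < rho ω (y t) := fun t h0 h1 => not_le.mp (hs t h0 h1)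
  have h1 := hdec'.duration_le one_pos hK₁.le htr le_rfl hs0
    (hsw.first.mono fun t ht h0 h1 => ht h0 (h1.trans_le hst))
    (fun t h0 h1 => by
      rw [one_mul]
      exact (le_max_left _ _).trans (hlt t h0 h1).le)
  have h2 := hdec.duration_le one_pos hK htr hs0 hst
    (hsw.first.mono fun t ht h0 h1 => ht (hs0.trans h0) h1)
    (fun t h0 h1 => by
      rw [one_mul]
      exact hR.trans (hsw.lt_rho t (hs0.trans h0) h1).le)
  have h3 : t₂ - t₁ ≤ 2 * (R + U * K) / U := by
    rw [le_div_iff₀ hU]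
    linarith
  have hrs : rho ω (y s) ≤ R' := hsmem
  rw [htr.apply_zero_eq] at h1
  have h4 : T ≤ s + (2 * (R' + K) + 2 * (R + U * K) / U + Θ) := by linarith
  have h5 := mul_le_mul_of_nonneg_left h4 (by linarith : 0 ≤ 1 - ε)
  linarith

/-! ### Comparison with the minimum time. -/

theorem minTime_le {ω : Fin N → ℝ} {x : State N} {y : ℝ → State N} {u : ℝ → ℝ} {T : ℝ}
    (htr : IsTrajectory ω x y u) (hu : IsAdmissible u) (hT : IsArrivalTime y T) :
    minTime ω x ≤ T :=
  csInf_le ⟨0, fun _ h => h.1⟩ ⟨hT.1.1, y, u, htr, hu, hT.1.2⟩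

/-- The assumed motion makes the set of steering times nonempty; otherwise its infimum would be 0 by
convention and bound nothing. -/
theorem exists_rho_le_minTime (hN : 0 < N) {ω : Fin N → ℝ} (hω : ∀ i, ω i ≠ 0)
    (hres : ∀ m : Fin N → ℤ, ∑ i, (m i : ℝ) * ω i = 0 → m = 0) {ε : ℝ} (hε : 0 < ε) :
    ∃ K : ℝ, ∀ x, (∃ (y : ℝ → State N) (u : ℝ → ℝ) (T : ℝ), IsTrajectory ω x y u ∧
      IsAdmissible u ∧ IsArrivalTime y T) → rho ω x ≤ (1 + ε) * minTime ω x + K := by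
  obtain ⟨K, hK, h⟩ := exists_rho_le_time hN hω hres hε
  refine ⟨K, fun x ⟨y, u, T, htr, hu, hT⟩ => ?_⟩
  have h1 : (rho ω x - K) / (1 + ε) ≤ minTime ω x := by
    refine le_csInf ⟨T, hT.1.1, y, u, htr, hu, hT.1.2⟩ ?_
    rintro S ⟨hS0, z, v, hz, hv, hzS⟩
    rw [div_le_iff₀ (by linarith)]
    linarith [h x z v hz hv S hS0 hzS]
  rw [div_le_iff₀ (by linarith)] at h1
  linarith

/-- For large f the additive constants are absorbed, giving (1 - ε)T ≤ (1 + ε)f and (1 - ε)f ≤ (1 +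
ε)m. Together with m ≤ T this squeezes both ratios. -/
theorem tendsto_ratios {α : Type*} {l : Filter α} {f m T : α → ℝ} (hf : Tendsto f l atTop)
    (h1 : ∀ ε, 0 < ε → ε < 1 → ∃ K, ∀ x, (1 - ε) * T x ≤ f x + K)
    (h2 : ∀ ε, 0 < ε → ε < 1 → ∃ K, ∀ x, f x ≤ (1 + ε) * m x + K)
    (hm : ∀ x, m x ≤ T x) :
    Tendsto (fun x => f x / T x) l (𝓝 1) ∧ Tendsto (fun x => m x / T x) l (𝓝 1) := by
  have key : ∀ ε, 0 < ε → ε < 1 → ∀ᶠ x in l, 0 < f x ∧ 0 < T x ∧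
      (1 - ε) * T x ≤ (1 + ε) * f x ∧ (1 - ε) * f x ≤ (1 + ε) * m x := by
    intro ε h0 hε1
    obtain ⟨K₁, hK₁⟩ := h1 ε h0 hε1
    obtain ⟨K₂, hK₂⟩ := h2 ε h0 hε1
    -- Beyond these thresholds each constant is at most εf.
    filter_upwards [hf.eventually_ge_atTop (K₁ / ε), hf.eventually_ge_atTop (K₂ / ε),
      hf.eventually_gt_atTop 0] with x hx1 hx2 hx3
    rw [div_le_iff₀ h0] at hx1 hx2
    have h4 : (1 - ε) * f x ≤ (1 + ε) * m x := by linarith [hK₂ x]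
    have h5 : 0 < (1 + ε) * m x := (mul_pos (by linarith) hx3).trans_le h4
    have h6 : 0 < m x := pos_of_mul_pos_right h5 (by linarith)
    exact ⟨hx3, h6.trans_le (hm x), by linarith [hK₁ x], h4⟩
  have hlow : Tendsto (fun ε : ℝ => (1 - ε) / (1 + ε)) (𝓝[>] 0) (𝓝 1) := by
    have : ContinuousAt (fun ε : ℝ => (1 - ε) / (1 + ε)) 0 :=
      ContinuousAt.div (by fun_prop) (by fun_prop) (by norm_num)
    have h := this.tendsto
    simp only [sub_zero, add_zero, div_one] at h
    exact h.mono_left nhdsWithin_le_nhds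
  have hlow2 : Tendsto (fun ε : ℝ => ((1 - ε) / (1 + ε)) ^ 2) (𝓝[>] 0) (𝓝 1) := by
    simpa using hlow.pow 2
  have hhigh : Tendsto (fun ε : ℝ => ((1 - ε) / (1 + ε))⁻¹) (𝓝[>] 0) (𝓝 1) := by
    simpa using hlow.inv₀ one_ne_zero
  have hsmall : ∀ᶠ ε : ℝ in 𝓝[>] 0, 0 < ε ∧ ε < 1 := Ioo_mem_nhdsGT one_pos
  refine ⟨tendsto_order.mpr ⟨fun r hr => ?_, fun r hr => ?_⟩,
    tendsto_order.mpr ⟨fun r hr => ?_, fun r hr => ?_⟩⟩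
  · obtain ⟨ε, hεr, h0, hε1⟩ := ((hlow.eventually_const_lt hr).and hsmall).exists
    filter_upwards [key ε h0 hε1] with x hx
    obtain ⟨hf0, hT0, h3, h4⟩ := hx
    refine hεr.trans_le ?_
    rw [div_le_div_iff₀ (by linarith) hT0]
    linarith
  · obtain ⟨ε, hεr, h0, hε1⟩ := ((hhigh.eventually_lt_const hr).and hsmall).exists
    filter_upwards [key ε h0 hε1] with x hx
    obtain ⟨hf0, hT0, h3, h4⟩ := hx
    refine lt_of_le_of_lt ?_ hεr
    rw [inv_div, div_le_div_iff₀ hT0 (by linarith)]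
    have := mul_le_mul_of_nonneg_left (hm x) (by linarith : 0 ≤ 1 + ε)
    linarith
  · obtain ⟨ε, hεr, h0, hε1⟩ := ((hlow2.eventually_const_lt hr).and hsmall).exists
    filter_upwards [key ε h0 hε1] with x hx
    obtain ⟨hf0, hT0, h3, h4⟩ := hx
    refine hεr.trans_le ?_
    rw [div_pow, div_le_div_iff₀ (by positivity) hT0]
    have h5 := mul_le_mul_of_nonneg_left h3 (by linarith : 0 ≤ 1 - ε)
    have h6 := mul_le_mul_of_nonneg_left h4 (by linarith : 0 ≤ 1 + ε)
    linarith
  · filter_upwards [key (1 / 2) (by norm_num) (by norm_num)] with x hx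
    exact ((div_le_one hx.2.1).mpr (hm x)).trans_lt hr

/-! ### Non-resonant frequencies -/

theorem frequency_ne_zero {ω : Fin N → ℝ}
    (hres : ∀ m : Fin N → ℤ, ∑ i, (m i : ℝ) * ω i = 0 → m = 0) (i : Fin N) : ω i ≠ 0 := by
  intro h
  have := hres (Pi.single i 1) (by
    rw [Finset.sum_eq_single i]
    · simp [h]
    · intro j _ hj
      simp [Pi.single_eq_of_ne hj]
    · simp)
  simpa using congrFun this i

/-- ω_i = ±ω_j with i ≠ j would be an integer relation with coefficients 1 and ∓1. -/
theorem injective_sq_frequency {ω : Fin N → ℝ}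
    (hres : ∀ m : Fin N → ℤ, ∑ i, (m i : ℝ) * ω i = 0 → m = 0) :
    Function.Injective fun i => (ω i) ^ 2 := by
  intro i j hij
  by_contra hne
  have hsum : ∀ c : ℤ, ∑ k, (((Pi.single i 1 + Pi.single j c : Fin N → ℤ) k : ℤ) : ℝ) * ω k =
      ω i + c * ω j := by
    intro c
    simp only [Pi.add_apply, Int.cast_add, add_mul, Finset.sum_add_distrib]
    congr 1
    · rw [Finset.sum_eq_single i] <;> simp +contextual
    · rw [Finset.sum_eq_single j] <;> simp +contextual
  have hcontra : ∀ c : ℤ, ω i + c * ω j ≠ 0 := by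
    intro c hc
    have := congrFun (hres _ ((hsum c).trans hc)) i
    simp [hne] at this
  rcases sq_eq_sq_iff_eq_or_eq_neg.mp hij with h | h
  · exact hcontra (-1) (by rw [h]; simp)
  · exact hcontra 1 (by rw [h]; simp)

end Oscillators

/-! ### Assembly of the theorem. -/

theorem theorem7 {N : ℕ} (hN : 0 < N) (ω : Fin N → ℝ)
    (hω : ∀ m : Fin N → ℤ, ∑ i, (m i : ℝ) * ω i = 0 → m = 0) :
    ∃ C₀ : ℝ, 0 < C₀ ∧ ∀ C : ℝ, C₀ ≤ C →
      (∀ᶠ Θ in 𝓝[>] (0 : ℝ), Oscillators.InStrip ω Θ) ∧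
      (∀ Θ : ℝ, 0 < Θ → ∀ᶠ U in 𝓝[>] (0 : ℝ), Oscillators.CoversInefficient ω C Θ U) ∧
      ∀ R Θ U : ℝ, C ≤ R → 0 < Θ → 0 < U → U ≤ 1 →
        Oscillators.InStrip ω Θ → Oscillators.CoversInefficient ω C Θ U →
        (∀ x, ∃ y u, Oscillators.IsThreeStageMotion ω R U Θ x y u) ∧
        (∀ x y u, Oscillators.IsThreeStageMotion ω R U Θ x y u →
          Oscillators.IsAdmissible u ∧ ∃ T, Oscillators.IsArrivalTime y T) ∧
        ∀ T : Oscillators.State N → ℝ,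
          (∀ x, Oscillators.IsMotionTime ω R U Θ x (T x)) →
          Tendsto (fun x => Oscillators.rho ω x / T x)
            (comap (Oscillators.rho ω) atTop) (𝓝 1) ∧
          Tendsto (fun x => Oscillators.minTime ω x / T x)
            (comap (Oscillators.rho ω) atTop) (𝓝 1) := by
  have hω0 := Oscillators.frequency_ne_zero hω
  have hsq := Oscillators.injective_sq_frequency hω
  -- The constant of the theorem comes from the rate 1/2 alone; sharper rates enter only through
  -- additive constants in the asymptotics.
  obtain ⟨C₀, K, hC₀, hK, hdec⟩ := Oscillators.exists_decay hN hω0 hω (one_half_pos (α := ℝ))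
  refine ⟨C₀, hC₀, fun C hC => ⟨Oscillators.eventually_inStrip hN hsq, fun Θ hΘ =>
    Oscillators.eventually_coversInefficient hN hω0 (hC₀.trans_le hC) hΘ, ?_⟩⟩
  intro R Θ U hR hΘ hU hU1 hstrip hcov
  have hdec' : Oscillators.DecaysWith ω (1 / 2) C K :=
    Oscillators.DecaysWith.mono (C := C₀) hdec hC
  have hmotion : ∀ x y u, Oscillators.IsThreeStageMotion ω R U Θ x y u →
      Oscillators.IsAdmissible u ∧ ∃ T, Oscillators.IsArrivalTime y T := by
    intro x y u h
    obtain ⟨t₁, t₂, hsw, -⟩ := h.exists_switchingTimes hN hω0 hdec' hK.le hR hU hcov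
    obtain ⟨T, hT, -⟩ := hsw.exists_arrival hN hω0 hsq h.trajectory
    exact ⟨hsw.isAdmissible hN hω0 hsq hU1 hstrip h.trajectory, T, hT⟩
  refine ⟨Oscillators.exists_threeStageMotion hN hω0 hsq (hC₀.trans_le (hC.trans hR)) hU.le hΘ,
    hmotion, fun T hT => ?_⟩
  refine Oscillators.tendsto_ratios tendsto_comap (fun ε h0 h1 => ?_) (fun ε h0 _ => ?_)
    fun x => ?_
  · obtain ⟨K', h⟩ :=
      Oscillators.exists_arrival_le hN hω0 hω hsq hdec' hK.le hR hU hcov h0 h1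
    exact ⟨K', fun x => h x (T x) (hT x)⟩
  · obtain ⟨K', h⟩ := Oscillators.exists_rho_le_minTime hN hω0 hω h0
    refine ⟨K', fun x => h x ?_⟩
    obtain ⟨y, u, hm, hTx⟩ := hT x
    exact ⟨y, u, T x, hm.trajectory, (hmotion x y u hm).1, hTx⟩
  · obtain ⟨y, u, hm, hTx⟩ := hT x
    exact Oscillators.minTime_le hm.trajectory (hmotion x y u hm).1 hTx
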